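/- Let $\mathcal A$ be a unital C$^*$-algebra over $\mathbb C$ and let $X:[0,1]\to\mathcal A$ be a smooth ($C^\infty$) path; write $\mathrm dX_r=X'(r)\,\mathrm dr$. **Trees and forests.** A levelled tree $\tau$ with $\|\tau\|=n$ internal vertices ($|\tau|=n+1$ leaves, $n$ faces) is identified with a permutation $\tau\in\mathfrak S_n$, $n\ge 0$: $\tau(i)$ is the level of the vertex on the face between the leaves $i$ and $i+1$. Write $\tau'\subset\tau$ if $\tau'=\tau\cap[p]$ for some $0\le p\le n$, i.e. $\tau'$ is the subword of the letters $\le p$ of the word $\tau(1)\cdots\tau(n)$. A levelled forest $f=(\sigma,c)$ with $\mathsf{nt}(f)=p+1$ trees and $\|f\|=k$ vertices is a permutation $\sigma\in\mathfrak S_k$ with a weak composition $c=(c_1,\dots,c_{p+1})$ of $k$ ($c_j$ is the number of vertices of the $j$-th tree). For $\tau'=\tau\cap[p]$, the forest $\tau\setminus\tau'$ has as permutation the standardization of the subword of the letters $>p$ of $\tau$, and as $c$ the numbers of letters $>p$ before, between and after the letters $\le p$. For $\emptyset\ne I\subset\{1,\dots,p\}$, $f^I$ is obtained from $f$ by gluing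 the trees $i$ and $i+1$ for all $i\in I$ (i.e. adding up the corresponding parts of $c$), and $\ell^f_j=\sum_{i\le j}(c_i+1)$ is the number, among the $p+k$ faces of $f$ from left to right, of the face between the trees $j$ and $j+1$. **Faces-contractions.** For a word $a=a_0\otimes\cdots\otimes a_n$ and $\tau\in\mathfrak S_n$, let $\sharp(a\,\tau)$ be the $n$-linear map $(x_1,\dots,x_n)\mapsto a_0x_{\tau(1)}a_1\cdots x_{\tau(n)}a_n$ (inputs are numbered by levels). Let $\mathsf{FC}(\tau)$ be the closure in operator norm of the span of these maps in the bounded $n$-linear maps $\mathcal A^n\to\mathcal A$ (so $\mathsf{FC}(\bullet)=\mathcal A$ for the tree $\bullet$ without vertices), let $\mathsf{LT}^\sharp(\mathsf{FC})=\bigoplus_\tau\mathsf{FC}(\tau)$ be the algebraic direct sum and let $\mathsf{LT}^\sharp(\mathcal A)=\bigoplus_\tau\mathcal A^{\otimes|\tau|}$, with completed projective tensor powers; $\sharp$ extends to $\sharp:\mathsf{LT}^\sharp(\mathcal A)\to\mathsf{LT}^\sharp(\mathsf{FC})$. For $m\in\mathsf{FC}(\tau)$, $m'\in\mathsf{FC}(\tau')$,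 $\|\tau\|=n$, $\|\tau'\|=n'$, the product $m \mathbin{\sqcup\!\sqcup} m'$ is the sum, over all permutations $s$ of $\{1,\dots,n+n'\}$ which are increasing on $\{1,\dots,n\}$ and on $\{n+1,\dots,n+n'\}$, of the operators $x\mapsto m(x_{s(1)},\dots,x_{s(n)})\,m'(x_{s(n+1)},\dots,x_{s(n+n')})\in\mathsf{FC}(s\circ(\tau\otimes\tau'))$, where $\tau\otimes\tau'$ is the shifted concatenation; the unit is $1\in\mathsf{FC}(\bullet)$. The involution sends $m\in\mathsf{FC}(\tau)$ to $x\mapsto m(x_1^*,\dots,x_n^*)^*$, an element of $\mathsf{FC}(\theta(\tau))$ where $\theta(\tau)$ is the reversed word (the mirror image of $\tau$); thus $\star\sharp((a_0\otimes\cdots\otimes a_n)\tau)=\sharp((a_n^*\otimes\cdots\otimes a_0^*)\theta(\tau))$. **The group $G(\mathsf{FC})$.** For $\sigma\in\mathfrak S_n$ let $\phi_\sigma:\mathsf{FC}(\tau)\to\mathsf{FC}(\sigma\tau)$ be the isometry $\phi_\sigma(m)(y)=m(y_{\sigma(1)},\dots,y_{\sigma(n)})$, which sends $\sharp(a\,\tau)$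 to $\sharp(a\,\sigma\tau)$, and put $\mathsf{FC}(n)=\mathsf{FC}(\mathrm{id}_n)$ (inputs numbered by faces). The component $\mathcal X(\tau',\tau):\mathsf{FC}(\|\tau\|)\to\mathsf{FC}(\|\tau'\|)$ of a linear endomorphism $\mathcal X$ of $\mathsf{LT}^\sharp(\mathsf{FC})$ sends $m$ to the image by $\phi_{\tau'^{-1}}$ of the $\mathsf{FC}(\tau')$-part of $\mathcal X(\phi_\tau(m))$. For $k\ge 1$ and $Y_1,\dots,Y_k\in\mathcal A$, the endomorphism $C_{Y_1,\dots,Y_k}$ sends $m\in\mathsf{FC}(\tau)$ to $(x_1,\dots,x_p)\mapsto m(x_1,\dots,x_p,Y_1,\dots,Y_k)\in\mathsf{FC}(\tau\cap[p])$ if $p=\|\tau\|-k\ge 0$, and to $0$ otherwise. Let $\mathcal C$ be the closure of the linear span of the identity and of all the $C_{Y_1,\dots,Y_k}$, for the topology of operator-norm convergence of the components $\mathsf{FC}(\tau)\to\mathsf{FC}(\tau')$, uniformly in $\tau'$ and in $\tau\in T$ for each finite set $T$ of trees. Let $U(\mathsf{FC})$ be the set of the endomorphisms $\mathcal X$ of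 the unital algebra $(\mathsf{LT}^\sharp(\mathsf{FC}),\mathbin{\sqcup\!\sqcup})$ such that $(\mathcal X-\mathrm{id})(\mathsf{FC}(\tau))\subset\bigoplus_{\tau'\subsetneq\tau}\mathsf{FC}(\tau')$ for all $\tau$. Then $G(\mathsf{FC})$ is the set of the $\mathcal X\in U(\mathsf{FC})\cap\mathcal C$ such that $$\mathcal X(f)(m)\circ_{i_1,\dots,i_q}(w_1,\dots,w_q)=\mathcal X(f^{I})\big(m\circ_{\ell^f_{i_1},\dots,\ell^f_{i_q}}(w_1,\dots,w_q)\big)$$ for all levelled forests $f$, all $I=\{i_1<\dots<i_q\}\subset\{1,\dots,\mathsf{nt}(f)-1\}$ with $q\ge1$, all $m\in\mathsf{FC}(\|f\|+\mathsf{nt}(f)-1)$ and all $w_1,\dots,w_q\in\mathcal A$. Here $\circ_{j_1,\dots,j_q}$ is substitution in the inputs $j_1,\dots,j_q$, and $\mathcal X(f)$ is the common value of the components $\mathcal X(\tau',\tau)$ with $\tau'\subset\tau$ and $\tau\setminus\tau'=f$. **The endomorphisms.** For $s,t\in[0,1]$, integrals over $\{t>t_1>\dots>t_k>s\}$ mean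 $\int_s^t\int_s^{t_1}\cdots\int_s^{t_{k-1}}$, with oriented integrals if $s>t$. The non-commutative signature $\mathcal X_{s,t}$ is the endomorphism of $\mathsf{LT}^\sharp(\mathsf{FC})$ which sends $m\in\mathsf{FC}(\tau)$, $\|\tau\|=n$, to the sum over $0\le p\le n$ of the elements $$(y_1,\dots,y_p)\mapsto\int_{t>t_1>\dots>t_{n-p}>s}m(y_1,\dots,y_p,\mathrm dX_{t_1},\dots,\mathrm dX_{t_{n-p}})$$ of $\mathsf{FC}(\tau\cap[p])$. For a forest $f=(\sigma,c)$ with $p+1$ trees and $k$ vertices, the partial contraction $\bar{\mathbb X}^f_{s,t}:\mathcal A^{\otimes(p+k+1)}\to\mathcal A^{\otimes(p+1)}$ sends $a_0\otimes\cdots\otimes a_{p+k}$ to the integral over $t>t_1>\dots>t_k>s$ of the tensor obtained by placing the $a$'s on the leaves of $f$ from left to right and $\mathrm dX_{t_{\sigma(r)}}$ on its $r$-th vertex from left to right, and multiplying, from left to right, within each tree. Finally $\bar{\mathbb X}_{s,t}(a\,\tau)=\sum_{\tau'\subset\tau}\bar{\mathbb X}^{\tau\setminus\tau'}_{s,t}(a)\,\tau'$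 on $\mathsf{LT}^\sharp(\mathcal A)$. **Theorem.** For all $s,u,t\in[0,1]$: 1. $\mathcal X_{s,t}\in G(\mathsf{FC})$; 2. $\mathcal X_{s,t}=\mathcal X_{u,t}\circ\mathcal X_{s,u}$; 3. $\sharp\circ\bar{\mathbb X}_{s,t}=\mathcal X_{s,t}\circ\sharp$. If moreover $X_r^*=X_r$ for all $r\in[0,1]$, then $\mathcal X_{s,t}$ is a morphism of unital $\star$-algebras of $\mathsf{LT}^\sharp(\mathsf{FC})$ for all $s,t\in[0,1]$. -/

import Mathlib

open scoped ContDiff TensorProduct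

noncomputable section

namespace NCSignature

open Equiv

/-! ### Levelled trees and forests -/

/-- A levelled binary tree with `n` internal vertices (hence `n` faces and `n + 1` leaves), encoded
by its permutation: `τ i` is the level of the vertex lying between the leaves `i` and `i + 1`.
Faces, leaves and levels are numbered from `0`; the root has level `0`. -/
abbrev LevelledTree : Type := Σ n : ℕ, Perm (Fin n)

lemma card_positions {n p : ℕ} (τ : Perm (Fin n)) (S : Finset (Fin n)) (h : S.card = p) :
    (S.map τ.symm.toEmbedding).card = p := by simpa using h

/-- The standardization of the subword of the word `τ 0, τ 1, …` formed by the letters in `S`. -/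
def subword {n p : ℕ} (τ : Perm (Fin n)) (S : Finset (Fin n)) (h : S.card = p) : Perm (Fin p) :=
  ((S.map τ.symm.toEmbedding).orderIsoOfFin (card_positions τ S h)).toEquiv.trans
    ((τ.subtypeEquiv (p := fun i => i ∈ S.map τ.symm.toEmbedding) (q := fun l => l ∈ S)
      (fun i => by simp)).trans (S.orderIsoOfFin h).symm.toEquiv)

/-- The `p` lowest levels. -/
def lowLevels (n p : ℕ) : Finset (Fin n) := Finset.univ.filter fun l => (l : ℕ) < p

/-- All levels but the `p` lowest ones. -/
def highLevels (n p : ℕ) : Finset (Fin n) := Finset.univ.filter fun l => p ≤ (l : ℕ)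

lemma card_lowLevels {n p : ℕ} (h : p ≤ n) : (lowLevels n p).card = p := by
  have := Fin.card_filter_val_lt (n := n) (m := p)
  simp [lowLevels, this, h]

lemma card_highLevels {n p k : ℕ} (h : p + k = n) : (highLevels n p).card = k := by
  have h1 := card_lowLevels (n := n) (p := p) (by omega)
  have h2 := Finset.card_filter_add_card_filter_not (s := (Finset.univ : Finset (Fin n)))
    (fun l => (l : ℕ) < p)
  simp only [lowLevels] at h1
  simp only [not_lt, Finset.card_univ, Fintype.card_fin] at h2
  simp only [highLevels]
  omega

/-- The subtree `τ ∩ [p]` made of the `p` lowest generations of `τ`. -/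
def lower {n p : ℕ} (τ : Perm (Fin n)) (h : p ≤ n) : Perm (Fin p) :=
  subword τ (lowLevels n p) (card_lowLevels h)

/-- `σ` is a subtree of `τ`, different from `τ`. -/
def IsProperSubtree (σ τ : LevelledTree) : Prop :=
  ∃ h : σ.1 < τ.1, σ.2 = lower τ.2 h.le

/-- A levelled forest with `p + 1` trees and `k` internal vertices, as a split permutation: a
permutation together with a weak composition of `k` of length `p + 1`, whose `j`-th part is the
number of internal vertices of the `j`-th tree. -/
@[ext]
structure LevelledForest (p k : ℕ) where
  perm : Perm (Fin k)
  comp : Fin (p + 1) → ℕ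
  sum_comp : ∑ j, comp j = k

namespace LevelledForest

variable {p k : ℕ}

/-- The internal vertices of a forest, as pairs (tree, face of this tree), numbered from left to
right. -/
def vertexEquiv (f : LevelledForest p k) : (Σ j, Fin (f.comp j)) ≃ Fin k :=
  finSigmaFinEquiv.trans (finCongr f.sum_comp)

/-- The level of the `r`-th vertex (from left to right) of the `j`-th tree. -/
def level (f : LevelledForest p k) (j : Fin (p + 1)) (r : Fin (f.comp j)) : Fin k :=
  f.perm (f.vertexEquiv ⟨j, r⟩)

/-- The leaves of a forest, as pairs (tree, leaf of this tree), numbered from left to right. -/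
def leafEquiv (f : LevelledForest p k) {n : ℕ} (h : p + k = n) :
    (Σ j, Fin (f.comp j + 1)) ≃ Fin (n + 1) :=
  finSigmaFinEquiv.trans (finCongr (by
    have := f.sum_comp
    simp only [Finset.sum_add_distrib, this, Finset.sum_const, Finset.card_univ, Fintype.card_fin,
      smul_eq_mul, mul_one]
    omega))

/-- The face of a forest lying between its trees `j` and `j + 1`. The faces of a forest with
`p + 1` trees and `k` vertices, numbered from left to right, are the `k` faces of its trees and the
`p` faces between two consecutive trees. -/
def gap (f : LevelledForest p k) (j : Fin p) : Fin (p + k) :=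
  ⟨j + ∑ i ∈ Finset.Iic j.castSucc, f.comp i, by
    have h1 : ∑ i ∈ Finset.Iic j.castSucc, f.comp i ≤ ∑ i, f.comp i :=
      Finset.sum_le_sum_of_subset (Finset.subset_univ _)
    have h2 := f.sum_comp
    omega⟩

lemma gap_strictMono (f : LevelledForest p k) : StrictMono f.gap := by
  intro i j hij
  have h1 : ∑ l ∈ Finset.Iic i.castSucc, f.comp l ≤ ∑ l ∈ Finset.Iic j.castSucc, f.comp l :=
    Finset.sum_le_sum_of_subset (Finset.Iic_subset_Iic.2 (by simpa using hij.le))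
  rw [Fin.lt_def] at hij ⊢
  simp only [gap]
  omega

/-- The faces of `f` between the trees `j` and `j + 1` for `j ∈ I`. -/
def gaps (f : LevelledForest p k) (I : Finset (Fin p)) : Finset (Fin (p + k)) :=
  I.map ⟨f.gap, f.gap_strictMono.injective⟩

lemma card_compl_gaps (f : LevelledForest p k) (I : Finset (Fin p)) :
    (f.gaps I)ᶜ.card = Iᶜ.card + k := by
  have h : I.card ≤ p := by simpa using I.card_le_univ
  simp only [gaps, Finset.card_compl, Fintype.card_fin, Finset.card_map]
  omega

/-- The forest `f ^ I` obtained from `f` by gluing the trees `i` and `i + 1` along their external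
edges, for all `i ∈ I`. The tree `j` of `f` becomes a part of the tree of `f ^ I` whose number is
the number of positions `i < j` which do not belong to `I`. -/
def glue (f : LevelledForest p k) (I : Finset (Fin p)) : LevelledForest Iᶜ.card k where
  perm := f.perm
  comp l := ∑ j with (Iᶜ.filter fun i => i.castSucc < j).card = (l : ℕ), f.comp j
  sum_comp := by
    have h := Finset.sum_fiberwise (Finset.univ : Finset (Fin (p + 1)))
      (fun j => (⟨(Iᶜ.filter fun i => i.castSucc < j).card,
        Nat.lt_succ_of_le (Finset.card_filter_le _ _)⟩ : Fin (Iᶜ.card + 1))) f.comp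
    simp only [Fin.ext_iff] at h
    rw [h, f.sum_comp]

end LevelledForest

/-- The forest `τ \ τ'` where `τ' = τ ∩ [p]`: it is what remains of `τ` above its `p` lowest
generations. Its permutation is the standardization of the subword of `τ` of the levels `≥ p`, and
a face of `τ` of level `≥ p` belongs to the `j`-th tree when there are `j` faces of level `< p` to
its left. -/
def upper {n p k : ℕ} (τ : Perm (Fin n)) (h : p + k = n) : LevelledForest p k where
  perm := subword τ (highLevels n p) (card_highLevels h)
  comp j := (Finset.univ.filter fun i => p ≤ (τ i : ℕ) ∧
    (Finset.univ.filter fun i' => i' < i ∧ (τ i' : ℕ) < p).card = (j : ℕ)).card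
  sum_comp := by
    have hcard : (Finset.univ.filter fun i => p ≤ (τ i : ℕ)).card = k := by
      rw [← card_highLevels h]
      exact Finset.card_equiv τ (fun i => by simp [highLevels])
    have hle : ∀ i : Fin n,
        (Finset.univ.filter fun i' => i' < i ∧ (τ i' : ℕ) < p).card < p + 1 := by
      intro i
      have h1 : (Finset.univ.filter fun i' => i' < i ∧ (τ i' : ℕ) < p).card ≤
          (lowLevels n p).card := by
        refine Finset.card_le_card_of_injOn τ ?_ τ.injective.injOn
        intro i' hi'
        simpa [lowLevels] using (Finset.mem_filter.1 (Finset.mem_coe.1 hi')).2.2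
      rw [card_lowLevels (by omega)] at h1
      omega
    have hsum := Finset.card_eq_sum_card_fiberwise
      (s := Finset.univ.filter fun i => p ≤ (τ i : ℕ)) (t := Finset.univ)
      (f := fun i => (⟨_, hle i⟩ : Fin (p + 1))) (fun _ _ => by simp)
    simp only [Fin.ext_iff, Finset.filter_filter] at hsum
    rw [← hsum, hcard]

end NCSignature
end
noncomputable section

namespace NCSignature

open Equiv

section Operators

variable {A : Type*} [CStarAlgebra A]

variable (A) in
/-- Bounded `n`-linear maps from `A` to `A`, with the operator norm. -/
abbrev MultOp (n : ℕ) : Type _ := ContinuousMultilinearMap ℂ (fun _ : Fin n => A) A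

/-- The value `a₀ · x_{τ(0)} · a₁ ⋯ x_{τ(n-1)} · aₙ` of the global faces-contraction map of the
word `a` and the tree `τ`: the variable `x l` is placed on the face of level `l`. -/
def interleave {n : ℕ} (τ : Perm (Fin n)) (a : Fin (n + 1) → A) (x : Fin n → A) : A :=
  a 0 * (List.ofFn fun i => x (τ i) * a i.succ).prod

/-- The closure, for the operator norm, of the linear span of the global faces-contraction maps
of `τ`. -/
def FCSubmodule {n : ℕ} (τ : Perm (Fin n)) : Submodule ℂ (MultOp A n) :=
  (Submodule.span ℂ {m : MultOp A n | ∃ a : Fin (n + 1) → A, ∀ x, m x = interleave τ a x}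
    ).topologicalClosure

lemma isClosed_FCSubmodule {n : ℕ} (τ : Perm (Fin n)) :
    IsClosed (FCSubmodule (A := A) τ : Set (MultOp A n)) :=
  Submodule.isClosed_topologicalClosure _

/-- The space `FC(τ)` of `τ`-faces-contractions, with the operator norm. It is `FCSubmodule τ`,
as a type. -/
def FC {n : ℕ} (τ : Perm (Fin n)) : Type _ := FCSubmodule (A := A) τ

instance {n : ℕ} (τ : Perm (Fin n)) : NormedAddCommGroup (FC (A := A) τ) :=
  inferInstanceAs (NormedAddCommGroup (FCSubmodule (A := A) τ))

instance {n : ℕ} (τ : Perm (Fin n)) : NormedSpace ℂ (FC (A := A) τ) :=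
  inferInstanceAs (NormedSpace ℂ (FCSubmodule (A := A) τ))

instance {n : ℕ} (τ : Perm (Fin n)) : CompleteSpace (FC (A := A) τ) :=
  (isClosed_FCSubmodule τ).completeSpace_coe

/-- A faces-contraction as an operator. -/
def FC.toOp {n : ℕ} (τ : Perm (Fin n)) : FC (A := A) τ →L[ℂ] MultOp A n :=
  (FCSubmodule (A := A) τ).subtypeL

lemma FC.toOp_mem {n : ℕ} (τ : Perm (Fin n)) (m : FC (A := A) τ) :
    FC.toOp τ m ∈ FCSubmodule τ := m.2

lemma FC.toOp_injective {n : ℕ} (τ : Perm (Fin n)) :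
    Function.Injective (FC.toOp (A := A) τ) := Subtype.val_injective

lemma FC.norm_toOp {n : ℕ} (τ : Perm (Fin n)) (m : FC (A := A) τ) : ‖FC.toOp τ m‖ = ‖m‖ := rfl

/-- An operator which belongs to `FC(τ)`, as an element of this space. -/
def FC.mk {n : ℕ} (τ : Perm (Fin n)) (m : MultOp A n) (h : m ∈ FCSubmodule τ) : FC (A := A) τ :=
  Subtype.mk m h

lemma FC.toOp_mk {n : ℕ} (τ : Perm (Fin n)) (m : MultOp A n) (h : m ∈ FCSubmodule τ) :
    FC.toOp τ (FC.mk τ m h) = m := rfl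

/-- Restriction of the codomain to `FC(τ)`. -/
def FC.codRestrict {E : Type*} [TopologicalSpace E] [AddCommMonoid E] [Module ℂ E] {n : ℕ}
    (τ : Perm (Fin n)) (L : E →L[ℂ] MultOp A n) (h : ∀ x, L x ∈ FCSubmodule τ) : E →L[ℂ] FC (A := A) τ :=
  ContinuousLinearMap.codRestrict L (FCSubmodule τ) h

lemma FC.toOp_codRestrict {E : Type*} [TopologicalSpace E] [AddCommMonoid E] [Module ℂ E] {n : ℕ}
    (τ : Perm (Fin n)) (L : E →L[ℂ] MultOp A n) (h : ∀ x, L x ∈ FCSubmodule τ) (x : E) :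
    FC.toOp τ (FC.codRestrict τ L h x) = L x := rfl

lemma mem_FC_of_interleave {n : ℕ} {τ : Perm (Fin n)} {m : MultOp A n} (a : Fin (n + 1) → A)
    (h : ∀ x, m x = interleave τ a x) : m ∈ FCSubmodule τ :=
  Submodule.le_topologicalClosure _ (Submodule.subset_span ⟨a, h⟩)

instance {n : ℕ} (τ : Perm (Fin n)) : CompleteSpace (FC (A := A) τ) :=
  (isClosed_FCSubmodule τ).completeSpace_coe

lemma FC_le_comap {n p : ℕ} {τ : Perm (Fin n)} {ρ : Perm (Fin p)} (L : MultOp A n →L[ℂ] MultOp A p)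
    (hL : ∀ (m : MultOp A n) (a : Fin (n + 1) → A), (∀ x, m x = interleave τ a x) →
      L m ∈ FCSubmodule ρ) (m : MultOp A n) (hm : m ∈ FCSubmodule τ) : L m ∈ FCSubmodule ρ := by
  have h : FCSubmodule τ ≤ (FCSubmodule ρ).comap L.toLinearMap := by
    refine Submodule.topologicalClosure_minimal _ (Submodule.span_le.2 ?_) ?_
    · rintro m ⟨a, ha⟩
      exact hL m a ha
    · exact (isClosed_FCSubmodule ρ).preimage L.continuous
  exact h hm

/-! ### Filling some of the inputs of an operator -/

/-- The tuple indexed by `Fin n` whose entries at the places in `S` are, in increasing order, those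
of `y`, and whose other entries are those of `x`. -/
def fillInputs {n p : ℕ} (S : Finset (Fin n)) (h : S.card = p) (x : Fin n → A) (y : Fin p → A) :
    Fin n → A :=
  fun l => if hl : l ∈ S then y ((S.orderIsoOfFin h).symm ⟨l, hl⟩) else x l

lemma fillInputs_update {n p : ℕ} [DecidableEq (Fin p)] (S : Finset (Fin n)) (h : S.card = p)
    (x : Fin n → A) (y : Fin p → A) (j : Fin p) (z : A) :
    fillInputs S h x (Function.update y j z) =
      Function.update (fillInputs S h x y) (S.orderIsoOfFin h j) z := by
  ext l
  by_cases hl : l ∈ S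
  · simp only [fillInputs, hl, dif_pos, Function.update_apply]
    simp only [OrderIso.symm_apply_eq, Subtype.ext_iff]
  · have hne : l ≠ S.orderIsoOfFin h j := fun e => hl (e ▸ (S.orderIsoOfFin h j).2)
    rw [Function.update_of_ne hne]
    simp [fillInputs, hl]

lemma prod_norm_fillInputs {n p : ℕ} (S : Finset (Fin n)) (h : S.card = p) (x : Fin n → A)
    (y : Fin p → A) :
    ∏ l, ‖fillInputs S h x y l‖ = (∏ l ∈ Sᶜ, ‖x l‖) * ∏ j, ‖y j‖ := by
  rw [← Finset.prod_mul_prod_compl S, mul_comm]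
  congr 1
  · refine Finset.prod_congr rfl fun l hl => ?_
    simp [fillInputs, Finset.mem_compl.1 hl]
  · rw [← Finset.prod_attach, ← Finset.univ_eq_attach]
    refine (Fintype.prod_equiv (S.orderIsoOfFin h).toEquiv _ _ fun j => ?_).symm
    have hj : (S.orderIsoOfFin h j : Fin n) ∈ S := (S.orderIsoOfFin h j).2
    simp only [fillInputs, RelIso.coe_fn_toEquiv, hj, dif_pos]
    rw [Subtype.coe_eta, OrderIso.symm_apply_apply]

/-- The operator obtained from `m` by giving the values of `x` to its inputs out of `S`. -/
def fillOp {n p : ℕ} (S : Finset (Fin n)) (h : S.card = p) (x : Fin n → A) (m : MultOp A n) :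
    MultOp A p where
  toFun y := m (fillInputs S h x y)
  map_update_add' y j z z' := by simp only [fillInputs_update, m.map_update_add]
  map_update_smul' y j c z := by simp only [fillInputs_update, m.map_update_smul]
  cont := by
    refine m.cont.comp (continuous_pi fun l => ?_)
    by_cases hl : l ∈ S
    · simpa only [fillInputs, hl, dif_pos] using continuous_apply _
    · simpa only [fillInputs, hl, dif_neg, not_false_iff] using continuous_const

lemma fillOp_apply {n p : ℕ} (S : Finset (Fin n)) (h : S.card = p) (x : Fin n → A)
    (m : MultOp A n) (y : Fin p → A) : fillOp S h x m y = m (fillInputs S h x y) := rfl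

def fillOpL {n p : ℕ} (S : Finset (Fin n)) (h : S.card = p) (x : Fin n → A) :
    MultOp A n →L[ℂ] MultOp A p :=
  LinearMap.mkContinuous
    { toFun := fillOp S h x
      map_add' := fun _ _ => rfl
      map_smul' := fun _ _ => rfl } (∏ l ∈ Sᶜ, ‖x l‖) (fun m => by
        refine ContinuousMultilinearMap.opNorm_le_bound (by positivity) fun y => ?_
        refine (m.le_opNorm _).trans (le_of_eq ?_)
        rw [prod_norm_fillInputs]
        ring)

lemma exists_regroup {ι : Type*} (P : ι → Prop) [DecidablePred P] (u c : ι → A) (L : List ι) :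
    ∀ a : A, ∃ b₀ : A, ∃ b : List A, b.length = (L.filter P).length ∧ ∀ y : ι → A,
      a * (L.map fun i => (if P i then y i else c i) * u i).prod =
        b₀ * (List.zipWith (fun i d => y i * d) (L.filter P) b).prod := by
  induction L with
  | nil => exact fun a => ⟨a, [], by simp, by simp⟩
  | cons i L ih =>
    intro a
    by_cases hi : P i
    · obtain ⟨b₀, b, hb, h⟩ := ih (u i)
      refine ⟨a, b₀ :: b, by simp [hi, hb], fun y => ?_⟩
      have hy := h y
      simp only [hi, decide_true, List.filter_cons_of_pos, List.map_cons, if_true, List.prod_cons,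
        List.zipWith_cons_cons]
      rw [mul_assoc, mul_assoc, hy]
    · obtain ⟨b₀, b, hb, h⟩ := ih (a * (c i * u i))
      refine ⟨b₀, b, by simp [hi, hb], fun y => ?_⟩
      simpa [hi, mul_assoc] using h y

lemma filter_finRange {n p : ℕ} (P : Finset (Fin n)) (h : P.card = p) :
    (List.finRange n).filter (· ∈ P) = List.ofFn fun j : Fin p => (P.orderIsoOfFin h j : Fin n) := by
  have h1 : (List.ofFn fun j : Fin p => (P.orderIsoOfFin h j : Fin n)) = P.sort := by
    subst h
    simp only [Finset.coe_orderIsoOfFin_apply, Finset.orderEmbOfFin_apply]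
    apply List.ext_getElem <;> simp
  rw [h1]
  refine List.Perm.eq_of_pairwise (le := (· ≤ ·)) (fun a b _ _ => le_antisymm) ?_ ?_ ?_
  · exact ((List.pairwise_lt_finRange n).imp le_of_lt).filter _
  · exact P.pairwise_sort (· ≤ ·)
  · refine (List.perm_ext_iff_of_nodup ((List.nodup_finRange n).filter _) (P.sort_nodup _)).2 ?_
    intro a
    simp

lemma fillOp_mem_FC {n p : ℕ} (τ : Perm (Fin n)) (S : Finset (Fin n)) (h : S.card = p)
    (x : Fin n → A) (m : MultOp A n) (hm : m ∈ FCSubmodule τ) :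
    fillOpL S h x m ∈ FCSubmodule (subword τ S h) := by
  refine FC_le_comap _ (fun m a ha => ?_) m hm
  set P := S.map τ.symm.toEmbedding with hP
  have hPc : P.card = p := card_positions τ S h
  obtain ⟨b₀, b, hb, hreg⟩ := exists_regroup (fun i => i ∈ P) (fun i => a i.succ)
    (fun i => x (τ i)) (List.finRange n) (a 0)
  rw [filter_finRange P hPc, List.length_ofFn] at hb
  refine mem_FC_of_interleave (Fin.cons b₀ fun j => b[j]'(by simp [hb])) fun y => ?_
  have hmem : ∀ i, i ∈ P ↔ τ i ∈ S := fun i => by simp [hP]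
  have hfill : ∀ i, fillInputs S h x y (τ i) = if i ∈ P then
      (if hl : τ i ∈ S then y ((S.orderIsoOfFin h).symm ⟨τ i, hl⟩) else 0) else x (τ i) := by
    intro i
    by_cases hi : τ i ∈ S
    · simp [fillInputs, hmem, hi]
    · simp [fillInputs, hmem, hi]
  change m (fillInputs S h x y) = _
  rw [ha, interleave, interleave, List.ofFn_eq_map]
  simp only [hfill]
  rw [hreg]
  simp only [Fin.cons_zero, Fin.cons_succ]
  congr 2
  rw [filter_finRange P hPc]
  apply List.ext_getElem
  · simp [hb]
  · intro i h1 h2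
    have hi : i < p := by simpa using h2
    have hmemS : τ (P.orderIsoOfFin hPc ⟨i, hi⟩) ∈ S := (hmem _).1 (P.orderIsoOfFin hPc ⟨i, hi⟩).2
    simp only [List.getElem_zipWith, List.getElem_ofFn, hmemS, dif_pos, Fin.getElem_fin]
    rfl

/-- `fillOp` as a bounded operator between spaces of faces-contractions. -/
def fillFC {n p : ℕ} (τ : Perm (Fin n)) (S : Finset (Fin n)) (h : S.card = p) (x : Fin n → A)
    {ρ : Perm (Fin p)} (hρ : subword τ S h = ρ) : FC (A := A) τ →L[ℂ] FC (A := A) ρ :=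
  FC.codRestrict ρ ((fillOpL S h x).comp (FC.toOp τ))
    (fun m => hρ ▸ fillOp_mem_FC τ S h x _ (FC.toOp_mem τ m))

lemma subword_one {n p : ℕ} (S : Finset (Fin n)) (h : S.card = p) :
    subword (1 : Perm (Fin n)) S h = 1 := by
  have key : ∀ (T : Finset (Fin n)) (hT : T.card = p) (_ : T = S) (j : Fin p),
      ((T.orderIsoOfFin hT j : Fin n)) = S.orderIsoOfFin h j := by
    rintro T hT rfl j; rfl
  ext j
  have : subword (1 : Perm (Fin n)) S h j = j := by
    simp only [subword, Equiv.trans_apply, RelIso.coe_fn_toEquiv]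
    rw [OrderIso.symm_apply_eq]
    apply Subtype.ext
    simpa using key _ (card_positions 1 S h) (by ext; simp) j
  simp [this]

/-- Contraction of the inputs of the `k` highest levels of a `τ`-faces-contraction with
`v 0, …, v (k - 1)`, see `contract_apply`. -/
def contract {n p k : ℕ} (τ : Perm (Fin n)) (h : p + k = n) (v : Fin k → A) :
    FC (A := A) τ →L[ℂ] FC (A := A) (lower τ (h ▸ Nat.le_add_right p k)) :=
  fillFC τ (lowLevels n p) (card_lowLevels (h ▸ Nat.le_add_right p k))
    (fun l => if hl : p ≤ (l : ℕ) then v ⟨l - p, by omega⟩ else 0) rfl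

lemma contract_apply {p k : ℕ} (τ : Perm (Fin (p + k))) (v : Fin k → A) (m : FC (A := A) τ)
    (y : Fin p → A) : FC.toOp _ (contract τ rfl v m) y = FC.toOp τ m (Fin.append y v) := by
  change FC.toOp τ m (fillInputs _ _ _ _) = _
  congr 1
  have key : ∀ (j : Fin p), ((lowLevels (p + k) p).orderIsoOfFin
      (card_lowLevels (Nat.le_add_right p k)) j : Fin (p + k)) = Fin.castAdd k j := by
    have := Finset.orderEmbOfFin_unique (s := lowLevels (p + k) p)
      (card_lowLevels (Nat.le_add_right p k)) (f := Fin.castAdd k)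
      (fun j => by simp [lowLevels]) (Fin.strictMono_castAdd k)
    intro j
    rw [Finset.coe_orderIsoOfFin_apply, ← this]
  ext l
  refine Fin.addCases (fun j => ?_) (fun j => ?_) l
  · have hl : Fin.castAdd k j ∈ lowLevels (p + k) p := by simp [lowLevels]
    simp only [fillInputs, hl, dif_pos, Fin.append_left]
    congr 1
    rw [OrderIso.symm_apply_eq]
    exact Subtype.ext (key j).symm
  · simp [fillInputs, lowLevels]

end Operators
end NCSignature
end
noncomputable section

namespace NCSignature

open Equiv

section Algebra

variable {A : Type*} [CStarAlgebra A]

/-! ### The space of faces-contractions, with its product and its involution -/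

variable (A) in
/-- The space `LT^♯(FC) = ⨁ FC(τ)`. -/
abbrev LTFC : Type _ := DirectSum LevelledTree fun τ => FC (A := A) τ.2

/-- The inclusion of `FC(τ)` in `LT^♯(FC)`. -/
abbrev incl {n : ℕ} (τ : Perm (Fin n)) : FC (A := A) τ →ₗ[ℂ] LTFC A :=
  DirectSum.lof ℂ LevelledTree (fun τ => FC (A := A) τ.2) ⟨n, τ⟩

lemma interleave_update_var {n : ℕ} (τ : Perm (Fin n)) (a : Fin (n + 1) → A) (x : Fin n → A)
    (l : Fin n) (z : A) : interleave τ a (Function.update x l z) =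
      a 0 * MultilinearMap.mkPiAlgebraFin ℂ n A
        (Function.update (fun i => x (τ i) * a i.succ) (τ.symm l) (z * a (τ.symm l).succ)) := by
  rw [interleave, MultilinearMap.mkPiAlgebraFin_apply]
  congr 3
  ext i
  by_cases h : i = τ.symm l
  · subst h; simp
  · have h' : τ i ≠ l := fun e => h (by simp [← e])
    simp [h, h']

lemma interleave_update_zero {n : ℕ} (τ : Perm (Fin n)) (a : Fin (n + 1) → A) (x : Fin n → A)
    (z : A) : interleave τ (Function.update a 0 z) x =
      z * (List.ofFn fun i => x (τ i) * a i.succ).prod := by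
  simp [interleave]

lemma interleave_update_succ {n : ℕ} (τ : Perm (Fin n)) (a : Fin (n + 1) → A) (x : Fin n → A)
    (j : Fin n) (z : A) : interleave τ (Function.update a j.succ z) x =
      a 0 * MultilinearMap.mkPiAlgebraFin ℂ n A
        (Function.update (fun i => x (τ i) * a i.succ) j (x (τ j) * z)) := by
  rw [interleave, MultilinearMap.mkPiAlgebraFin_apply,
    Function.update_of_ne (Fin.succ_ne_zero j).symm]
  congr 3
  ext i
  by_cases h : i = j
  · subst h; simp
  · simp [h]

lemma norm_mul_prod_le (a : A) (L : List A) : ‖a * L.prod‖ ≤ ‖a‖ * (L.map norm).prod := by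
  induction L generalizing a with
  | nil => simp
  | cons b L ih =>
    have h := ih (a * b)
    rw [List.prod_cons, ← mul_assoc, List.map_cons, List.prod_cons, ← mul_assoc]
    refine h.trans (mul_le_mul_of_nonneg_right (norm_mul_le a b) ?_)
    exact List.prod_nonneg (by simp)

lemma norm_interleave_le {n : ℕ} (τ : Perm (Fin n)) (a : Fin (n + 1) → A) (x : Fin n → A) :
    ‖interleave τ a x‖ ≤ (∏ i, ‖a i‖) * ∏ i, ‖x i‖ := by
  refine (norm_mul_prod_le _ _).trans ?_
  rw [List.map_ofFn, List.prod_ofFn, Fin.prod_univ_succ, mul_assoc,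
    ← Equiv.prod_comp τ fun i => ‖x i‖, ← Finset.prod_mul_distrib]
  refine mul_le_mul_of_nonneg_left (Finset.prod_le_prod (fun _ _ => norm_nonneg _) fun i _ => ?_)
    (norm_nonneg _)
  rw [mul_comm ‖a i.succ‖]
  exact norm_mul_le (x (τ i)) (a i.succ)

/-- The global faces-contraction map `♯(a τ)`, as a bounded multilinear function of the word `a`. -/
def sharpOp {n : ℕ} (τ : Perm (Fin n)) :
    ContinuousMultilinearMap ℂ (fun _ : Fin (n + 1) => A) (MultOp A n) :=
  MultilinearMap.mkContinuousMultilinear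
    { toFun := fun a =>
        { toFun := interleave τ a
          map_update_add' := fun {inst} x l z z' => by
            rw [Subsingleton.elim inst (instDecidableEqFin n)]
            simp only [interleave_update_var, add_mul, MultilinearMap.map_update_add, mul_add]
          map_update_smul' := fun {inst} x l c z => by
            rw [Subsingleton.elim inst (instDecidableEqFin n)]
            simp only [interleave_update_var, smul_mul_assoc, MultilinearMap.map_update_smul,
              mul_smul_comm] }
      map_update_add' := fun {inst} a j z z' => by
        rw [Subsingleton.elim inst (instDecidableEqFin (n + 1))]
        ext x
        refine Fin.cases ?_ (fun j => ?_) j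
        · simp [interleave_update_zero, add_mul]
        · simp [interleave_update_succ, mul_add]
      map_update_smul' := fun {inst} a j c z => by
        rw [Subsingleton.elim inst (instDecidableEqFin (n + 1))]
        ext x
        refine Fin.cases ?_ (fun j => ?_) j
        · simp [interleave_update_zero]
        · simp [interleave_update_succ] } 1 (fun a x => by
    rw [one_mul]
    exact norm_interleave_le τ a x)

lemma sharpOp_apply {n : ℕ} (τ : Perm (Fin n)) (a : Fin (n + 1) → A) (x : Fin n → A) :
    sharpOp τ a x = interleave τ a x := rfl

lemma sharpOp_mem_FC {n : ℕ} (τ : Perm (Fin n)) (a : Fin (n + 1) → A) : sharpOp τ a ∈ FCSubmodule τ :=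
  mem_FC_of_interleave a fun _ => rfl

/-- `sharpOp`, with values in `FC(τ)`. -/
def sharpOpFC {n : ℕ} (τ : Perm (Fin n)) :
    ContinuousMultilinearMap ℂ (fun _ : Fin (n + 1) => A) (FC (A := A) τ) where
  toFun a := FC.mk τ (sharpOp τ a) (sharpOp_mem_FC τ a)
  map_update_add' a i z z' := FC.toOp_injective τ ((sharpOp τ).map_update_add a i z z')
  map_update_smul' a i c z := FC.toOp_injective τ ((sharpOp τ).map_update_smul a i c z)
  cont := Continuous.subtype_mk (sharpOp τ).cont _

variable (A) in
/-- The unit of `LT^♯(FC)`, namely `1 ∈ A = FC(∙)` where `∙` is the tree without faces. -/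
def unitFC : LTFC A :=
  incl (1 : Perm (Fin 0)) (sharpOpFC 1 fun _ => 1)

/-- `s` is a shuffle of `{0, …, n - 1}` and `{n, …, n + n' - 1}`: it is increasing on both. -/
def IsShuffle {n n' : ℕ} (s : Perm (Fin (n + n'))) : Prop :=
  (∀ i j : Fin n, i < j → s (Fin.castAdd n' i) < s (Fin.castAdd n' j)) ∧
    ∀ i j : Fin n', i < j → s (Fin.natAdd n i) < s (Fin.natAdd n j)

instance {n n' : ℕ} : DecidablePred (IsShuffle (n := n) (n' := n')) := fun s => by
  unfold IsShuffle; infer_instance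

/-- The shifted concatenation `τ ⊗ τ'` of two permutations. -/
def tensorPerm {n n' : ℕ} (τ : Perm (Fin n)) (τ' : Perm (Fin n')) : Perm (Fin (n + n')) :=
  finSumFinEquiv.permCongr (τ.sumCongr τ')

lemma tensorPerm_castAdd {n n' : ℕ} (τ : Perm (Fin n)) (τ' : Perm (Fin n')) (i : Fin n) :
    tensorPerm τ τ' (Fin.castAdd n' i) = Fin.castAdd n' (τ i) := by
  simp [tensorPerm, Equiv.permCongr_apply]

lemma tensorPerm_natAdd {n n' : ℕ} (τ : Perm (Fin n)) (τ' : Perm (Fin n')) (i : Fin n') :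
    tensorPerm τ τ' (Fin.natAdd n i) = Fin.natAdd n (τ' i) := by
  simp [tensorPerm, Equiv.permCongr_apply]

/-- The operator `x ↦ m (x (s 0), …, x (s (n - 1))) · m' (x (s n), …, x (s (n + n' - 1)))`. -/
def mulOp {n n' : ℕ} (s : Perm (Fin (n + n'))) (m : MultOp A n) (m' : MultOp A n') :
    MultOp A (n + n') where
  toMultilinearMap := (LinearMap.mul' ℂ A).compMultilinearMap
    ((m.toMultilinearMap.domCoprod m'.toMultilinearMap).domDomCongr (finSumFinEquiv.trans s))
  cont := by
    have h1 : Continuous fun x : Fin (n + n') → A => m fun i => x (s (Fin.castAdd n' i)) :=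
      m.cont.comp (by fun_prop)
    have h2 : Continuous fun x : Fin (n + n') → A => m' fun i => x (s (Fin.natAdd n i)) :=
      m'.cont.comp (by fun_prop)
    exact h1.mul h2

lemma mulOp_apply {n n' : ℕ} (s : Perm (Fin (n + n'))) (m : MultOp A n) (m' : MultOp A n')
    (x : Fin (n + n') → A) : mulOp s m m' x =
      (m fun i => x (s (Fin.castAdd n' i))) * m' fun i => x (s (Fin.natAdd n i)) := rfl

lemma mulOp_add_left {n n' : ℕ} (s : Perm (Fin (n + n'))) (m₁ m₂ : MultOp A n) (m' : MultOp A n') :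
    mulOp s (m₁ + m₂) m' = mulOp s m₁ m' + mulOp s m₂ m' := by
  ext x; simp [mulOp_apply, add_mul]

lemma mulOp_smul_left {n n' : ℕ} (s : Perm (Fin (n + n'))) (c : ℂ) (m : MultOp A n)
    (m' : MultOp A n') : mulOp s (c • m) m' = c • mulOp s m m' := by
  ext x; simp [mulOp_apply]

lemma mulOp_add_right {n n' : ℕ} (s : Perm (Fin (n + n'))) (m : MultOp A n)
    (m₁ m₂ : MultOp A n') : mulOp s m (m₁ + m₂) = mulOp s m m₁ + mulOp s m m₂ := by
  ext x; simp [mulOp_apply, mul_add]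

lemma mulOp_smul_right {n n' : ℕ} (s : Perm (Fin (n + n'))) (c : ℂ) (m : MultOp A n)
    (m' : MultOp A n') : mulOp s m (c • m') = c • mulOp s m m' := by
  ext x; simp [mulOp_apply]

/-- `mulOp` as a bounded bilinear map. -/
def mulOpL {n n' : ℕ} (s : Perm (Fin (n + n'))) :
    MultOp A n →L[ℂ] MultOp A n' →L[ℂ] MultOp A (n + n') :=
  LinearMap.mkContinuous₂ (LinearMap.mk₂ ℂ (mulOp s) (mulOp_add_left s) (mulOp_smul_left s)
    (mulOp_add_right s) (mulOp_smul_right s)) 1 (fun m m' => by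
      refine ContinuousMultilinearMap.opNorm_le_bound (by positivity) fun x => ?_
      refine (norm_mul_le _ _).trans ?_
      rw [← Equiv.prod_comp s, Fin.prod_univ_add, one_mul, mul_mul_mul_comm]
      exact mul_le_mul (m.le_opNorm _) (m'.le_opNorm _) (norm_nonneg _) (by positivity))

lemma mulOpL_apply {n n' : ℕ} (s : Perm (Fin (n + n'))) (m : MultOp A n) (m' : MultOp A n') :
    mulOpL (A := A) s m m' = mulOp s m m' := rfl

lemma interleave_mul {n : ℕ} (τ : Perm (Fin n)) (a : Fin (n + 1) → A) (x : Fin n → A) (d : A) :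
    interleave τ a x * d =
      interleave τ (Function.update a (Fin.last n) (a (Fin.last n) * d)) x := by
  cases n with
  | zero =>
    have : (Fin.last 0) = 0 := rfl
    simp [interleave, this]
  | succ n =>
    rw [← Fin.succ_last, interleave_update_succ, ← mul_assoc, ← smul_eq_mul]
    simp only [MultilinearMap.mkPiAlgebraFin_apply, interleave]
    rw [List.ofFn_succ_last, List.ofFn_succ_last]
    simp [mul_assoc]

lemma mulOp_mem_FC {n n' : ℕ} (s : Perm (Fin (n + n'))) (τ : Perm (Fin n)) (τ' : Perm (Fin n'))
    (m : MultOp A n) (m' : MultOp A n') (hm : m ∈ FCSubmodule τ) (hm' : m' ∈ FCSubmodule τ') :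
    mulOp s m m' ∈ FCSubmodule (s * tensorPerm τ τ') := by
  refine FC_le_comap (mulOpL (A := A) s m) (fun m' b hb => ?_) m' hm'
  refine FC_le_comap ((mulOpL (A := A) s).flip m') (fun m a ha => ?_) m hm
  set a' := Function.update a (Fin.last n) (a (Fin.last n) * b 0) with ha'
  refine mem_FC_of_interleave
    (Fin.cons (a' 0) (Fin.append (fun i : Fin n => a' i.succ) fun i : Fin n' => b i.succ))
    fun x => ?_
  change mulOp s m m' x = _
  rw [mulOp_apply, ha, hb, interleave.eq_1 τ', ← mul_assoc, interleave_mul, ← ha', interleave,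
    interleave, List.ofFn_add, List.prod_append, mul_assoc]
  have hc : ∀ i : Fin n, (Fin.castLE (Nat.le_add_right n n') i) = Fin.castAdd n' i := fun _ => rfl
  simp only [Fin.cons_zero, Fin.cons_succ, Perm.mul_apply, hc, tensorPerm_castAdd,
    tensorPerm_natAdd, Fin.append_left, Fin.append_right]

/-- `mulOp` on faces-contractions. -/
def mulFC {n n' : ℕ} (s : Perm (Fin (n + n'))) (τ : Perm (Fin n)) (τ' : Perm (Fin n')) :
    FC (A := A) τ →ₗ[ℂ] FC (A := A) τ' →ₗ[ℂ] FC (A := A) (s * tensorPerm τ τ') :=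
  LinearMap.mk₂ ℂ
    (fun m m' => FC.mk _ (mulOp s (FC.toOp τ m) (FC.toOp τ' m'))
      (mulOp_mem_FC s τ τ' _ _ (FC.toOp_mem τ m) (FC.toOp_mem τ' m')))
    (fun m₁ m₂ m' => FC.toOp_injective _
      (mulOp_add_left s (FC.toOp τ m₁) (FC.toOp τ m₂) (FC.toOp τ' m')))
    (fun c m m' => FC.toOp_injective _
      (mulOp_smul_left s c (FC.toOp τ m) (FC.toOp τ' m')))
    (fun m m₁ m₂ => FC.toOp_injective _
      (mulOp_add_right s (FC.toOp τ m) (FC.toOp τ' m₁) (FC.toOp τ' m₂)))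
    (fun c m m' => FC.toOp_injective _
      (mulOp_smul_right s c (FC.toOp τ m) (FC.toOp τ' m')))

variable (A) in
/-- The shuffle product on `LT^♯(FC)`: for `m ∈ FC(τ)` and `m' ∈ FC(τ')`, it is the sum of the
operators `mulOp s m m' ∈ FC(s ∘ (τ ⊗ τ'))` over all shuffles `s`. -/
def shuffle : LTFC A →ₗ[ℂ] LTFC A →ₗ[ℂ] LTFC A :=
  DirectSum.toModule ℂ LevelledTree _ fun τ₁ => LinearMap.flip <|
    DirectSum.toModule ℂ LevelledTree _ fun τ₂ => LinearMap.flip <|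
      ∑ s : {s : Perm (Fin (τ₁.1 + τ₂.1)) // IsShuffle s},
        (mulFC s.1 τ₁.2 τ₂.2).compr₂ (incl (s.1 * tensorPerm τ₁.2 τ₂.2))

/-- The operator `x ↦ (m (x₀⋆, x₁⋆, …))⋆`. -/
def starOp {n : ℕ} (m : MultOp A n) : MultOp A n where
  toFun x := star (m fun i => star (x i))
  map_update_add' x i z z' := by
    have h : ∀ z, (fun j => star (Function.update x i z j)) =
        Function.update (fun j => star (x j)) i (star z) := fun z => by
      ext j; by_cases hj : j = i <;> simp [hj]
    simp only [h, star_add, m.map_update_add]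
  map_update_smul' x i c z := by
    have h : ∀ z, (fun j => star (Function.update x i z j)) =
        Function.update (fun j => star (x j)) i (star z) := fun z => by
      ext j; by_cases hj : j = i <;> simp [hj]
    simp only [h, star_smul, m.map_update_smul, star_star]
  cont := (m.cont.comp (by fun_prop)).star

lemma starOp_apply {n : ℕ} (m : MultOp A n) (x : Fin n → A) :
    starOp m x = star (m fun i => star (x i)) := rfl

/-- `starOp` as an additive map. -/
def starOpHom (n : ℕ) : MultOp A n →+ MultOp A n where
  toFun := starOp
  map_zero' := by ext x; simp [starOp_apply]
  map_add' m m' := by ext x; simp [starOp_apply]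

lemma continuous_starOpHom (n : ℕ) : Continuous (starOpHom (A := A) n) := by
  refine AddMonoidHomClass.continuous_of_bound _ 1 fun m => ?_
  rw [one_mul]
  refine ContinuousMultilinearMap.opNorm_le_bound (norm_nonneg _) fun x => ?_
  change ‖star (m fun i => star (x i))‖ ≤ _
  rw [norm_star]
  simpa using m.le_opNorm fun i => star (x i)

lemma star_interleave {n : ℕ} (a : Fin (n + 1) → A) (y : Fin n → A) :
    star (a 0 * (List.ofFn fun i => y i * a i.succ).prod) = star (a (Fin.last n)) *
      (List.ofFn fun i : Fin n => star (y i.rev) * star (a i.succ.rev)).prod := by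
  induction n with
  | zero => simp
  | succ n ih =>
    have h := ih (fun i => a i.succ) (fun i => y i.succ)
    rw [List.ofFn_succ, List.prod_cons, mul_assoc (y 0), star_mul, star_mul]
    simp only [Fin.succ_zero_eq_one] at h ⊢
    rw [h, List.ofFn_succ_last, List.prod_append]
    simp [mul_assoc, Fin.rev_castSucc, Fin.rev_succ]

lemma starOp_mem_FC {n : ℕ} (τ : Perm (Fin n)) (m : MultOp A n) (hm : m ∈ FCSubmodule τ) :
    starOp m ∈ FCSubmodule (τ * Fin.revPerm) := by
  let T : Submodule ℂ (MultOp A n) :=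
    { carrier := {m | starOp m ∈ FCSubmodule (τ * Fin.revPerm)}
      add_mem' := fun {m m'} h h' => by
        have := (FCSubmodule (A := A) (τ * Fin.revPerm)).add_mem h h'
        rwa [show starOp m + starOp m' = starOp (m + m') from
          ((starOpHom n).map_add m m').symm] at this
      zero_mem' := by
        have := (FCSubmodule (A := A) (τ * Fin.revPerm)).zero_mem
        rwa [show (0 : MultOp A n) = starOp 0 from (starOpHom n).map_zero.symm] at this
      smul_mem' := fun c m h => by
        have := (FCSubmodule (A := A) (τ * Fin.revPerm)).smul_mem (star c) h
        rwa [show star c • starOp m = starOp (c • m) by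
          ext x; simp [starOp_apply]] at this }
  have h : FCSubmodule τ ≤ T := by
    refine Submodule.topologicalClosure_minimal _ (Submodule.span_le.2 ?_) ?_
    · rintro m ⟨a, ha⟩
      refine mem_FC_of_interleave (fun i => star (a i.rev)) fun x => ?_
      rw [starOp_apply, ha, interleave, star_interleave]
      simp [interleave]
    · exact (isClosed_FCSubmodule (τ * Fin.revPerm)).preimage (continuous_starOpHom n)
  exact h hm

/-- `starOp` on faces-contractions. -/
def starFC {n : ℕ} (τ : Perm (Fin n)) :
    FC (A := A) τ →+ FC (A := A) (τ * Fin.revPerm) where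
  toFun m := FC.mk _ (starOp (FC.toOp τ m)) (starOp_mem_FC τ _ (FC.toOp_mem τ m))
  map_zero' := FC.toOp_injective _ (starOpHom (A := A) n).map_zero
  map_add' m m' := FC.toOp_injective _ ((starOpHom n).map_add (FC.toOp τ m) (FC.toOp τ m'))

variable (A) in
/-- The involution of `LT^♯(FC)`. It sends `FC(τ)` to `FC(θ τ)`, where `θ τ` is the mirror image of
`τ`, and it is characterized by `⋆ ♯((a₀ ⊗ ⋯ ⊗ aₙ) τ) = ♯((aₙ⋆ ⊗ ⋯ ⊗ a₀⋆) θ τ)`. Inputs are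
numbered by levels, which `θ` preserves; numbered by faces from left to right, they are reversed. -/
def starMap : LTFC A →+ LTFC A :=
  DirectSum.toAddMonoid fun τ =>
    (DirectSum.of (fun τ : LevelledTree => FC (A := A) τ.2) ⟨τ.1, τ.2 * Fin.revPerm⟩).comp
      (starFC τ.2)

/-! ### Faces-contractions with inputs numbered by faces -/

/-- The space `FC(n)` of faces-contractions of the tree of the identity permutation. Inputs of its
elements are numbered by faces, from left to right. -/
abbrev FCid (A : Type*) [CStarAlgebra A] (n : ℕ) : Type _ :=
  FC (A := A) (1 : Perm (Fin n))

/-- The map `φ_σ : FC(τ) → FC(σ τ)`, which sends `♯(a τ)` to `♯(a (σ τ))`. -/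
def relabel {n : ℕ} (σ : Perm (Fin n)) {τ ρ : Perm (Fin n)} (h : σ * τ = ρ) :
    FC (A := A) τ →L[ℂ] FC (A := A) ρ :=
  FC.codRestrict ρ ((ContinuousMultilinearMap.domDomCongrₗᵢ ℂ A A σ :
      MultOp A n ≃ₗᵢ[ℂ] MultOp A n).toContinuousLinearEquiv.toContinuousLinearMap.comp (FC.toOp τ))
    (fun m => by
      refine FC_le_comap (ContinuousMultilinearMap.domDomCongrₗᵢ ℂ A A σ :
        MultOp A n ≃ₗᵢ[ℂ] MultOp A n).toContinuousLinearEquiv.toContinuousLinearMap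
        (fun m a ha => ?_) _ (FC.toOp_mem τ m)
      refine mem_FC_of_interleave a fun x => ?_
      subst h
      exact ha fun i => x (σ i))

lemma relabel_apply {n : ℕ} (σ : Perm (Fin n)) {τ ρ : Perm (Fin n)} (h : σ * τ = ρ)
    (m : FC (A := A) τ) (x : Fin n → A) :
    FC.toOp ρ (relabel σ h m) x = FC.toOp τ m fun i => x (σ i) := rfl

end Algebra
end NCSignature
end
noncomputable section

namespace NCSignature

open Equiv

section Groups

variable {A : Type*} [CStarAlgebra A]

/-! ### Endomorphisms of the algebra of faces-contractions -/

/-- Morphisms of the unital algebra `LT^♯(FC)`. -/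
def IsAlgHom (𝒳 : Module.End ℂ (LTFC A)) : Prop :=
  𝒳 (unitFC A) = unitFC A ∧ ∀ m₁ m₂, 𝒳 (shuffle A m₁ m₂) = shuffle A (𝒳 m₁) (𝒳 m₂)

/-- Morphisms of the unital `⋆`-algebra `LT^♯(FC)`. -/
def IsStarAlgHom (𝒳 : Module.End ℂ (LTFC A)) : Prop :=
  IsAlgHom 𝒳 ∧ ∀ m, 𝒳 (starMap A m) = starMap A (𝒳 m)

/-- `(𝒳 - id) (FC(τ))` is contained in the sum of the `FC(τ')` over the proper subtrees `τ'` of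
`τ`. -/
def IsUnitriangular (𝒳 : Module.End ℂ (LTFC A)) : Prop :=
  ∀ (τ ρ : LevelledTree) (m : FC (A := A) τ.2),
    ((𝒳 - 1) (incl τ.2 m)) ρ ≠ 0 → IsProperSubtree ρ τ

/-- The group `U(FC)`. -/
def groupU (A : Type*) [CStarAlgebra A] : Set (Module.End ℂ (LTFC A)) :=
  {𝒳 | IsAlgHom 𝒳 ∧ IsUnitriangular 𝒳}

/-- The operator `C_{Y₁, …, Y_k}`: it contracts the inputs of the `k` highest levels of a
`τ`-faces-contraction with `Y₁, …, Y_k`; it vanishes on `FC(τ)` if `τ` has less than `k` levels. -/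
def insertion {k : ℕ} (Y : Fin k → A) : Module.End ℂ (LTFC A) :=
  DirectSum.toModule ℂ LevelledTree _ fun τ =>
    if h : k ≤ τ.1 then
      incl (lower τ.2 (Nat.sub_le τ.1 k)) ∘ₗ
        (contract τ.2 (Nat.sub_add_cancel h) Y).toLinearMap
    else 0

/-- The linear span of the identity and of the operators `C_{Y₁, …, Y_k}`, `k ≥ 1`. -/
def insertionSpan (A : Type*) [CStarAlgebra A] : Submodule ℂ (Module.End ℂ (LTFC A)) :=
  Submodule.span ℂ ({1} ∪ {Z | ∃ k : ℕ, 1 ≤ k ∧ ∃ Y : Fin k → A, Z = insertion Y})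

/-- The closure `𝒞` of `insertionSpan`, for the topology of convergence in operator norm of the
components `FC(τ) → FC(τ')`, uniform in `τ'` and locally uniform in `τ`. -/
def insertionClosure (A : Type*) [CStarAlgebra A] : Set (Module.End ℂ (LTFC A)) :=
  {𝒳 | ∀ (T : Finset LevelledTree) (ε : ℝ), 0 < ε → ∃ Z ∈ insertionSpan A,
    ∀ τ ∈ T, ∀ (m : FC (A := A) τ.2) (ρ : LevelledTree),
      ‖((𝒳 - Z) (incl τ.2 m)) ρ‖ ≤ ε * ‖m‖}

/-- The component `𝒳(τ', τ) : FC(n) → FC(n')`, with `FC(τ)` and `FC(τ')` identified with `FC(n)` and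
`FC(n')` through `φ`. -/
def component (𝒳 : Module.End ℂ (LTFC A)) {n' n : ℕ} (τ' : Perm (Fin n')) (τ : Perm (Fin n)) :
    FCid A n →ₗ[ℂ] FCid A n' :=
  (relabel (A := A) τ'⁻¹ (inv_mul_cancel τ')).toLinearMap ∘ₗ
    DirectSum.component ℂ LevelledTree (fun τ => FC (A := A) τ.2) ⟨n', τ'⟩ ∘ₗ 𝒳 ∘ₗ incl τ ∘ₗ
      (relabel (A := A) τ (mul_one τ)).toLinearMap

/-- The group `G(FC)`: the elements `𝒳` of `U(FC) ∩ 𝒞` such that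
`𝒳(f)(m) ∘_I w = 𝒳(f ^ I)(m ∘_{ℓ(I)} w)` for all forests `f` with `p + 1` trees and `k` vertices,
all non-empty `I ⊆ {0, …, p - 1}`, all `m ∈ FC(p + k)`, and all `w i ∈ A`, `i ∈ I`. Here `∘_I`
denotes substitution in the inputs `i ∈ I`, `ℓ(I)` consists of the faces of `f` between its trees
`i` and `i + 1` for `i ∈ I`, and `𝒳(f)` is the common value of the components `𝒳(τ', τ)` with
`τ' ⊆ τ` and `τ \ τ' = f`. -/
def groupG (A : Type*) [CStarAlgebra A] : Set (Module.End ℂ (LTFC A)) :=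
  {𝒳 | 𝒳 ∈ groupU A ∩ insertionClosure A ∧
    ∀ (p k : ℕ) (f : LevelledForest p k) (I : Finset (Fin p)), I.Nonempty →
      ∀ τ : Perm (Fin (p + k)), upper τ rfl = f →
      ∀ ρ : Perm (Fin (Iᶜ.card + k)), upper ρ rfl = f.glue I →
      ∀ (m : FCid A (p + k)) (w : Fin p → A),
        fillFC 1 Iᶜ rfl w (subword_one _ _)
            (component 𝒳 (lower τ (Nat.le_add_right p k)) τ m) =
          component 𝒳 (lower ρ (Nat.le_add_right Iᶜ.card k)) ρ
            (fillFC 1 (f.gaps I)ᶜ (f.card_compl_gaps I) (Function.extend f.gap w 0)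
              (subword_one _ _) m)}

/-! ### Iterated integrals -/

/-- The iterated integral `∫_{t > t₁ > ⋯ > t_k > s} F (dX_{t₁}, …, dX_{t_k})` of a `k`-linear
function `F` along a path `X` on `[0, 1]`, as `∫ₛᵗ ∫ₛ^{t₁} ⋯ ∫ₛ^{t_{k-1}}`, with
`dX_r = X'(r) dr`. -/
def iteratedIntegral {E : Type*} [NormedAddCommGroup E] [NormedSpace ℝ E] (X : ℝ → A) (s : ℝ) :
    (k : ℕ) → ℝ → ((Fin k → A) → E) → E
  | 0, _, F => F Fin.elim0
  | k + 1, t, F => ∫ r in s..t, iteratedIntegral X s k r fun v =>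
      F (Fin.cons (derivWithin X (Set.Icc 0 1) r) v)

/-! ### The non-commutative signature -/

/-- The part of `𝒳_{s,t}` which maps `FC(τ)` to `FC(τ ∩ [p])`: it sends `m` to
`(y₁, …, y_p) ↦ ∫_{t > t₁ > ⋯ > t_k > s} m (y₁, …, y_p, dX_{t₁}, …, dX_{t_k})`. -/
def sigPart (X : ℝ → A) (s t : ℝ) {n p k : ℕ} (τ : Perm (Fin n)) (h : p + k = n) :
    FC (A := A) τ →L[ℂ] FC (A := A) (lower τ (h ▸ Nat.le_add_right p k)) :=
  iteratedIntegral X s k t (contract τ h)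

/-- The non-commutative signature `𝒳_{s,t}`. -/
def signature (X : ℝ → A) (s t : ℝ) : Module.End ℂ (LTFC A) :=
  DirectSum.toModule ℂ LevelledTree _ fun τ => ∑ p : Fin (τ.1 + 1),
    incl _ ∘ₗ (sigPart X s t τ.2 (Nat.add_sub_of_le (Nat.le_of_lt_succ p.2))).toLinearMap

end Groups

section Words

variable {A : Type*} [CStarAlgebra A]

/-! ### Trees labelled by words -/

variable (A) in
/-- The completed projective tensor power `A^{⊗ n}` (the norm of Mathlib on `⨂[ℂ] _ : Fin n, A` is
the projective one). -/
def TensorPow (n : ℕ) : Type _ := UniformSpace.Completion (⨂[ℂ] _ : Fin n, A)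

instance (n : ℕ) : NormedAddCommGroup (TensorPow A n) :=
  inferInstanceAs (NormedAddCommGroup (UniformSpace.Completion (⨂[ℂ] _ : Fin n, A)))

instance (n : ℕ) : NormedSpace ℂ (TensorPow A n) :=
  inferInstanceAs (NormedSpace ℂ (UniformSpace.Completion (⨂[ℂ] _ : Fin n, A)))

instance (n : ℕ) : CompleteSpace (TensorPow A n) :=
  inferInstanceAs (CompleteSpace (UniformSpace.Completion (⨂[ℂ] _ : Fin n, A)))

variable (A) in
/-- The map from the algebraic tensor power to the completed one. -/
def toTensorPow (n : ℕ) : (⨂[ℂ] _ : Fin n, A) →L[ℂ] TensorPow A n :=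
  UniformSpace.Completion.toComplL

variable (A) in
lemma denseRange_toTensorPow (n : ℕ) : DenseRange (toTensorPow A n) :=
  UniformSpace.Completion.denseRange_coe

variable (A) in
lemma isUniformInducing_toTensorPow (n : ℕ) : IsUniformInducing (toTensorPow A n) :=
  UniformSpace.Completion.isUniformInducing_coe _

/-- The bounded linear map on `A^{⊗ n}` which extends a bounded `n`-linear map. -/
def liftTensor {n : ℕ} {F : Type*} [NormedAddCommGroup F] [NormedSpace ℂ F] [CompleteSpace F]
    (g : ContinuousMultilinearMap ℂ (fun _ : Fin n => A) F) : TensorPow A n →L[ℂ] F :=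
  (PiTensorProduct.liftIsometry ℂ (fun _ : Fin n => A) F g).extend (toTensorPow A n)

variable (A) in
/-- The elementary tensor `a₁ ⊗ ⋯ ⊗ aₙ`, as a function of `a`. -/
def elemTensor (n : ℕ) : ContinuousMultilinearMap ℂ (fun _ : Fin n => A) (TensorPow A n) :=
  (toTensorPow A n).compContinuousMultilinearMap (PiTensorProduct.tprodL ℂ)

lemma liftTensor_toTensorPow {n : ℕ} {F : Type*} [NormedAddCommGroup F] [NormedSpace ℂ F]
    [CompleteSpace F] (g : ContinuousMultilinearMap ℂ (fun _ : Fin n => A) F)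
    (x : ⨂[ℂ] _ : Fin n, A) :
    liftTensor g (toTensorPow A n x) = PiTensorProduct.lift g.toMultilinearMap x :=
  (ContinuousLinearMap.extend_eq _ (denseRange_toTensorPow A n)
    (isUniformInducing_toTensorPow A n) x).trans (PiTensorProduct.liftIsometry_apply_apply g x)

lemma liftTensor_elemTensor {n : ℕ} {F : Type*} [NormedAddCommGroup F] [NormedSpace ℂ F]
    [CompleteSpace F] (g : ContinuousMultilinearMap ℂ (fun _ : Fin n => A) F) (a : Fin n → A) :
    liftTensor g (elemTensor A n a) = g a :=
  (liftTensor_toTensorPow g (PiTensorProduct.tprod ℂ a)).trans (PiTensorProduct.lift.tprod a)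

variable (A) in
/-- The space `LT(A) = ⨁ A^{⊗ |τ|}`, where `|τ|` is the number of leaves of `τ`. -/
abbrev LTA : Type _ := DirectSum LevelledTree fun τ => TensorPow A (τ.1 + 1)

/-- The restriction `A^{⊗ |τ|} → FC(τ)` of `♯`. -/
def sharpFC {n : ℕ} (τ : Perm (Fin n)) : TensorPow A (n + 1) →L[ℂ] FC (A := A) τ :=
  liftTensor (sharpOpFC τ)

lemma sharpFC_elemTensor {n : ℕ} (τ : Perm (Fin n)) (a : Fin (n + 1) → A) :
    sharpFC τ (elemTensor A (n + 1) a) = FC.mk τ (sharpOp τ a) (sharpOp_mem_FC τ a) :=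
  liftTensor_elemTensor (sharpOpFC τ) a

variable (A) in
/-- The map `♯ : LT(A) → LT^♯(FC)`. -/
def sharp : LTA A →ₗ[ℂ] LTFC A :=
  DirectSum.lmap fun τ => (sharpFC (A := A) τ.2).toLinearMap

/-- `a ↦ a₀ · x₀ · a₁ ⋯ x_{n-1} · aₙ`, as a bounded multilinear map. -/
def interleaveL {n : ℕ} (x : Fin n → A) : ContinuousMultilinearMap ℂ (fun _ : Fin (n + 1) => A) A :=
  (ContinuousMultilinearMap.apply ℂ (fun _ : Fin n => A) A x).compContinuousMultilinearMap
    (sharpOp 1)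

lemma interleaveL_apply {n : ℕ} (x : Fin n → A) (a : Fin (n + 1) → A) :
    interleaveL x a = interleave 1 a x := rfl

/-- The operator `Op([v_{σ(1)} ⋯ v_{σ(k)}]_c)` of a forest `f = (σ, c)`: it sends `a₀ ⊗ ⋯ ⊗ aₙ`,
with `a` placed on the leaves of `f`, to the tensor product over the trees of `f` (from left to
right) of the products of the `a`'s of the leaves of this tree, interleaved with the `v l`'s, where
`v l` is placed on the vertex of level `l`. -/
def forestOp {n p k : ℕ} (f : LevelledForest p k) (h : p + k = n) (v : Fin k → A) :
    TensorPow A (n + 1) →L[ℂ] TensorPow A (p + 1) :=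
  liftTensor
    { toMultilinearMap := (((elemTensor A (p + 1)).toMultilinearMap.compMultilinearMap fun j =>
        (interleaveL fun r => v (f.level j r)).toMultilinearMap).domDomCongr (f.leafEquiv h) :
          MultilinearMap ℂ (fun _ : Fin (n + 1) => A) (TensorPow A (p + 1)))
      cont := (elemTensor A (p + 1)).cont.comp <| continuous_pi fun j =>
        (interleaveL fun r => v (f.level j r)).cont.comp <| continuous_pi fun _ =>
          continuous_apply _ }

lemma forestOp_elemTensor {n p k : ℕ} (f : LevelledForest p k) (h : p + k = n) (v : Fin k → A)
    (a : Fin (n + 1) → A) : forestOp f h v (elemTensor A (n + 1) a) =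
      elemTensor A (p + 1) fun j => interleave 1 (fun r => a (f.leafEquiv h ⟨j, r⟩))
        fun r => v (f.level j r) :=
  liftTensor_elemTensor _ _

/-- The partial contraction operator `𝕏^f_{s,t}` of a path `X` along a forest `f`. -/
def partialContraction (X : ℝ → A) (s t : ℝ) {n p k : ℕ} (f : LevelledForest p k) (h : p + k = n) :
    TensorPow A (n + 1) →L[ℂ] TensorPow A (p + 1) :=
  iteratedIntegral X s k t (forestOp f h)

/-- The endomorphism `𝕏̄_{s,t}` of `LT(A)`: it sends `a τ` to the sum of the `𝕏^{τ \ τ'}(a) τ'` over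
the subtrees `τ'` of `τ`. -/
def barX (X : ℝ → A) (s t : ℝ) : Module.End ℂ (LTA A) :=
  DirectSum.toModule ℂ LevelledTree _ fun τ => ∑ p : Fin (τ.1 + 1),
    DirectSum.lof ℂ LevelledTree (fun τ => TensorPow A (τ.1 + 1))
        ⟨p, lower τ.2 (Nat.le_of_lt_succ p.2)⟩ ∘ₗ
      (partialContraction X s t (upper τ.2 (Nat.add_sub_of_le (Nat.le_of_lt_succ p.2)))
        (Nat.add_sub_of_le (Nat.le_of_lt_succ p.2))).toLinearMap

end Words

end NCSignature

end

/-! Write $V=X'$ and let $C_Y$ be the operator which contracts the input of highest level with $Y$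
(`topContraction`). Differentiating an iterated integral in its upper limit freezes the outermost
variable $t_1$ at $t$. Since $\mathrm dX_{t_1}$ occupies the lowest of the contracted levels, it is
the highest input left once the others are contracted. Hence $t\mapsto\mathcal X_{s,t}z$ solves the
linear equation $D'=C_{V(t)}D$ with $D(s)=z$ (`hasWeakDerivAt_pathSig`). As $C_Y$ lowers degrees by
one, solutions of bounded degree are determined by their value at one time: their components are
shown to be constant from the top degree downwards (`eq_pathSig_of_hasWeakDerivAt`).

Three assertions are instances of this uniqueness. Chen's identity compares two solutions which
agree at the time $u$. Multiplicativity holds because $C_Y$ is a derivation of the shuffle product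
(`topContraction_shuffle`): the greatest letter of a shuffle ends the left block or the right one.
Compatibility with $\star$ holds because $\star C_Y=C_{Y^*}\star$ and $V$ is self-adjoint when $X$
is.

Membership in $\mathcal C$ is an approximation argument. The part of the signature contracting $k$
inputs is the image of a single tensor, the iterated integral of $\mathrm
dX_{t_1}\otimes\cdots\otimes\mathrm dX_{t_k}$ in the completed projective power, by a map of norm at
most $1$; approximating this tensor by algebraic ones gives combinations of insertions
(`exists_insertionSpan_approx`).

The group condition and the intertwining with $\sharp$ are equalities of integrands, before
integration. They rest on the description of the faces of $\tau\setminus\tau'$ inside $\tau$: the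
gaps between trees are the faces of low level (`gap_upper`), and the other faces carry the vertices
of the forest (`val_vertexFace_upper`). Gluing deletes gaps and preserves the order of the remaining
faces (`orderEmbOfFin_vertexFace_glue`, `orderEmbOfFin_gap_glue`), and cutting a word at the gaps
gives the partial contractions (`interleave_forest`). -/

noncomputable section

namespace NCSignature

open Equiv

/-! ### Iterated integrals along a continuous path -/

section IteratedIntegrals

variable {A : Type*} {E : Type*} [NormedAddCommGroup E] [NormedSpace ℝ E]

/-- The iterated integral `∫ₛᵗ ∫ₛ^{t₁} ⋯ ∫ₛ^{t_{k-1}} F (V t₁, …, V t_k) dt_k ⋯ dt₁`. -/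
def iterInt (V : ℝ → A) (s : ℝ) : (k : ℕ) → ℝ → ((Fin k → A) → E) → E
  | 0, _, F => F Fin.elim0
  | k + 1, t, F => ∫ r in s..t, iterInt V s k r fun v => F (Fin.cons (V r) v)

lemma iterInt_zero (V : ℝ → A) (s t : ℝ) (F : (Fin 0 → A) → E) :
    iterInt V s 0 t F = F Fin.elim0 := rfl

lemma iterInt_succ (V : ℝ → A) (s t : ℝ) (k : ℕ) (F : (Fin (k + 1) → A) → E) :
    iterInt V s (k + 1) t F = ∫ r in s..t, iterInt V s k r fun v => F (Fin.cons (V r) v) := rfl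

lemma iterInt_self (V : ℝ → A) (s : ℝ) (k : ℕ) (F : (Fin (k + 1) → A) → E) :
    iterInt V s (k + 1) s F = 0 := by
  rw [iterInt_succ, intervalIntegral.integral_same]

variable [TopologicalSpace A]

lemma continuous_finCons {k : ℕ} {Z : Type*} [TopologicalSpace Z] {a : Z → A} {v : Z → Fin k → A}
    (ha : Continuous a) (hv : Continuous v) :
    Continuous fun z => (Fin.cons (a z) (v z) : Fin (k + 1) → A) := by
  refine continuous_pi fun i => ?_
  refine Fin.cases ?_ (fun i => ?_) i
  · simpa using ha
  · simp only [Fin.cons_succ]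
    exact (continuous_apply i).comp hv

/-- The parameter space `Z` is arbitrary because the induction enlarges it: the outer integration
variable becomes a parameter of the inner integral, which is therefore treated over `Z × ℝ`. -/
lemma continuous_iterInt {V : ℝ → A} (hV : Continuous V) (s : ℝ) (k : ℕ) :
    ∀ {Z : Type*} [TopologicalSpace Z] {F : Z → (Fin k → A) → E},
      Continuous (Function.uncurry F) →
      Continuous fun q : Z × ℝ => iterInt V s k q.2 (F q.1) := by
  induction k with
  | zero =>
    intro Z _ F hF
    exact hF.comp (continuous_fst.prodMk continuous_const)
  | succ k ih =>
    intro Z _ F hF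
    have h := ih (Z := Z × ℝ) (F := fun z v => F z.1 (Fin.cons (V z.2) v))
      (hF.comp (g := Function.uncurry F) (f := fun q : (Z × ℝ) × (Fin k → A) =>
        (q.1.1, (Fin.cons (V q.1.2) q.2 : Fin (k + 1) → A)))
        ((continuous_fst.comp continuous_fst).prodMk
          (continuous_finCons (hV.comp (continuous_snd.comp continuous_fst)) continuous_snd)))
    have h2 : Continuous (Function.uncurry fun (q : Z) (r : ℝ) =>
        iterInt V s k r fun v => F q (Fin.cons (V r) v)) :=
      h.comp ((continuous_fst.prodMk continuous_snd).prodMk continuous_snd)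
    have h3 := intervalIntegral.continuous_parametric_primitive_of_continuous
      (μ := MeasureTheory.volume) (a₀ := s) h2
    exact h3

lemma continuous_iterInt_cons {V : ℝ → A} (hV : Continuous V) (s : ℝ) (k : ℕ)
    {F : (Fin (k + 1) → A) → E} (hF : Continuous F) :
    Continuous fun r => iterInt V s k r fun v => F (Fin.cons (V r) v) := by
  have h := continuous_iterInt (E := E) hV s k (Z := ℝ) (F := fun z v => F (Fin.cons (V z) v))
    (hF.comp (continuous_finCons (hV.comp continuous_fst) continuous_snd))
  exact h.comp (continuous_id.prodMk continuous_id)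

/-- The fundamental theorem of calculus for the outermost integral only; the integrand is continuous
although it depends on `r` both through `V r` and through the upper limit of the inner integrals. -/
lemma hasDerivAt_iterInt [CompleteSpace E] {V : ℝ → A} (hV : Continuous V) (s t : ℝ) (k : ℕ)
    {F : (Fin (k + 1) → A) → E} (hF : Continuous F) :
    HasDerivAt (fun r => iterInt V s (k + 1) r F)
      (iterInt V s k t fun v => F (Fin.cons (V t) v)) t :=
  intervalIntegral.integral_hasDerivAt_right
    ((continuous_iterInt_cons hV s k hF).intervalIntegrable _ _)
    ((continuous_iterInt_cons hV s k hF).stronglyMeasurableAtFilter _ _)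
    (continuous_iterInt_cons hV s k hF).continuousAt

lemma map_iterInt [CompleteSpace E] {E' : Type*} [NormedAddCommGroup E'] [NormedSpace ℝ E']
    [CompleteSpace E'] {V : ℝ → A} (hV : Continuous V) (s : ℝ) (L : E →L[ℝ] E') (k : ℕ) :
    ∀ (t : ℝ) {F : (Fin k → A) → E}, Continuous F →
      L (iterInt V s k t F) = iterInt V s k t fun v => L (F v) := by
  induction k with
  | zero => intro t F _; rfl
  | succ k ih =>
    intro t F hF
    rw [iterInt_succ, iterInt_succ, ← ContinuousLinearMap.intervalIntegral_comp_comm L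
      ((continuous_iterInt_cons hV s k hF).intervalIntegrable _ _)]
    refine intervalIntegral.integral_congr fun r _ => ?_
    exact ih r (hF.comp (continuous_finCons continuous_const continuous_id))

end IteratedIntegrals

/-! ### The velocity, extended to the whole line -/

section Velocity

variable {A : Type*} [CStarAlgebra A]

/-- The derivative of a path on `[0, 1]`, extended by constants out of this interval. -/
def velocity (X : ℝ → A) : ℝ → A :=
  Set.IccExtend (zero_le_one' ℝ) fun r : Set.Icc (0 : ℝ) 1 => derivWithin X (Set.Icc 0 1) r

lemma continuous_velocity {X : ℝ → A} (hX : ContDiffOn ℝ ∞ X (Set.Icc (0 : ℝ) 1)) :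
    Continuous (velocity X) := by
  have h := hX.continuousOn_derivWithin (uniqueDiffOn_Icc zero_lt_one) (by simp)
  exact (continuousOn_iff_continuous_domRestrict.1 h).Icc_extend'

/-- All integration variables stay between `s` and `t`, in either order, hence in `[0, 1]`, where
the extension changes nothing. With a continuous velocity on `ℝ`, the differential equation holds at
every real time and needs no one-sided derivatives. -/
lemma iteratedIntegral_eq_iterInt {E : Type*} [NormedAddCommGroup E] [NormedSpace ℝ E] (X : ℝ → A)
    {s : ℝ} (hs : s ∈ Set.Icc (0 : ℝ) 1) (k : ℕ) : ∀ {t : ℝ}, t ∈ Set.Icc (0 : ℝ) 1 →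
      ∀ F : (Fin k → A) → E, iteratedIntegral X s k t F = iterInt (velocity X) s k t F := by
  induction k with
  | zero => intro t _ F; rfl
  | succ k ih =>
    intro t ht F
    rw [iteratedIntegral, iterInt_succ]
    refine intervalIntegral.integral_congr fun r hr => ?_
    have hr' : r ∈ Set.Icc (0 : ℝ) 1 := Set.uIcc_subset_Icc hs ht hr
    have hv : velocity X r = derivWithin X (Set.Icc 0 1) r := Set.IccExtend_of_mem _ _ hr'
    simp only [hv]
    exact ih hr' _

lemma star_velocity {X : ℝ → A} (hX : ∀ t ∈ Set.Icc (0 : ℝ) 1, star (X t) = X t) (r : ℝ) :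
    star (velocity X r) = velocity X r := by
  rw [velocity, Set.IccExtend, Function.comp_apply]
  generalize Set.projIcc (0 : ℝ) 1 _ r = q
  have h : Set.EqOn (fun t => star (X t)) X (Set.Icc 0 1) := hX
  have h2 := derivWithin_congr h (h q.2)
  have h3 : derivWithin (fun t => star (X t)) (Set.Icc 0 1) q =
      star (derivWithin X (Set.Icc 0 1) q) := derivWithin.star
  rw [← h3, h2]

end Velocity

/-! ### Standardized subwords and lower subtrees -/

section Subwords

lemma orderEmbOfFin_subword {n p : ℕ} (τ : Perm (Fin n)) (S : Finset (Fin n)) (h : S.card = p)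
    (j : Fin p) : S.orderEmbOfFin h (subword τ S h j) =
      τ ((S.map τ.symm.toEmbedding).orderEmbOfFin (card_positions τ S h) j) := by
  rw [← Finset.coe_orderIsoOfFin_apply]
  simp [subword]

/-- A finite set of positions has only one increasing enumeration, so an increasing `e` landing on
the letters of `S` must be it. Subtrees are identified below by exhibiting such an `e`. -/
lemma subword_eq_of_strictMono {n p : ℕ} {τ : Perm (Fin n)} {S : Finset (Fin n)} {h : S.card = p}
    {σ : Perm (Fin p)} {e : Fin p → Fin n} (he : StrictMono e)
    (hσ : ∀ j, τ (e j) = S.orderEmbOfFin h (σ j)) : subword τ S h = σ := by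
  have h1 : e = (S.map τ.symm.toEmbedding).orderEmbOfFin (card_positions τ S h) := by
    refine Finset.orderEmbOfFin_unique _ (fun j => ?_) he

    simp [hσ]
  ext j
  have h2 := orderEmbOfFin_subword τ S h j
  rw [← h1, hσ] at h2
  rw [(S.orderEmbOfFin h).injective h2]

lemma orderEmbOfFin_lowLevels {n p : ℕ} (h : p ≤ n) (j : Fin p) :
    (lowLevels n p).orderEmbOfFin (card_lowLevels h) j = Fin.castLE h j := by
  have := Finset.orderEmbOfFin_unique (s := lowLevels n p) (card_lowLevels h) (f := Fin.castLE h)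
    (fun j => by simp [lowLevels]) (Fin.strictMono_castLE h)
  rw [this]

lemma val_orderEmbOfFin_highLevels {n p k : ℕ} (h : p + k = n) (j : Fin k) :
    ((highLevels n p).orderEmbOfFin (card_highLevels h) j : ℕ) = p + j := by
  subst h
  have := Finset.orderEmbOfFin_unique (s := highLevels (p + k) p) (card_highLevels rfl)
    (f := Fin.natAdd p) (fun j => by simp [highLevels]) (Fin.strictMono_natAdd p)
  rw [← this]
  rfl

/-- The positions of the `p` lowest levels of a word, in increasing order. -/
def lowPos {n p : ℕ} (τ : Perm (Fin n)) (h : p ≤ n) : Fin p ↪o Fin n :=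
  ((lowLevels n p).map τ.symm.toEmbedding).orderEmbOfFin (card_positions τ _ (card_lowLevels h))

lemma val_lowPos {n p : ℕ} (τ : Perm (Fin n)) (h : p ≤ n) (j : Fin p) :
    (τ (lowPos τ h j) : ℕ) = lower τ h j := by
  have := orderEmbOfFin_subword τ (lowLevels n p) (card_lowLevels h) j
  rw [orderEmbOfFin_lowLevels h] at this
  rw [lowPos, ← this]
  rfl

lemma lower_eq_of_strictMono {n p : ℕ} {τ : Perm (Fin n)} {h : p ≤ n} {σ : Perm (Fin p)}
    {e : Fin p → Fin n} (he : StrictMono e) (hσ : ∀ j, (τ (e j) : ℕ) = σ j) : lower τ h = σ :=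
  subword_eq_of_strictMono he fun j => by
    rw [orderEmbOfFin_lowLevels h]
    exact Fin.ext (hσ j)

lemma lower_self {n : ℕ} (τ : Perm (Fin n)) : lower τ le_rfl = τ :=
  lower_eq_of_strictMono strictMono_id fun _ => rfl

lemma lower_lower {n p q : ℕ} (τ : Perm (Fin n)) (h : p ≤ n) (h' : q ≤ p) :
    lower (lower τ h) h' = lower τ (h'.trans h) :=
  (lower_eq_of_strictMono (e := fun j => lowPos τ h (lowPos (lower τ h) h' j))
    ((lowPos τ h).strictMono.comp (lowPos _ h').strictMono)
    fun j => by rw [val_lowPos, val_lowPos]).symm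

lemma lower_mul_revPerm {n p : ℕ} (τ : Perm (Fin n)) (h : p ≤ n) :
    lower (τ * Fin.revPerm) h = lower τ h * Fin.revPerm :=
  lower_eq_of_strictMono (e := fun j => (lowPos τ h j.rev).rev)
    (fun i j hij => Fin.rev_lt_rev.2 ((lowPos τ h).strictMono (Fin.rev_lt_rev.2 hij)))
    fun j => by simp [val_lowPos]

end Subwords

/-! ### Contractions of the highest inputs -/

section Contractions

lemma update_append_natAdd {p k : ℕ} {A : Type*} (y : Fin p → A)
    (v : Fin k → A) (i : Fin k) (z : A) :
    Fin.append y (Function.update v i z) =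
      Function.update (Fin.append y v) (Fin.natAdd p i) z := by
  ext j
  refine Fin.addCases (fun j => ?_) (fun j => ?_) j
  · have : Fin.castAdd k j ≠ Fin.natAdd p i := fun e => by
      have := congrArg Fin.val e
      simp at this
      omega
    simp [Function.update_of_ne this]
  · by_cases hj : j = i
    · subst hj; simp
    · have : Fin.natAdd p j ≠ Fin.natAdd p i := fun e => hj (Fin.natAdd_injective _ _ e)
      simp [Function.update_of_ne this, Function.update_of_ne hj]

variable {A : Type*} [CStarAlgebra A]

lemma FC.toOp_ext {n : ℕ} {τ : Perm (Fin n)} {m m' : FC (A := A) τ}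
    (h : ∀ x, FC.toOp τ m x = FC.toOp τ m' x) : m = m' :=
  FC.toOp_injective τ (ContinuousMultilinearMap.ext h)

/-- Trees such as `lower (lower τ _) _` and `lower τ _` are equal but not definitionally so.
Comparing elements of their spaces inside the direct sum avoids transporting operators along such
equalities. -/
lemma incl_congr {n n' : ℕ} (h : n = n') {τ : Perm (Fin n)} {τ' : Perm (Fin n')}
    {m : FC (A := A) τ} {m' : FC (A := A) τ'}
    (hτ : ∀ i, (τ i : ℕ) = τ' (Fin.cast h i))
    (hm : ∀ x : Fin n' → A, FC.toOp τ m (fun i => x (Fin.cast h i)) = FC.toOp τ' m' x) :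
    incl τ m = incl τ' m' := by
  subst h
  obtain rfl : τ = τ' := Equiv.ext fun i => Fin.ext (hτ i)
  rw [FC.toOp_ext hm]

lemma incl_apply_self {n : ℕ} (τ : Perm (Fin n)) (m : FC (A := A) τ) : incl τ m ⟨n, τ⟩ = m :=
  DirectSum.lof_apply ℂ (M := fun τ : LevelledTree => FC (A := A) τ.2) ⟨n, τ⟩ m

lemma incl_apply_of_ne {n : ℕ} (τ : Perm (Fin n)) (m : FC (A := A) τ) {ρ : LevelledTree}
    (h : ρ ≠ ⟨n, τ⟩) : incl τ m ρ = 0 :=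
  DirectSum.of_eq_of_ne _ _ _ h

lemma exists_sum_incl (z : LTFC A) :
    ∃ T : Finset LevelledTree, (∀ τ ∈ T, z τ ≠ 0) ∧ z = ∑ τ ∈ T, incl τ.2 (z τ) := by
  classical
  exact ⟨DFinsupp.support z, fun τ h => (DFinsupp.mem_support_iff.1 h),
    (DirectSum.sum_support_of z).symm⟩

lemma toOp_contract {n p k : ℕ} (τ : Perm (Fin n)) (h : p + k = n) (v : Fin k → A)
    (m : FC (A := A) τ) (y : Fin p → A) : FC.toOp _ (contract τ h v m) y =
      FC.toOp τ m fun i => Fin.append y v (Fin.cast h.symm i) := by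
  subst h
  exact contract_apply τ v m y

/-- `contract`, with values in `FC(ρ)` for a permutation `ρ` equal to `lower τ _`. -/
def contractTo {n p k : ℕ} (τ : Perm (Fin n)) (h : p + k = n) (v : Fin k → A) {ρ : Perm (Fin p)}
    (hρ : lower τ (h ▸ Nat.le_add_right p k) = ρ) : FC (A := A) τ →L[ℂ] FC (A := A) ρ :=
  fillFC τ (lowLevels n p) (card_lowLevels (h ▸ Nat.le_add_right p k))
    (fun l => if hl : p ≤ (l : ℕ) then v ⟨l - p, by omega⟩ else 0) hρ

lemma toOp_contractTo {n p k : ℕ} (τ : Perm (Fin n)) (h : p + k = n) (v : Fin k → A)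
    {ρ : Perm (Fin p)} (hρ : lower τ (h ▸ Nat.le_add_right p k) = ρ)
    (m : FC (A := A) τ) (y : Fin p → A) : FC.toOp _ (contractTo τ h v hρ m) y =
      FC.toOp τ m fun i => Fin.append y v (Fin.cast h.symm i) := by
  subst hρ
  exact toOp_contract τ h v m y

lemma incl_contractTo {n p k : ℕ} (τ : Perm (Fin n)) (h : p + k = n) (v : Fin k → A)
    {ρ : Perm (Fin p)} (hρ : lower τ (h ▸ Nat.le_add_right p k) = ρ) (m : FC (A := A) τ) :
    incl ρ (contractTo τ h v hρ m) = incl _ (contract τ h v m) := by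
  subst hρ
  rfl

/-- Once the `k` upper levels are filled with `v`, the level `p` receiving `Y` is the highest one
left. This factorization is the source of the equation `D' = C_V D`. -/
lemma contract_cons {n p k : ℕ} (τ : Perm (Fin n)) (h : p + (k + 1) = n) (h' : p + 1 + k = n)
    (Y : A) (v : Fin k → A) (m : FC (A := A) τ) :
    contract τ h (Fin.cons Y v) m =
      contractTo (lower τ (h' ▸ Nat.le_add_right (p + 1) k)) (rfl : p + 1 = p + 1) (fun _ => Y)
        (lower_lower _ _ _) (contract τ h' v m) := by
  refine FC.toOp_ext fun y => ?_
  rw [toOp_contract, toOp_contractTo, toOp_contract]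
  subst h'
  congr 1
  ext i
  refine Fin.addCases (fun i => ?_) (fun i => ?_) i
  · refine Fin.lastCases ?_ (fun i => ?_) i
    · have h1 : Fin.cast h.symm (Fin.castAdd k (Fin.last p)) = Fin.natAdd p (0 : Fin (k + 1)) :=
        Fin.ext (by simp)
      have h2 : Fin.last p = Fin.natAdd p (0 : Fin 1) := Fin.ext (by simp)
      rw [h1, Fin.append_right]
      simp only [Fin.cast_eq_self, Fin.append_left]
      rw [h2, Fin.append_right]
      rfl
    · have h1 : Fin.cast h.symm (Fin.castAdd k (Fin.castSucc i)) = Fin.castAdd (k + 1) i :=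
        Fin.ext (by simp)
      have h2 : Fin.castSucc i = Fin.castAdd 1 i := rfl
      rw [h1, Fin.append_left]
      simp only [Fin.cast_eq_self, Fin.append_left]
      rw [h2, Fin.append_left]
  · have h1 : Fin.cast h.symm (Fin.natAdd (p + 1) i) = Fin.natAdd p i.succ :=
      Fin.ext (by simp; omega)
    rw [h1, Fin.append_right]
    simp only [Fin.cast_eq_self, Fin.append_right, Fin.cons_succ]

lemma norm_contract_le {n p k : ℕ} (τ : Perm (Fin n)) (h : p + k = n) (v : Fin k → A) :
    ‖contract (A := A) τ h v‖ ≤ ∏ i, ‖v i‖ := by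
  have h0 : 0 ≤ ∏ i, ‖v i‖ := Finset.prod_nonneg fun _ _ => norm_nonneg _
  refine ContinuousLinearMap.opNorm_le_bound _ h0 fun m => ?_
  rw [← FC.norm_toOp, ← FC.norm_toOp]
  refine ContinuousMultilinearMap.opNorm_le_bound (by positivity) fun y => ?_
  rw [toOp_contract]
  subst h
  refine (ContinuousMultilinearMap.le_opNorm _ _).trans (le_of_eq ?_)
  simp only [Fin.cast_eq_self]
  rw [Fin.prod_univ_add]
  simp only [Fin.append_left, Fin.append_right]
  ring

/-- `contract`, as a bounded multilinear function of the inserted elements. -/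
def contractL {n p k : ℕ} (τ : Perm (Fin n)) (h : p + k = n) :
    ContinuousMultilinearMap ℂ (fun _ : Fin k => A)
      (FC (A := A) τ →L[ℂ] FC (A := A) (lower τ (h ▸ Nat.le_add_right p k))) :=
  MultilinearMap.mkContinuous
    { toFun := contract τ h
      map_update_add' := fun {inst} v i z z' => by
        rw [Subsingleton.elim inst (instDecidableEqFin k)]
        subst h
        refine ContinuousLinearMap.ext fun m => FC.toOp_ext fun y => ?_
        rw [add_apply, map_add, add_apply]
        simp only [contract_apply, update_append_natAdd, ContinuousMultilinearMap.map_update_add]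
      map_update_smul' := fun {inst} v i c z => by
        rw [Subsingleton.elim inst (instDecidableEqFin k)]
        subst h
        refine ContinuousLinearMap.ext fun m => FC.toOp_ext fun y => ?_
        rw [smul_apply, map_smul, smul_apply]
        simp only [contract_apply, update_append_natAdd,
          ContinuousMultilinearMap.map_update_smul] } 1
    (fun v => by simpa using norm_contract_le τ h v)

lemma contractL_apply {n p k : ℕ} (τ : Perm (Fin n)) (h : p + k = n) (v : Fin k → A) :
    contractL τ h v = contract τ h v := rfl

/-- The bound does not depend on `τ`: one approximating tensor will serve for all trees. -/
lemma norm_contractL_le {n p k : ℕ} (τ : Perm (Fin n)) (h : p + k = n) :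
    ‖contractL (A := A) τ h‖ ≤ 1 :=
  MultilinearMap.mkContinuous_norm_le _ zero_le_one _

lemma continuous_contract {n p k : ℕ} (τ : Perm (Fin n)) (h : p + k = n) :
    Continuous (contract (A := A) τ h) :=
  (contractL τ h).cont

end Contractions

/-! ### The signature of a velocity and the top contraction -/

section Signature

variable {A : Type*} [CStarAlgebra A]

/-- The iterated integral of the contractions of the `k` highest levels along `V`. -/
def sigTerm (V : ℝ → A) (s t : ℝ) {n p k : ℕ} (τ : Perm (Fin n)) (h : p + k = n) :
    FC (A := A) τ →L[ℂ] FC (A := A) (lower τ (h ▸ Nat.le_add_right p k)) :=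
  iterInt V s k t (contract τ h)

/-- The signature of a path with velocity `V`. -/
def pathSig (V : ℝ → A) (s t : ℝ) : Module.End ℂ (LTFC A) :=
  DirectSum.toModule ℂ LevelledTree _ fun τ => ∑ p : Fin (τ.1 + 1),
    incl _ ∘ₗ (sigTerm V s t τ.2 (Nat.add_sub_of_le (Nat.le_of_lt_succ p.2))).toLinearMap

lemma signature_eq_pathSig (X : ℝ → A) {s t : ℝ} (hs : s ∈ Set.Icc (0 : ℝ) 1)
    (ht : t ∈ Set.Icc (0 : ℝ) 1) : signature X s t = pathSig (velocity X) s t := by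
  simp only [signature, pathSig, sigPart, sigTerm, iteratedIntegral_eq_iterInt X hs _ ht]

lemma pathSig_incl (V : ℝ → A) (s t : ℝ) {n : ℕ} (τ : Perm (Fin n)) (m : FC (A := A) τ) :
    pathSig V s t (incl τ m) = ∑ p : Fin (n + 1),
      incl (lower τ (Nat.le_of_lt_succ p.2))
        (sigTerm V s t τ (Nat.add_sub_of_le (Nat.le_of_lt_succ p.2)) m) := by
  rw [pathSig, incl, DirectSum.toModule_lof, LinearMap.sum_apply]
  rfl

/-- `sigTerm` integrates operators; evaluation at `m` is bounded and real linear, so it goes through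
the integrals. -/
lemma sigTerm_apply {V : ℝ → A} (hV : Continuous V) (s t : ℝ) {n p k : ℕ} (τ : Perm (Fin n))
    (h : p + k = n) (m : FC (A := A) τ) :
    sigTerm V s t τ h m = iterInt V s k t fun v => contract τ h v m :=
  map_iterInt hV s
    ((ContinuousLinearMap.apply ℂ (FC (A := A) (lower τ (h ▸ Nat.le_add_right p k)))
      m).restrictScalars ℝ) k t (continuous_contract τ h)

lemma sigTerm_congr (V : ℝ → A) (s t : ℝ) {n p k k' : ℕ} (τ : Perm (Fin n))
    (h : p + k = n) (h' : p + k' = n) : sigTerm V s t τ h = sigTerm V s t τ h' := by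
  obtain rfl : k = k' := by omega
  rfl

lemma sigTerm_zero (V : ℝ → A) (s t : ℝ) {n : ℕ} (τ : Perm (Fin n)) (m : FC (A := A) τ) :
    incl _ (sigTerm V s t τ (Nat.add_zero n) m) = incl τ m := by
  refine incl_congr rfl (fun i => by rw [lower_self]; rfl) fun x => ?_
  rw [sigTerm, iterInt_zero, toOp_contract]
  congr 1
  ext i
  exact Fin.append_left _ _ i

/-- The contraction of the input of the highest level with `Y`. -/
def topContraction (Y : A) : Module.End ℂ (LTFC A) :=
  insertion fun _ : Fin 1 => Y

lemma topContraction_incl_zero (Y : A) (τ : Perm (Fin 0)) (m : FC (A := A) τ) :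
    topContraction Y (incl τ m) = 0 := by
  rw [topContraction, insertion, incl, DirectSum.toModule_lof]
  simp

lemma topContraction_incl_succ (Y : A) {n : ℕ} (τ : Perm (Fin (n + 1))) (m : FC (A := A) τ) :
    topContraction Y (incl τ m) =
      incl (lower τ (Nat.le_succ n)) (contract τ (rfl : n + 1 = n + 1) (fun _ => Y) m) := by
  rw [topContraction, insertion, incl, DirectSum.toModule_lof, dif_pos (by simp)]
  rfl

end Signature

/-! ### The equation `D' = C_V D`: uniqueness, Chen's identity, unitriangularity -/

section LinearEquation

variable {A : Type*} [CStarAlgebra A]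

/-- The components of `z` in degree greater than `N` vanish. -/
def DegreeLE (N : ℕ) (z : LTFC A) : Prop := ∀ ρ : LevelledTree, N < ρ.1 → z ρ = 0

lemma DegreeLE.mono {N N' : ℕ} (h : N ≤ N') {z : LTFC A} (hz : DegreeLE N z) : DegreeLE N' z :=
  fun ρ hρ => hz ρ (h.trans_lt hρ)

lemma degreeLE_sum {N : ℕ} {ι : Type*} (s : Finset ι) {z : ι → LTFC A}
    (hz : ∀ i ∈ s, DegreeLE N (z i)) : DegreeLE N (∑ i ∈ s, z i) := fun ρ hρ => by
  rw [DirectSum.sum_apply]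
  exact Finset.sum_eq_zero fun i hi => hz i hi ρ hρ

lemma DegreeLE.sub {N : ℕ} {z z' : LTFC A} (hz : DegreeLE N z) (hz' : DegreeLE N z') :
    DegreeLE N (z - z') := fun ρ hρ => by
  rw [DirectSum.sub_apply, hz ρ hρ, hz' ρ hρ, sub_zero]

lemma degreeLE_incl {n N : ℕ} (h : n ≤ N) (τ : Perm (Fin n)) (m : FC (A := A) τ) :
    DegreeLE N (incl τ m) := fun ρ hρ =>
  incl_apply_of_ne τ m fun e => by
    subst e
    exact absurd h hρ.not_ge

lemma exists_degreeLE (z : LTFC A) : ∃ N, DegreeLE N z := by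
  obtain ⟨T, -, hz⟩ := exists_sum_incl z
  rw [hz]
  exact ⟨T.sup Sigma.fst, degreeLE_sum _ fun τ hτ =>
    degreeLE_incl (Finset.le_sup (f := Sigma.fst) hτ) _ _⟩

lemma degreeLE_map {T : Module.End ℂ (LTFC A)}
    (hT : ∀ (τ : LevelledTree) (m : FC (A := A) τ.2), DegreeLE τ.1 (T (incl τ.2 m))) {N : ℕ}
    {z : LTFC A} (hz : DegreeLE N z) : DegreeLE N (T z) := by
  obtain ⟨S, hS, h⟩ := exists_sum_incl z
  rw [h, map_sum]
  refine degreeLE_sum _ fun τ hτ => (hT τ _).mono ?_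
  by_contra hN
  exact hS τ hτ (hz τ (not_le.1 hN))

lemma linearMap_ext_incl {M : Type*} [AddCommMonoid M] [Module ℂ M] {f g : LTFC A →ₗ[ℂ] M}
    (h : ∀ (n : ℕ) (τ : Perm (Fin n)) (m : FC (A := A) τ), f (incl τ m) = g (incl τ m)) : f = g :=
  DirectSum.linearMap_ext ℂ fun τ => LinearMap.ext fun m => h τ.1 τ.2 m

/-- Weak differentiability: all the components of `z` are differentiable at `t`, and their
derivatives are the components of `z'`. -/
def HasWeakDerivAt (z : ℝ → LTFC A) (z' : LTFC A) (t : ℝ) : Prop :=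
  ∀ ρ, HasDerivAt (fun r => z r ρ) (z' ρ) t

lemma hasWeakDerivAt_const (z : LTFC A) (t : ℝ) : HasWeakDerivAt (fun _ => z) 0 t := fun ρ =>
  hasDerivAt_const t (z ρ)

lemma HasWeakDerivAt.sub {z w : ℝ → LTFC A} {z' w' : LTFC A} {t : ℝ} (hz : HasWeakDerivAt z z' t)
    (hw : HasWeakDerivAt w w' t) : HasWeakDerivAt (fun r => z r - w r) (z' - w') t := fun ρ => by
  simpa only [DirectSum.sub_apply] using (hz ρ).fun_sub (hw ρ)

lemma HasWeakDerivAt.add {z w : ℝ → LTFC A} {z' w' : LTFC A} {t : ℝ} (hz : HasWeakDerivAt z z' t)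
    (hw : HasWeakDerivAt w w' t) : HasWeakDerivAt (fun r => z r + w r) (z' + w') t := fun ρ => by
  simpa only [DirectSum.add_apply] using (hz ρ).fun_add (hw ρ)

lemma HasWeakDerivAt.sum {ι : Type*} {s : Finset ι} {z : ι → ℝ → LTFC A} {z' : ι → LTFC A}
    {t : ℝ} (h : ∀ i ∈ s, HasWeakDerivAt (z i) (z' i) t) :
    HasWeakDerivAt (fun r => ∑ i ∈ s, z i r) (∑ i ∈ s, z' i) t := fun ρ => by
  simpa only [DirectSum.sum_apply] using HasDerivAt.fun_sum fun i hi => h i hi ρ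

lemma HasWeakDerivAt.incl {n : ℕ} {τ : Perm (Fin n)} {m : ℝ → FC (A := A) τ} {m' : FC (A := A) τ}
    {t : ℝ} (h : HasDerivAt m m' t) :
    HasWeakDerivAt (fun r => NCSignature.incl τ (m r)) (NCSignature.incl τ m') t := fun ρ => by
  by_cases hρ : ρ = ⟨n, τ⟩
  · subst hρ
    simpa only [incl_apply_self] using h
  · simpa only [incl_apply_of_ne τ _ hρ] using hasDerivAt_const t (0 : FC (A := A) ρ.2)

/-- The top contraction lowers the degree by exactly one, so a component of its image only sees the
components one degree higher. -/
lemma topContraction_apply_eq_zero (Y : A) {z : LTFC A} {ρ : LevelledTree}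
    (hz : ∀ τ : LevelledTree, τ.1 = ρ.1 + 1 → z τ = 0) : topContraction Y z ρ = 0 := by
  obtain ⟨S, hS, h⟩ := exists_sum_incl z
  rw [h, map_sum, DirectSum.sum_apply]
  refine Finset.sum_eq_zero ?_
  rintro ⟨n, τ⟩ hτ
  cases n with
  | zero => rw [topContraction_incl_zero, DirectSum.zero_apply]
  | succ n =>
    rw [topContraction_incl_succ]
    refine incl_apply_of_ne _ _ fun e => hS _ hτ (hz _ ?_)
    rw [e]

/-- Uniqueness for the equation `D' = C_V D`. -/
lemma eq_zero_of_hasWeakDerivAt {V : ℝ → A} {D : ℝ → LTFC A} {N : ℕ} (hN : ∀ t, DegreeLE N (D t))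
    (hD : ∀ t, HasWeakDerivAt D (topContraction (V t) (D t)) t) {s : ℝ} (hs : D s = 0) (t : ℝ) :
    D t = 0 := by
  -- Descending induction on the degree of `ρ`. When the components of degree `ρ.1 + 1` vanish at
  -- all times, the component at `ρ` has zero derivative, hence keeps its value `0` at `s`. With `j
  -- = N + 1` every degree is reached.
  have key : ∀ (j : ℕ) (ρ : LevelledTree), N < ρ.1 + j → ∀ t, D t ρ = 0 := by
    intro j
    induction j with
    | zero => exact fun ρ hρ t => hN t ρ hρ
    | succ j ih =>
      intro ρ hρ t
      have h : ∀ t, HasDerivAt (fun r => D r ρ) 0 t := fun t => by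
        have := hD t ρ
        rwa [topContraction_apply_eq_zero (V t) fun τ hτ => ih τ (by omega) t] at this
      have h2 := is_const_of_deriv_eq_zero (fun t => (h t).differentiableAt) (fun t => (h t).deriv)
        t s
      rw [h2, hs, DirectSum.zero_apply]
  refine DFinsupp.ext fun ρ => ?_
  exact key (N + 1) ρ (by omega) t

lemma degreeLE_pathSig (V : ℝ → A) (s t : ℝ) {N : ℕ} {z : LTFC A} (hz : DegreeLE N z) :
    DegreeLE N (pathSig V s t z) :=
  degreeLE_map (fun τ m => by
    rw [pathSig_incl]
    exact degreeLE_sum _ fun p _ => degreeLE_incl (Nat.le_of_lt_succ p.2) _ _) hz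

/-- The derivative sets `t₁ = t` in the part contracting `k + 1` inputs. By `contract_cons` this is
a contraction with `V t` following the part contracting `k` inputs, and the fixed outer contraction
comes out of the integral. -/
lemma hasWeakDerivAt_sigTerm {V : ℝ → A} (hV : Continuous V) (s t : ℝ) {n p k : ℕ}
    (τ : Perm (Fin n)) (h : p + (k + 1) = n) (h' : p + 1 + k = n) (m : FC (A := A) τ) :
    HasWeakDerivAt (fun r => incl _ (sigTerm V s r τ h m))
      (topContraction (V t) (incl _ (sigTerm V s t τ h' m))) t := by
  have hc : ∀ {p k : ℕ} (h : p + k = n), Continuous fun v => contract (A := A) τ h v m :=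
    fun h => (continuous_contract τ h).clm_apply continuous_const
  have h1 : HasDerivAt (fun r => sigTerm V s r τ h m)
      (iterInt V s k t fun v => contract τ h (Fin.cons (V t) v) m) t := by
    simp only [sigTerm_apply hV]
    exact hasDerivAt_iterInt hV s t k (hc h)
  convert HasWeakDerivAt.incl h1 using 1
  rw [topContraction_incl_succ, ← incl_contractTo _ _ _ (lower_lower τ _ _), sigTerm_apply hV]
  simp only [contract_cons τ h h']
  congr 1
  exact map_iterInt hV s ((contractTo (A := A) (lower τ (h' ▸ Nat.le_add_right (p + 1) k))
    (rfl : p + 1 = p + 1) (fun _ => V t) (lower_lower _ _ _)).restrictScalars ℝ) k t (hc h')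

lemma pathSig_incl_self (V : ℝ → A) (s : ℝ) {n : ℕ} (τ : Perm (Fin n)) (m : FC (A := A) τ) :
    pathSig V s s (incl τ m) = incl τ m := by
  rw [pathSig_incl, Fin.sum_univ_castSucc, Finset.sum_eq_zero, zero_add]
  · rw [← sigTerm_zero V s s τ m, sigTerm_congr V s s τ _ (Nat.add_zero n)]
    rfl
  · intro p _
    obtain ⟨k, hk⟩ : ∃ k, (p : ℕ) + (k + 1) = n := ⟨n - p - 1, by omega⟩
    rw [sigTerm_congr V s s τ _ (p := p.castSucc) hk, sigTerm, iterInt_self]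
    simp

lemma pathSig_self (V : ℝ → A) (s : ℝ) : pathSig V s s = 1 :=
  linearMap_ext_incl fun _ τ m => pathSig_incl_self V s τ m

lemma hasWeakDerivAt_pathSig {V : ℝ → A} (hV : Continuous V) (s t : ℝ) (z : LTFC A) :
    HasWeakDerivAt (fun r => pathSig V s r z) (topContraction (V t) (pathSig V s t z)) t := by
  obtain ⟨S, -, h⟩ := exists_sum_incl z
  rw [h]
  simp only [map_sum]
  refine HasWeakDerivAt.sum ?_
  rintro ⟨n, τ⟩ -
  generalize z ⟨n, τ⟩ = m
  simp only [pathSig_incl]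
  -- The two sums match after a shift of `p` by one: the derivative of the term `p` comes from the
  -- term `p + 1`. The unmatched terms vanish: `p = 0` on the right has no input to contract, and `p
  -- = n` on the left is the constant `m`.
  rw [map_sum, Fin.sum_univ_succ]
  simp only [Fin.sum_univ_castSucc (n := n)]
  have h0 : topContraction (V t) (incl (lower τ (Nat.le_of_lt_succ (0 : Fin (n + 1)).2))
      (sigTerm V s t τ (Nat.add_sub_of_le (Nat.le_of_lt_succ (0 : Fin (n + 1)).2)) m)) = 0 :=
    topContraction_incl_zero _ _ _
  rw [h0, add_comm (0 : LTFC A)]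
  refine HasWeakDerivAt.add (HasWeakDerivAt.sum fun p _ => ?_) ?_
  · obtain ⟨k, hk⟩ : ∃ k, (p : ℕ) + (k + 1) = n := ⟨n - p - 1, by omega⟩
    have hk' : (p : ℕ) + 1 + k = n := by omega
    have h1 := hasWeakDerivAt_sigTerm hV s t τ hk hk' m
    rw [sigTerm_congr V s t τ (p := p.succ) _ hk']
    convert h1 using 2 with r
    · exact congrArg (fun L => incl (lower τ p.2.le) (L m))
        (sigTerm_congr V s r τ (Nat.add_sub_of_le p.2.le) hk)
    · rfl
  · have h1 := hasWeakDerivAt_const (incl τ m) t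
    convert h1 using 2 with r
    rw [← sigTerm_zero V s r τ m, sigTerm_congr V s r τ (p := Fin.last n) _ (Nat.add_zero n)]
    rfl

/-- Solutions of the equation `D' = C_V D` are determined by their initial values. -/
lemma eq_pathSig_of_hasWeakDerivAt {V : ℝ → A} (hV : Continuous V) {D : ℝ → LTFC A} {N : ℕ}
    (hN : ∀ t, DegreeLE N (D t)) (hD : ∀ t, HasWeakDerivAt D (topContraction (V t) (D t)) t)
    (s t : ℝ) : D t = pathSig V s t (D s) := by
  have h := eq_zero_of_hasWeakDerivAt (V := V) (D := fun t => D t - pathSig V s t (D s)) (N := N)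
    (fun t => (hN t).sub (degreeLE_pathSig V s t (hN s)))
    (fun t => by
      rw [map_sub]
      exact (hD t).sub (hasWeakDerivAt_pathSig hV s t (D s))) (s := s)
    (by simp [pathSig_self]) t
  exact sub_eq_zero.1 h

/-- As a function of `t`, the left side is a solution whose value at `u` is `pathSig V s u z`;
uniqueness is applied with `u` as initial time. -/
lemma pathSig_comp {V : ℝ → A} (hV : Continuous V) (s u t : ℝ) :
    pathSig V s t = pathSig V u t ∘ₗ pathSig V s u := by
  refine LinearMap.ext fun z => ?_
  obtain ⟨N, hN⟩ := exists_degreeLE z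
  exact eq_pathSig_of_hasWeakDerivAt hV (fun t => degreeLE_pathSig V s t hN)
    (fun t => hasWeakDerivAt_pathSig hV s t z) u t

lemma isUnitriangular_pathSig (V : ℝ → A) (s t : ℝ) : IsUnitriangular (pathSig V s t) := by
  rintro ⟨n, τ⟩ ρ m hρ
  have h : (pathSig V s t - 1) (incl τ m) = ∑ p : Fin n,
      incl (lower τ p.2.le) (sigTerm V s t τ (Nat.add_sub_of_le p.2.le) m) := by
    rw [LinearMap.sub_apply, pathSig_incl, Fin.sum_univ_castSucc, Module.End.one_apply,
      sub_eq_iff_eq_add]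
    congr 1
    rw [← sigTerm_zero V s t τ m, sigTerm_congr V s t τ _ (Nat.add_zero n)]
    rfl
  change ((pathSig V s t - 1) (incl τ m)) ρ ≠ 0 at hρ
  rw [h, DirectSum.sum_apply] at hρ
  obtain ⟨p, -, hp⟩ := Finset.exists_ne_zero_of_sum_ne_zero hρ
  have : ρ = ⟨p, lower τ p.2.le⟩ := by
    by_contra hne
    exact hp (incl_apply_of_ne _ _ hne)
  subst this
  exact ⟨p.2, rfl⟩

lemma pathSig_unit (V : ℝ → A) (s t : ℝ) : pathSig V s t (unitFC A) = unitFC A := by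
  rw [unitFC, pathSig_incl, Fin.sum_univ_castSucc, Finset.univ_eq_empty, Finset.sum_empty, zero_add]
  conv_rhs => rw [← sigTerm_zero V s t]
  rfl

end LinearEquation

/-! ### Compatibility with the involution -/

section Involution

variable {A : Type*} [CStarAlgebra A]

lemma toOp_starFC {n : ℕ} (τ : Perm (Fin n)) (m : FC (A := A) τ) (x : Fin n → A) :
    FC.toOp _ (starFC τ m) x = star (FC.toOp τ m fun i => star (x i)) := rfl

lemma continuous_starFC {n : ℕ} (τ : Perm (Fin n)) : Continuous (starFC (A := A) τ) := by
  refine AddMonoidHomClass.continuous_of_bound _ 1 fun m => ?_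
  rw [one_mul, ← FC.norm_toOp, ← FC.norm_toOp]
  refine ContinuousMultilinearMap.opNorm_le_bound (norm_nonneg _) fun x => ?_
  rw [toOp_starFC, norm_star]
  simpa using (FC.toOp τ m).le_opNorm fun i => star (x i)

lemma starMap_incl {n : ℕ} (τ : Perm (Fin n)) (m : FC (A := A) τ) :
    starMap A (incl τ m) = incl (τ * Fin.revPerm) (starFC τ m) := by
  rw [starMap, incl, DirectSum.lof_eq_of, DirectSum.toAddMonoid_of]
  rfl

lemma starMap_apply {n : ℕ} (z : LTFC A) (ρ : Perm (Fin n)) :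
    starMap A z ⟨n, ρ * Fin.revPerm⟩ = starFC ρ (z ⟨n, ρ⟩) := by
  obtain ⟨S, -, h⟩ := exists_sum_incl z
  rw [h, map_sum, DirectSum.sum_apply, DirectSum.sum_apply, map_sum]
  refine Finset.sum_congr rfl ?_
  rintro ⟨n', τ⟩ -
  rw [starMap_incl]
  by_cases hτ : (⟨n', τ⟩ : LevelledTree) = ⟨n, ρ⟩
  · cases hτ
    rw [incl_apply_self, incl_apply_self]
  · rw [incl_apply_of_ne _ _ (Ne.symm hτ), map_zero]
    refine incl_apply_of_ne _ _ fun e => hτ ?_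
    obtain rfl : n = n' := congrArg Sigma.fst e
    have e2 := eq_of_heq (Sigma.mk.inj e).2
    rw [mul_right_cancel e2]

/-- Mirror images reverse faces and keep levels, so the highest input remains the highest. The
involution stars every input before it is used, which turns `Y` into `star Y`. -/
lemma starMap_topContraction (Y : A) (z : LTFC A) :
    starMap A (topContraction Y z) = topContraction (star Y) (starMap A z) := by
  obtain ⟨S, -, h⟩ := exists_sum_incl z
  rw [h]
  simp only [map_sum]
  refine Finset.sum_congr rfl ?_
  rintro ⟨n, τ⟩ -
  generalize z ⟨n, τ⟩ = m
  cases n with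
  | zero => simp only [starMap_incl, topContraction_incl_zero, map_zero]
  | succ n =>
    simp only [starMap_incl, topContraction_incl_succ]
    refine incl_congr rfl (fun i => by rw [lower_mul_revPerm]; rfl) fun x => ?_
    rw [toOp_contract, toOp_starFC, toOp_starFC, toOp_contract]
    congr 2
    ext i
    refine Fin.addCases (m := n) (n := 1) (fun i => ?_) (fun i => ?_) i
    · simp only [Fin.cast_eq_self, Fin.append_left]
    · simp only [Fin.cast_eq_self, Fin.append_right]
      simp

lemma HasWeakDerivAt.starMap {z : ℝ → LTFC A} {z' : LTFC A} {t : ℝ} (h : HasWeakDerivAt z z' t) :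
    HasWeakDerivAt (fun r => NCSignature.starMap A (z r)) (NCSignature.starMap A z') t := by
  rintro ⟨n, ρ⟩
  obtain ⟨ρ, rfl⟩ : ∃ ρ', ρ = ρ' * Fin.revPerm :=
    ⟨ρ * Fin.revPerm, by ext i; simp⟩
  simp only [starMap_apply]
  -- A continuous additive map is real linear, which suffices for derivatives in the real variable
  -- `t`.
  exact ((starFC (A := A) ρ).toRealLinearMap (continuous_starFC ρ)).hasFDerivAt.comp_hasDerivAt t
    (h ⟨n, ρ⟩)

lemma DegreeLE.starMap {N : ℕ} {z : LTFC A} (h : DegreeLE N z) :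
    DegreeLE N (NCSignature.starMap A z) := by
  rintro ⟨n, ρ⟩ hρ
  obtain ⟨ρ, rfl⟩ : ∃ ρ', ρ = ρ' * Fin.revPerm :=
    ⟨ρ * Fin.revPerm, by ext i; simp⟩
  rw [starMap_apply, h ⟨n, ρ⟩ hρ, map_zero]

/-- The image of a solution by the involution solves the equation of `star V`, which is `V` itself;
uniqueness with initial time `s` concludes. -/
lemma pathSig_starMap {V : ℝ → A} (hV : Continuous V) (hV' : ∀ r, star (V r) = V r) (s t : ℝ)
    (z : LTFC A) : pathSig V s t (starMap A z) = starMap A (pathSig V s t z) := by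
  obtain ⟨N, hN⟩ := exists_degreeLE z
  have h := eq_pathSig_of_hasWeakDerivAt hV (D := fun t => starMap A (pathSig V s t z))
    (fun t => (degreeLE_pathSig V s t hN).starMap) (fun t => by
      have := (hasWeakDerivAt_pathSig hV s t z).starMap
      rwa [starMap_topContraction, hV'] at this) s t
  rw [h, pathSig_self]
  rfl

end Involution

/-! ### Inserting a greatest letter in a word -/

section InsertTop

/-- The word obtained from `s` by inserting a new greatest letter at the position `p`. -/
def insertTop {M N : ℕ} (h : N + 1 = M) (p : Fin M) (s : Perm (Fin N)) : Perm (Fin M) :=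
  (finCongr h).permCongr ((finSuccEquiv' (Fin.cast h.symm p)).trans
    (s.optionCongr.trans (finSuccEquiv' (Fin.last N)).symm))

lemma val_insertTop_self {M N : ℕ} (h : N + 1 = M) (p : Fin M) (s : Perm (Fin N)) :
    (insertTop h p s p : ℕ) = N := by
  subst h
  simp [insertTop]

lemma val_insertTop_succAbove {N : ℕ} (p : Fin (N + 1)) (s : Perm (Fin N)) (i : Fin N) :
    (insertTop rfl p s (p.succAbove i) : ℕ) = s i := by
  simp [insertTop]

lemma val_insertTop_of_lt {M N : ℕ} (h : N + 1 = M) (p : Fin M) (s : Perm (Fin N)) {i : Fin N}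
    {j : Fin M} (hij : (j : ℕ) = i) (hi : (i : ℕ) < p) : (insertTop h p s j : ℕ) = s i := by
  subst h
  rw [← val_insertTop_succAbove p s i, Fin.succAbove_of_castSucc_lt _ _ (Fin.lt_def.2 hi)]
  congr 2
  exact Fin.ext hij

lemma val_insertTop_of_le {M N : ℕ} (h : N + 1 = M) (p : Fin M) (s : Perm (Fin N)) {i : Fin N}
    {j : Fin M} (hij : (j : ℕ) = i + 1) (hi : (p : ℕ) ≤ i) : (insertTop h p s j : ℕ) = s i := by
  subst h
  rw [← val_insertTop_succAbove p s i, Fin.succAbove_of_le_castSucc _ _ (Fin.le_def.2 hi)]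
  congr 2
  exact Fin.ext hij

lemma insertTop_injective {M N : ℕ} (h : N + 1 = M) (p : Fin M) :
    Function.Injective (insertTop h p) := by
  subst h
  intro s s' hs
  ext i
  rw [← val_insertTop_succAbove p s i, hs, val_insertTop_succAbove]

lemma exists_insertTop {M N : ℕ} (h : N + 1 = M) (p : Fin M) (s : Perm (Fin M))
    (hs : (s p : ℕ) = N) : ∃ s', insertTop h p s' = s := by
  subst h
  have hp : s p = Fin.last N := Fin.ext hs
  -- With the position `p` and the letter `N` both encoded as `none`, `s` becomes a permutation
  -- fixing `none`, from which `none` can be removed.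
  let e : Option (Fin N) ≃ Option (Fin N) :=
    (finSuccEquiv' p).symm.trans (s.trans (finSuccEquiv' (Fin.last N)))
  have he : e none = none := by simp [e, hp]
  have he' : (Equiv.removeNone e).optionCongr = e := by
    ext1 i
    cases i with
    | none => simp [he]
    | some i =>
      rw [Equiv.optionCongr_apply, Option.map_some]
      refine Equiv.removeNone_some e (Option.ne_none_iff_exists'.1 fun hi => ?_)
      rw [← he] at hi
      simpa using e.injective hi
  refine ⟨Equiv.removeNone e, ?_⟩
  rw [insertTop, he']
  ext i
  simp [e]

end InsertTop

/-! ### Shuffles sorted by the block of their greatest letter -/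

section Shuffles

/-- The greatest letter of `s` is among the first `n` ones. -/
def TopLeft {n n' : ℕ} (s : Perm (Fin (n + n'))) : Prop :=
  ∃ i : Fin n, (s (Fin.castAdd n' i) : ℕ) + 1 = n + n'

/-- The greatest letter of `s` is among the last `n'` ones. -/
def TopRight {n n' : ℕ} (s : Perm (Fin (n + n'))) : Prop :=
  ∃ i : Fin n', (s (Fin.natAdd n i) : ℕ) + 1 = n + n'

/-- The greatest letter is at exactly one position; positivity is what makes it exist. -/
lemma not_topLeft_iff {n n' : ℕ} (h : 0 < n + n') (s : Perm (Fin (n + n'))) :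
    ¬ TopLeft s ↔ TopRight s := by
  constructor
  · intro hs
    have h1 : ((s (s.symm ⟨n + n' - 1, by omega⟩) : Fin (n + n')) : ℕ) + 1 = n + n' := by
      rw [Equiv.apply_symm_apply]
      exact Nat.sub_add_cancel h
    revert h1
    generalize s.symm ⟨n + n' - 1, by omega⟩ = i
    refine Fin.addCases (fun i h1 => ?_) (fun i h1 => ?_) i
    · exact absurd ⟨i, h1⟩ hs
    · exact ⟨i, h1⟩
  · rintro ⟨i, hi⟩ ⟨j, hj⟩
    have := congrArg Fin.val (s.injective (Fin.ext (by omega) :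
      s (Fin.natAdd n i) = s (Fin.castAdd n' j)))
    simp at this
    omega

section Left

variable {n n' : ℕ} (s : Perm (Fin (n + n')))

/-- The shuffle obtained from `s` by adding a greatest letter at the end of the left block. -/
def addTopLeft : Perm (Fin (n + 1 + n')) :=
  insertTop (by omega) (Fin.castAdd n' (Fin.last n)) s

lemma val_addTopLeft_last : (addTopLeft s (Fin.castAdd n' (Fin.last n)) : ℕ) = n + n' :=
  val_insertTop_self _ _ _

lemma val_addTopLeft_castSucc (i : Fin n) :
    (addTopLeft s (Fin.castAdd n' i.castSucc) : ℕ) = s (Fin.castAdd n' i) :=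
  val_insertTop_of_lt _ _ _ rfl i.2

lemma val_addTopLeft_natAdd (i : Fin n') :
    (addTopLeft s (Fin.natAdd (n + 1) i) : ℕ) = s (Fin.natAdd n i) :=
  val_insertTop_of_le _ _ _ (by simp; omega) (by simp)

lemma isShuffle_addTopLeft : IsShuffle (addTopLeft s) ↔ IsShuffle s := by
  simp only [IsShuffle, Fin.lt_def, val_addTopLeft_natAdd]
  refine and_congr_left fun _ => ⟨fun h i j hij => ?_, fun h i j hij => ?_⟩
  · have := h i.castSucc j.castSucc hij
    rwa [val_addTopLeft_castSucc, val_addTopLeft_castSucc] at this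
  · have hi : (i : ℕ) < n := by have := j.2; omega
    obtain ⟨i, rfl⟩ : ∃ i' : Fin n, i = i'.castSucc := ⟨⟨i, hi⟩, rfl⟩
    rw [val_addTopLeft_castSucc]
    induction j using Fin.lastCases with
    | last => rw [val_addTopLeft_last]; exact (s _).2
    | cast j => rw [val_addTopLeft_castSucc]; exact h i j hij

lemma topLeft_addTopLeft : TopLeft (addTopLeft s) :=
  ⟨Fin.last n, by rw [val_addTopLeft_last]; omega⟩

/-- The left block of a shuffle is increasing, so a greatest letter in this block is its last letter
and can be removed. -/
lemma exists_addTopLeft {s : Perm (Fin (n + 1 + n'))} (hs : IsShuffle s) (h : TopLeft s) :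
    ∃ s', addTopLeft s' = s := by
  refine exists_insertTop _ _ _ ?_
  obtain ⟨i, hi⟩ := h
  have h2 := (s (Fin.castAdd n' (Fin.last n))).2
  rcases (Fin.le_last i).eq_or_lt with rfl | hlt
  · omega
  · have := Fin.lt_def.1 (hs.1 i _ hlt)
    omega

end Left

section Right

variable {n n' : ℕ} (s : Perm (Fin (n + n')))

/-- The shuffle obtained from `s` by adding a greatest letter at the end of the right block. -/
def addTopRight : Perm (Fin (n + (n' + 1))) :=
  insertTop rfl (Fin.natAdd n (Fin.last n')) s

lemma val_addTopRight_last : (addTopRight s (Fin.natAdd n (Fin.last n')) : ℕ) = n + n' :=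
  val_insertTop_self _ _ _

lemma val_addTopRight_castSucc (i : Fin n') :
    (addTopRight s (Fin.natAdd n i.castSucc) : ℕ) = s (Fin.natAdd n i) :=
  val_insertTop_of_lt _ _ _ rfl (by simp)

lemma val_addTopRight_castAdd (i : Fin n) :
    (addTopRight s (Fin.castAdd (n' + 1) i) : ℕ) = s (Fin.castAdd n' i) :=
  val_insertTop_of_lt _ _ _ rfl (by simp; omega)

lemma isShuffle_addTopRight : IsShuffle (addTopRight s) ↔ IsShuffle s := by
  simp only [IsShuffle, Fin.lt_def, val_addTopRight_castAdd]
  refine and_congr_right fun _ => ⟨fun h i j hij => ?_, fun h i j hij => ?_⟩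
  · have := h i.castSucc j.castSucc hij
    rwa [val_addTopRight_castSucc, val_addTopRight_castSucc] at this
  · have hi : (i : ℕ) < n' := by have := j.2; omega
    obtain ⟨i, rfl⟩ : ∃ i' : Fin n', i = i'.castSucc := ⟨⟨i, hi⟩, rfl⟩
    rw [val_addTopRight_castSucc]
    induction j using Fin.lastCases with
    | last => rw [val_addTopRight_last]; exact (s _).2
    | cast j => rw [val_addTopRight_castSucc]; exact h i j hij

lemma topRight_addTopRight : TopRight (addTopRight s) :=
  ⟨Fin.last n', by rw [val_addTopRight_last]; omega⟩

lemma exists_addTopRight {s : Perm (Fin (n + (n' + 1)))} (hs : IsShuffle s) (h : TopRight s) :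
    ∃ s', addTopRight s' = s := by
  refine exists_insertTop _ _ _ ?_
  obtain ⟨i, hi⟩ := h
  have h2 := (s (Fin.natAdd n (Fin.last n'))).2
  rcases (Fin.le_last i).eq_or_lt with rfl | hlt
  · omega
  · have := Fin.lt_def.1 (hs.2 i _ hlt)
    omega

end Right

end Shuffles

/-! ### The top contraction is a derivation of the shuffle product -/

section Derivation

lemma append_const_of_val_eq {A : Type*} {N M : ℕ} (h : M = N + 1) (y : Fin N → A) (Y : A)
    {i : Fin M} {j : Fin N} (hij : (i : ℕ) = j) : Fin.append y (fun _ : Fin 1 => Y) (Fin.cast h i) = y j := by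
  subst h
  have : i = Fin.castAdd 1 j := Fin.ext hij
  rw [Fin.cast_eq_self, this, Fin.append_left]

lemma append_const_of_val_top {A : Type*} {N M : ℕ} (h : M = N + 1) (y : Fin N → A) (Y : A)
    {i : Fin M} (hi : (i : ℕ) = N) : Fin.append y (fun _ : Fin 1 => Y) (Fin.cast h i) = Y := by
  subst h
  have : i = Fin.natAdd N (0 : Fin 1) := Fin.ext (by simpa using hi)
  rw [Fin.cast_eq_self, this, Fin.append_right]

variable {A : Type*} [CStarAlgebra A]

lemma shuffle_incl {n n' : ℕ} (τ : Perm (Fin n)) (τ' : Perm (Fin n')) (m : FC (A := A) τ)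
    (m' : FC (A := A) τ') : shuffle A (incl τ m) (incl τ' m') =
      ∑ s : Perm (Fin (n + n')) with IsShuffle s, incl (s * tensorPerm τ τ') (mulFC s τ τ' m m') := by
  rw [shuffle, incl, DirectSum.toModule_lof, LinearMap.flip_apply, incl, DirectSum.toModule_lof,
    LinearMap.flip_apply, LinearMap.sum_apply, LinearMap.sum_apply,
    Finset.sum_subtype (p := IsShuffle) _ (by simp)]
  rfl

lemma toOp_mulFC {n n' : ℕ} (s : Perm (Fin (n + n'))) (τ : Perm (Fin n)) (τ' : Perm (Fin n'))
    (m : FC (A := A) τ) (m' : FC (A := A) τ') (x : Fin (n + n') → A) :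
    FC.toOp _ (mulFC s τ τ' m m') x =
      FC.toOp τ m (fun i => x (s (Fin.castAdd n' i))) *
        FC.toOp τ' m' fun i => x (s (Fin.natAdd n i)) := rfl

lemma topContraction_incl (Y : A) {n N : ℕ} (h : N + 1 = n) (τ : Perm (Fin n)) (m : FC (A := A) τ) :
    topContraction Y (incl τ m) =
      incl (lower τ (h ▸ Nat.le_add_right N 1)) (contract τ h (fun _ => Y) m) := by
  subst h
  exact topContraction_incl_succ Y τ m

/-- The greatest letter ends the left block, so the highest input of the product is the highest
input of `m`: contracting it in the product or in `m` is the same. -/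
lemma topContraction_mulFC_addTopLeft (Y : A) {n n' : ℕ} (s : Perm (Fin (n + n')))
    (τ : Perm (Fin (n + 1))) (τ' : Perm (Fin n')) (m : FC (A := A) τ) (m' : FC (A := A) τ') :
    topContraction Y (incl (addTopLeft s * tensorPerm τ τ') (mulFC (addTopLeft s) τ τ' m m')) =
      incl (s * tensorPerm (lower τ (Nat.le_succ n)) τ')
        (mulFC s _ τ' (contract τ (rfl : n + 1 = n + 1) (fun _ => Y) m) m') := by
  have hN : n + n' + 1 = n + 1 + n' := by omega
  have hlow : ∀ {l : Fin (n + 1)} {l' : Fin n}, (l : ℕ) = l' →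
      (addTopLeft s (Fin.castAdd n' l) : ℕ) = s (Fin.castAdd n' l') := fun {l l'} h => by
    obtain rfl : l = l'.castSucc := Fin.ext h
    exact val_addTopLeft_castSucc s l'
  rw [topContraction_incl Y hN]
  refine incl_congr rfl (fun i => ?_) fun x => ?_
  -- The map `e` lists the positions left after deletion of the top letter: those of the low letters
  -- of `τ` in the left factor, and the whole right factor.
  · rw [lower_eq_of_strictMono (σ := s * tensorPerm (lower τ (Nat.le_succ n)) τ')
      (e := Fin.addCases (fun i => Fin.castAdd n' (lowPos τ (Nat.le_succ n) i))
        (fun i => Fin.natAdd (n + 1) i))]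
    · rfl
    · intro i j
      refine Fin.addCases (fun i => ?_) (fun i => ?_) i <;>
      refine Fin.addCases (fun j => ?_) (fun j => ?_) j <;>
      intro hij <;> simp only [Fin.addCases_left, Fin.addCases_right] <;>
      rw [Fin.lt_def] at hij ⊢ <;> simp at hij ⊢
      · exact hij
      · omega
      · omega
      · exact hij
    · intro j
      refine Fin.addCases (fun j => ?_) (fun j => ?_) j
      · simp only [Fin.addCases_left, Perm.mul_apply, tensorPerm_castAdd]
        exact hlow (val_lowPos τ _ j)
      · simp only [Fin.addCases_right, Perm.mul_apply, tensorPerm_natAdd]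
        exact val_addTopLeft_natAdd s _
  · rw [toOp_contract, toOp_mulFC, toOp_mulFC, toOp_contract]
    congr 2
    · ext i
      refine Fin.lastCases ?_ (fun i => ?_) i
      · rw [append_const_of_val_top _ _ _ (val_addTopLeft_last s)]
        exact (append_const_of_val_top rfl _ _ rfl).symm
      · rw [append_const_of_val_eq _ _ _ (val_addTopLeft_castSucc s i)]
        exact (append_const_of_val_eq rfl (fun i => x (s (Fin.castAdd n' i))) Y rfl).symm
    · ext i
      rw [append_const_of_val_eq _ _ _ (val_addTopLeft_natAdd s i)]
      rfl

lemma topContraction_mulFC_addTopRight (Y : A) {n n' : ℕ} (s : Perm (Fin (n + n')))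
    (τ : Perm (Fin n)) (τ' : Perm (Fin (n' + 1))) (m : FC (A := A) τ) (m' : FC (A := A) τ') :
    topContraction Y (incl (addTopRight s * tensorPerm τ τ') (mulFC (addTopRight s) τ τ' m m')) =
      incl (s * tensorPerm τ (lower τ' (Nat.le_succ n')))
        (mulFC s τ _ m (contract τ' (rfl : n' + 1 = n' + 1) (fun _ => Y) m')) := by
  have hN : n + n' + 1 = n + (n' + 1) := rfl
  have hlow : ∀ {l : Fin (n' + 1)} {l' : Fin n'}, (l : ℕ) = l' →
      (addTopRight s (Fin.natAdd n l) : ℕ) = s (Fin.natAdd n l') := fun {l l'} h => by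
    obtain rfl : l = l'.castSucc := Fin.ext h
    exact val_addTopRight_castSucc s l'
  rw [topContraction_incl Y hN]
  refine incl_congr rfl (fun i => ?_) fun x => ?_
  · rw [lower_eq_of_strictMono (σ := s * tensorPerm τ (lower τ' (Nat.le_succ n')))
      (e := Fin.addCases (fun i => Fin.castAdd (n' + 1) i)
        (fun i => Fin.natAdd n (lowPos τ' (Nat.le_succ n') i)))]
    · rfl
    · intro i j
      refine Fin.addCases (fun i => ?_) (fun i => ?_) i <;>
      refine Fin.addCases (fun j => ?_) (fun j => ?_) j <;>
      intro hij <;> simp only [Fin.addCases_left, Fin.addCases_right] <;>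
      rw [Fin.lt_def] at hij ⊢ <;> simp at hij ⊢
      · exact hij
      · omega
      · omega
      · exact hij
    · intro j
      refine Fin.addCases (fun j => ?_) (fun j => ?_) j
      · simp only [Fin.addCases_left, Perm.mul_apply, tensorPerm_castAdd]
        exact val_addTopRight_castAdd s _
      · simp only [Fin.addCases_right, Perm.mul_apply, tensorPerm_natAdd]
        exact hlow (val_lowPos τ' _ j)
  · rw [toOp_contract, toOp_mulFC, toOp_mulFC, toOp_contract]
    congr 2
    · ext i
      rw [append_const_of_val_eq _ _ _ (val_addTopRight_castAdd s i)]
      rfl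
    · ext i
      refine Fin.lastCases ?_ (fun i => ?_) i
      · rw [append_const_of_val_top _ _ _ (val_addTopRight_last s)]
        exact (append_const_of_val_top rfl _ _ rfl).symm
      · rw [append_const_of_val_eq _ _ _ (val_addTopRight_castSucc s i)]
        exact (append_const_of_val_eq rfl (fun i => x (s (Fin.natAdd n i))) Y rfl).symm

open Classical in
-- `addTopLeft` is a bijection from the shuffles of blocks of lengths `n - 1` and `n'` onto those
-- counted here. For `n = 0` there are none, and the contraction of a tree without vertices vanishes
-- too.
lemma sum_topLeft (Y : A) {n n' : ℕ} (τ : Perm (Fin n)) (τ' : Perm (Fin n')) (m : FC (A := A) τ)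
    (m' : FC (A := A) τ') :
    ∑ s : Perm (Fin (n + n')) with IsShuffle s ∧ TopLeft s,
      topContraction Y (incl (s * tensorPerm τ τ') (mulFC s τ τ' m m')) =
      shuffle A (topContraction Y (incl τ m)) (incl τ' m') := by
  cases n with
  | zero =>
    rw [topContraction_incl_zero, map_zero, LinearMap.zero_apply]
    refine Finset.sum_eq_zero fun s hs => ?_
    obtain ⟨i, -⟩ := (Finset.mem_filter.1 hs).2.2
    exact i.elim0
  | succ n =>
    rw [topContraction_incl_succ, shuffle_incl]
    refine (Finset.sum_bij (fun s _ => addTopLeft s) ?_ ?_ ?_ ?_).symm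
    · intro s hs
      simp only [Finset.mem_filter, Finset.mem_univ, true_and] at hs ⊢
      exact ⟨(isShuffle_addTopLeft s).2 hs, topLeft_addTopLeft s⟩
    · intro s _ s' _ h
      exact insertTop_injective _ _ h
    · intro s hs
      simp only [Finset.mem_filter, Finset.mem_univ, true_and] at hs
      obtain ⟨s', rfl⟩ := exists_addTopLeft hs.1 hs.2
      exact ⟨s', by simpa using (isShuffle_addTopLeft s').1 hs.1, rfl⟩
    · intro s _
      rw [topContraction_mulFC_addTopLeft]

open Classical in
lemma sum_topRight (Y : A) {n n' : ℕ} (τ : Perm (Fin n)) (τ' : Perm (Fin n')) (m : FC (A := A) τ)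
    (m' : FC (A := A) τ') :
    ∑ s : Perm (Fin (n + n')) with IsShuffle s ∧ TopRight s,
      topContraction Y (incl (s * tensorPerm τ τ') (mulFC s τ τ' m m')) =
      shuffle A (incl τ m) (topContraction Y (incl τ' m')) := by
  cases n' with
  | zero =>
    rw [topContraction_incl_zero, map_zero]
    refine Finset.sum_eq_zero fun s hs => ?_
    obtain ⟨i, -⟩ := (Finset.mem_filter.1 hs).2.2
    exact i.elim0
  | succ n' =>
    rw [topContraction_incl_succ, shuffle_incl]
    refine (Finset.sum_bij (fun s _ => addTopRight s) ?_ ?_ ?_ ?_).symm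
    · intro s hs
      simp only [Finset.mem_filter, Finset.mem_univ, true_and] at hs ⊢
      exact ⟨(isShuffle_addTopRight s).2 hs, topRight_addTopRight s⟩
    · intro s _ s' _ h
      exact insertTop_injective _ _ h
    · intro s hs
      simp only [Finset.mem_filter, Finset.mem_univ, true_and] at hs
      obtain ⟨s', rfl⟩ := exists_addTopRight hs.1 hs.2
      exact ⟨s', by simpa using (isShuffle_addTopRight s').1 hs.1, rfl⟩
    · intro s _
      rw [topContraction_mulFC_addTopRight]

lemma topContraction_shuffle_incl (Y : A) {n n' : ℕ} (τ : Perm (Fin n)) (τ' : Perm (Fin n'))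
    (m : FC (A := A) τ) (m' : FC (A := A) τ') :
    topContraction Y (shuffle A (incl τ m) (incl τ' m')) =
      shuffle A (topContraction Y (incl τ m)) (incl τ' m') +
        shuffle A (incl τ m) (topContraction Y (incl τ' m')) := by
  classical
  rw [shuffle_incl, map_sum, ← Finset.sum_filter_add_sum_filter_not _ TopLeft,
    Finset.filter_filter, Finset.filter_filter, sum_topLeft]
  congr 1
  -- Without any letter, "not on the left" no longer means "on the right"; then all contractions
  -- vanish.
  rcases Nat.eq_zero_or_pos (n + n') with h | h
  · obtain ⟨rfl, rfl⟩ : n = 0 ∧ n' = 0 := by omega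
    rw [topContraction_incl_zero, map_zero]
    exact Finset.sum_eq_zero fun s _ => topContraction_incl_zero Y _ _
  · simp only [not_topLeft_iff h]
    exact sum_topRight Y τ τ' m m'

lemma topContraction_shuffle (Y : A) (z w : LTFC A) :
    topContraction Y (shuffle A z w) =
      shuffle A (topContraction Y z) w + shuffle A z (topContraction Y w) := by
  obtain ⟨S, -, hz⟩ := exists_sum_incl z
  obtain ⟨T, -, hw⟩ := exists_sum_incl w
  rw [hz, hw]
  simp only [map_sum, LinearMap.sum_apply, topContraction_shuffle_incl, Finset.sum_add_distrib]

end Derivation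

/-! ### Multiplicativity of the signature -/

section Morphism

variable {A : Type*} [CStarAlgebra A]

lemma norm_mulFC_le {n n' : ℕ} (s : Perm (Fin (n + n'))) (τ : Perm (Fin n)) (τ' : Perm (Fin n'))
    (m : FC (A := A) τ) (m' : FC (A := A) τ') : ‖mulFC s τ τ' m m'‖ ≤ ‖m‖ * ‖m'‖ := by
  rw [← FC.norm_toOp, ← FC.norm_toOp, ← FC.norm_toOp]
  refine ContinuousMultilinearMap.opNorm_le_bound (by positivity) fun x => ?_
  rw [toOp_mulFC]
  refine (norm_mul_le _ _).trans ?_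
  rw [← Equiv.prod_comp s, Fin.prod_univ_add, mul_mul_mul_comm]
  exact mul_le_mul (ContinuousMultilinearMap.le_opNorm _ _)
    (ContinuousMultilinearMap.le_opNorm _ _) (norm_nonneg _) (by positivity)

lemma isBoundedBilinearMap_mulFC {n n' : ℕ} (s : Perm (Fin (n + n'))) (τ : Perm (Fin n))
    (τ' : Perm (Fin n')) : IsBoundedBilinearMap ℝ
      fun q : FC (A := A) τ × FC (A := A) τ' => mulFC s τ τ' q.1 q.2 where
  add_left _ _ _ := LinearMap.map_add₂ _ _ _ _
  smul_left c m m' := LinearMap.map_smul₂ (mulFC s τ τ') (c : ℂ) m m'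
  add_right _ _ _ := map_add _ _ _
  smul_right c m m' := (mulFC s τ τ' m).map_smul (c : ℂ) m'
  bound := ⟨1, one_pos, fun m m' => by simpa using norm_mulFC_le s τ τ' m m'⟩

lemma hasDerivAt_mulFC {n n' : ℕ} (s : Perm (Fin (n + n'))) {τ : Perm (Fin n)}
    {τ' : Perm (Fin n')} {m : ℝ → FC (A := A) τ} {m' : ℝ → FC (A := A) τ'} {dm : FC (A := A) τ}
    {dm' : FC (A := A) τ'} {t : ℝ} (h : HasDerivAt m dm t) (h' : HasDerivAt m' dm' t) :
    HasDerivAt (fun r => mulFC s τ τ' (m r) (m' r))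
      (mulFC s τ τ' dm (m' t) + mulFC s τ τ' (m t) dm') t := by
  have := ((isBoundedBilinearMap_mulFC s τ τ').hasFDerivAt (m t, m' t)).comp_hasDerivAt t
    (h.prodMk h')
  rw [add_comm (mulFC s τ τ' dm (m' t))]
  exact this

lemma HasWeakDerivAt.shuffle_incl {n n' : ℕ} {τ : Perm (Fin n)}
    {τ' : Perm (Fin n')} {m : ℝ → FC (A := A) τ} {m' : ℝ → FC (A := A) τ'} {dm : FC (A := A) τ}
    {dm' : FC (A := A) τ'} {t : ℝ} (h : HasDerivAt m dm t) (h' : HasDerivAt m' dm' t) :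
    HasWeakDerivAt (fun r => shuffle A (NCSignature.incl τ (m r)) (NCSignature.incl τ' (m' r)))
      (shuffle A (NCSignature.incl τ dm) (NCSignature.incl τ' (m' t)) +
        shuffle A (NCSignature.incl τ (m t)) (NCSignature.incl τ' dm')) t := by
  simp only [NCSignature.shuffle_incl, ← Finset.sum_add_distrib, ← map_add]
  exact HasWeakDerivAt.sum fun s _ => HasWeakDerivAt.incl (hasDerivAt_mulFC s h h')

/-- The trees with at most `N` vertices. -/
def treesLE (N : ℕ) : Finset LevelledTree :=
  (Finset.range (N + 1)).sigma fun _ => Finset.univ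

lemma DegreeLE.eq_sum {N : ℕ} {z : LTFC A} (h : DegreeLE N z) :
    z = ∑ τ ∈ treesLE N, NCSignature.incl τ.2 (z τ) := by
  refine DFinsupp.ext fun ρ => ?_
  change z ρ = (∑ τ ∈ treesLE N, NCSignature.incl τ.2 (z τ)) ρ
  rw [DirectSum.sum_apply]
  by_cases hρ : ρ ∈ treesLE N
  · rw [Finset.sum_eq_single_of_mem ρ hρ fun τ _ hτ => incl_apply_of_ne _ _ hτ.symm,
      incl_apply_self]
  · rw [Finset.sum_eq_zero fun τ hτ =>
      incl_apply_of_ne τ.2 _ fun e : ρ = τ => hρ (by rw [e]; exact hτ)]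
    refine h ρ ?_
    simpa [treesLE] using hρ

lemma HasWeakDerivAt.shuffle {z w : ℝ → LTFC A} {z' w' : LTFC A} {t : ℝ} {N : ℕ}
    (hz : HasWeakDerivAt z z' t) (hw : HasWeakDerivAt w w' t) (hzN : ∀ r, DegreeLE N (z r))
    (hwN : ∀ r, DegreeLE N (w r)) (hzN' : DegreeLE N z') (hwN' : DegreeLE N w') :
    HasWeakDerivAt (fun r => NCSignature.shuffle A (z r) (w r))
      (NCSignature.shuffle A z' (w t) + NCSignature.shuffle A (z t) w') t := by
  -- The degree bound gives a finite index set independent of time, so the product can be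
  -- differentiated term by term.
  have h : ∀ z w : LTFC A, DegreeLE N z → DegreeLE N w → NCSignature.shuffle A z w =
      ∑ τ ∈ treesLE N, ∑ τ' ∈ treesLE N,
        NCSignature.shuffle A (NCSignature.incl τ.2 (z τ)) (NCSignature.incl τ'.2 (w τ')) := by
    intro z w hz hw
    conv_lhs => rw [hz.eq_sum, hw.eq_sum]
    simp only [map_sum, LinearMap.sum_apply]
    exact Finset.sum_comm
  rw [h _ _ hzN' (hwN t), h _ _ (hzN t) hwN']
  simp only [fun r => h _ _ (hzN r) (hwN r), ← Finset.sum_add_distrib]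
  exact HasWeakDerivAt.sum fun τ _ => HasWeakDerivAt.sum fun τ' _ =>
    HasWeakDerivAt.shuffle_incl (hz τ) (hw τ')

lemma degreeLE_topContraction (Y : A) {N : ℕ} {z : LTFC A} (hz : DegreeLE N z) :
    DegreeLE N (topContraction Y z) :=
  degreeLE_map (fun τ m => by
    obtain ⟨n, τ⟩ := τ
    cases n with
    | zero =>
      rw [topContraction_incl_zero]
      exact fun ρ _ => rfl
    | succ n =>
      rw [topContraction_incl_succ]
      exact degreeLE_incl (Nat.le_succ n) _ _) hz

lemma degreeLE_shuffle {N N' : ℕ} {z w : LTFC A} (hz : DegreeLE N z) (hw : DegreeLE N' w) :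
    DegreeLE (N + N') (shuffle A z w) := by
  rw [hz.eq_sum, hw.eq_sum]
  simp only [map_sum, LinearMap.sum_apply, shuffle_incl]
  refine degreeLE_sum _ fun τ hτ => degreeLE_sum _ fun τ' hτ' => degreeLE_sum _ fun s _ =>
    degreeLE_incl ?_ _ _
  simp only [treesLE, Finset.mem_sigma, Finset.mem_range, Finset.mem_univ, and_true] at hτ hτ'
  omega

/-- By the Leibniz rules for the time derivative and for `topContraction`, the product of two
solutions is a solution; at time `s` it equals `shuffle A z w`. -/
lemma pathSig_shuffle {V : ℝ → A} (hV : Continuous V) (s t : ℝ) (z w : LTFC A) :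
    pathSig V s t (shuffle A z w) = shuffle A (pathSig V s t z) (pathSig V s t w) := by
  obtain ⟨N, hN⟩ : ∃ N, DegreeLE N z ∧ DegreeLE N w := by
    obtain ⟨N, hN⟩ := exists_degreeLE z
    obtain ⟨N', hN'⟩ := exists_degreeLE w
    exact ⟨max N N', hN.mono (le_max_left _ _), hN'.mono (le_max_right _ _)⟩
  have hz := fun t => degreeLE_pathSig V s t hN.1
  have hw := fun t => degreeLE_pathSig V s t hN.2
  have h := eq_pathSig_of_hasWeakDerivAt hV
    (D := fun t => shuffle A (pathSig V s t z) (pathSig V s t w))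
    (fun t => degreeLE_shuffle (hz t) (hw t)) (fun t => by
      rw [topContraction_shuffle]
      exact (hasWeakDerivAt_pathSig hV s t z).shuffle (hasWeakDerivAt_pathSig hV s t w) hz hw
        (degreeLE_topContraction _ (hz t)) (degreeLE_topContraction _ (hw t))) s t
  rw [h, pathSig_self]
  rfl

lemma isAlgHom_pathSig {V : ℝ → A} (hV : Continuous V) (s t : ℝ) : IsAlgHom (pathSig V s t) :=
  ⟨pathSig_unit V s t, pathSig_shuffle hV s t⟩

lemma isStarAlgHom_pathSig {V : ℝ → A} (hV : Continuous V) (hV' : ∀ r, star (V r) = V r)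
    (s t : ℝ) : IsStarAlgHom (pathSig V s t) :=
  ⟨isAlgHom_pathSig hV s t, pathSig_starMap hV hV' s t⟩

end Morphism

/-! ### Completed projective tensor powers -/

section TensorPowers

variable {A : Type*} [CStarAlgebra A]

lemma tensorPow_hom_ext {n : ℕ} {F : Type*} [NormedAddCommGroup F] [NormedSpace ℂ F]
    {f g : TensorPow A n →L[ℂ] F} (h : ∀ a, f (elemTensor A n a) = g (elemTensor A n a)) :
    f = g := by
  have h1 : (f.comp (toTensorPow A n)).toLinearMap = (g.comp (toTensorPow A n)).toLinearMap :=
    PiTensorProduct.ext (MultilinearMap.ext h)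
  refine ContinuousLinearMap.ext fun x => ?_
  exact congrFun ((denseRange_toTensorPow A n).equalizer f.continuous g.continuous
    (funext fun y => LinearMap.congr_fun h1 y)) x

lemma norm_liftTensor_le {n : ℕ} {F : Type*} [NormedAddCommGroup F] [NormedSpace ℂ F]
    [CompleteSpace F] (g : ContinuousMultilinearMap ℂ (fun _ : Fin n => A) F) :
    ‖liftTensor g‖ ≤ ‖g‖ := by
  refine ContinuousLinearMap.opNorm_le_bound _ (norm_nonneg g) fun x => ?_
  refine (denseRange_toTensorPow A n).induction_on
    (p := fun x => ‖liftTensor g x‖ ≤ ‖g‖ * ‖x‖) x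
    (isClosed_le (liftTensor g).continuous.norm (continuous_const.mul continuous_norm)) fun y => ?_
  have hy : ‖toTensorPow A n y‖ = ‖y‖ := UniformSpace.Completion.norm_coe y
  rw [liftTensor_toTensorPow, hy]
  exact PiTensorProduct.norm_eval_le_projectiveSeminorm g y

/-- Universality: one tensor, the iterated integral of `V t₁ ⊗ ⋯ ⊗ V t_k`, determines the iterated
integrals of all bounded `k`-linear maps. -/
lemma liftTensor_iterInt {V : ℝ → A} (hV : Continuous V) (s t : ℝ) {k : ℕ} {F : Type*}
    [NormedAddCommGroup F] [NormedSpace ℂ F] [CompleteSpace F]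
    (g : ContinuousMultilinearMap ℂ (fun _ : Fin k => A) F) :
    liftTensor g (iterInt V s k t (elemTensor A k)) = iterInt V s k t g := by
  refine (map_iterInt hV s ((liftTensor g).restrictScalars ℝ) k t (elemTensor A k).cont).trans ?_
  congr 1
  ext v
  exact liftTensor_elemTensor g v

end TensorPowers

/-! ### Approximation of the signature by insertions -/

section InsertionClosure

variable {A : Type*} [CStarAlgebra A]

lemma insertion_incl {n k : ℕ} (Y : Fin k → A) (τ : Perm (Fin n)) (m : FC (A := A) τ) :
    insertion Y (incl τ m) = if h : k ≤ n then
      incl (lower τ (Nat.sub_le n k)) (contract τ (Nat.sub_add_cancel h) Y m) else 0 := by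
  rw [insertion, incl, DirectSum.toModule_lof]
  split_ifs <;> rfl

/-- The part of the signature which contracts exactly `k` inputs. -/
def sigDegree (V : ℝ → A) (s t : ℝ) (k : ℕ) {n : ℕ} (τ : Perm (Fin n)) (m : FC (A := A) τ) :
    LTFC A :=
  if h : k ≤ n then
    incl (lower τ (Nat.sub_le n k)) (sigTerm V s t τ (Nat.sub_add_cancel h) m) else 0

lemma incl_sigTerm_congr (V : ℝ → A) (s t : ℝ) {n p p' k k' : ℕ} (τ : Perm (Fin n))
    (h : p + k = n) (h' : p' + k' = n) (hk : k = k') (m : FC (A := A) τ) :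
    incl _ (sigTerm V s t τ h m) = incl _ (sigTerm V s t τ h' m) := by
  subst hk
  obtain rfl : p = p' := by omega
  rfl

/-- Indexing by the number `k = n - p` of contracted inputs, with zero terms for `k > n`, gives one
range of summation for all trees with at most `N` vertices. -/
lemma pathSig_incl_eq_sum_sigDegree (V : ℝ → A) (s t : ℝ) {n N : ℕ} (hN : n ≤ N)
    (τ : Perm (Fin n)) (m : FC (A := A) τ) :
    pathSig V s t (incl τ m) = ∑ k ∈ Finset.range (N + 1), sigDegree V s t k τ m := by
  rw [← Finset.sum_subset (Finset.range_mono (Nat.succ_le_succ hN)) fun k _ hk =>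
    dif_neg (by simpa using hk), Finset.sum_range, pathSig_incl, ← Equiv.sum_comp Fin.revPerm]
  refine Finset.sum_congr rfl fun k _ => ?_
  have hk := Nat.le_of_lt_succ k.2
  rw [sigDegree, dif_pos hk]
  refine incl_sigTerm_congr V s t τ _ (Nat.sub_add_cancel hk) ?_ m
  rw [Fin.revPerm_apply, Fin.val_rev]
  omega

lemma sigDegree_zero (V : ℝ → A) (s t : ℝ) {n : ℕ} (τ : Perm (Fin n)) (m : FC (A := A) τ) :
    sigDegree V s t 0 τ m = incl τ m := by
  rw [sigDegree, dif_pos (Nat.zero_le n), ← sigTerm_zero V s t τ m]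
  exact incl_sigTerm_congr V s t τ _ _ rfl m

lemma norm_incl_apply_le {n : ℕ} (τ : Perm (Fin n)) (m : FC (A := A) τ) (ρ : LevelledTree) :
    ‖incl τ m ρ‖ ≤ ‖m‖ := by
  by_cases hρ : ρ = ⟨n, τ⟩
  · subst hρ
    rw [incl_apply_self]
  · rw [incl_apply_of_ne τ m hρ, norm_zero]
    exact norm_nonneg _

/-- An algebraic tensor is a finite sum of multiples of elementary ones, and `Y₁ ⊗ ⋯ ⊗ Y_k` acts as
`insertion Y`. The same `Z` works for all trees. -/
lemma exists_insertionSpan {k : ℕ} (hk : 1 ≤ k) (x : ⨂[ℂ] _ : Fin k, A) :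
    ∃ Z ∈ insertionSpan A, ∀ (n : ℕ) (τ : Perm (Fin n)) (m : FC (A := A) τ),
      Z (incl τ m) = if h : k ≤ n then incl (lower τ (Nat.sub_le n k))
        (liftTensor (contractL τ (Nat.sub_add_cancel h)) (toTensorPow A k x) m) else 0 := by
  induction x using PiTensorProduct.induction_on with
  | smul_tprod c Y =>
    refine ⟨c • insertion Y, Submodule.smul_mem _ _ (Submodule.subset_span
      (Or.inr ⟨k, hk, Y, rfl⟩)), fun n τ m => ?_⟩
    rw [LinearMap.smul_apply, insertion_incl]
    split_ifs with h
    · rw [map_smul, map_smul, smul_apply, map_smul]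
      have := liftTensor_elemTensor (contractL (A := A) τ (Nat.sub_add_cancel h)) Y
      rw [contractL_apply] at this
      rw [← this]
      rfl
    · exact smul_zero c
  | add x y hx hy =>
    obtain ⟨Z, hZ, h⟩ := hx
    obtain ⟨Z', hZ', h'⟩ := hy
    refine ⟨Z + Z', Submodule.add_mem _ hZ hZ', fun n τ m => ?_⟩
    rw [LinearMap.add_apply, h, h']
    split_ifs with hkn
    · rw [map_add, map_add, add_apply, map_add]
    · exact add_zero 0

/-- For `k ≥ 1`, an algebraic tensor within `δ` of the iterated integral of elementary tensors is
enough, since contraction has norm at most `1`. For `k = 0` the identity is exact. -/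
lemma exists_insertionSpan_approx {V : ℝ → A} (hV : Continuous V) (s t : ℝ) (k : ℕ) {δ : ℝ}
    (hδ : 0 < δ) : ∃ Z ∈ insertionSpan A, ∀ (n : ℕ) (τ : Perm (Fin n)) (m : FC (A := A) τ)
      (ρ : LevelledTree), ‖(sigDegree V s t k τ m - Z (incl τ m)) ρ‖ ≤ δ * ‖m‖ := by
  rcases Nat.eq_zero_or_pos k with rfl | hk
  · refine ⟨1, Submodule.subset_span (Or.inl rfl), fun n τ m ρ => ?_⟩
    rw [sigDegree_zero, Module.End.one_apply, sub_self, DirectSum.zero_apply, norm_zero]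
    positivity
  · obtain ⟨x, hx⟩ := (denseRange_toTensorPow A k).exists_dist_lt
      (iterInt V s k t (elemTensor A k)) hδ
    obtain ⟨Z, hZ, h⟩ := exists_insertionSpan hk x
    refine ⟨Z, hZ, fun n τ m ρ => ?_⟩
    rw [h, sigDegree]
    split_ifs with hkn
    · rw [← map_sub]
      refine (norm_incl_apply_le _ _ ρ).trans ?_
      have h1 : sigTerm V s t τ (Nat.sub_add_cancel hkn) =
          liftTensor (contractL (A := A) τ (Nat.sub_add_cancel hkn))
            (iterInt V s k t (elemTensor A k)) :=
        (liftTensor_iterInt hV s t (contractL (A := A) τ (Nat.sub_add_cancel hkn))).symm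
      rw [h1, ← sub_apply, ← map_sub]
      refine (ContinuousLinearMap.le_opNorm _ _).trans
        (mul_le_mul_of_nonneg_right ?_ (norm_nonneg m))
      refine (ContinuousLinearMap.le_opNorm _ _).trans ?_
      rw [← dist_eq_norm]
      exact (mul_le_mul ((norm_liftTensor_le _).trans (norm_contractL_le _ _)) hx.le dist_nonneg
        zero_le_one).trans_eq (one_mul δ)
    · rw [sub_zero, DirectSum.zero_apply, norm_zero]
      positivity

lemma pathSig_mem_insertionClosure {V : ℝ → A} (hV : Continuous V) (s t : ℝ) :
    pathSig V s t ∈ insertionClosure A := by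
  intro T ε hε
  set N := T.sup Sigma.fst
  -- The error `ε` is shared equally among the `N + 1` values `0, …, N` of `k`.
  have hδ : 0 < ε / (N + 1) := by positivity
  choose Z hZ hZ' using fun k => exists_insertionSpan_approx hV s t k hδ
  refine ⟨∑ k ∈ Finset.range (N + 1), Z k, Submodule.sum_mem _ fun k _ => hZ k, ?_⟩
  rintro ⟨n, τ⟩ hτ m ρ
  have hn : n ≤ N := Finset.le_sup (f := Sigma.fst) hτ
  rw [LinearMap.sub_apply, LinearMap.sum_apply, pathSig_incl_eq_sum_sigDegree V s t hn,
    ← Finset.sum_sub_distrib, DirectSum.sum_apply]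
  refine (norm_sum_le _ _).trans ((Finset.sum_le_sum fun k _ => hZ' k n τ m ρ).trans_eq ?_)
  rw [Finset.sum_const, Finset.card_range, nsmul_eq_mul, Nat.cast_add, Nat.cast_one]
  field_simp

end InsertionClosure

/-! ### The faces of a forest: gaps between trees and faces carrying vertices -/

namespace LevelledForest

variable {p k : ℕ} (f : LevelledForest p k)

/-- The number of vertices in the trees on the left of the tree `j`. -/
def before (j : Fin (p + 1)) : ℕ := ∑ i ∈ Finset.Iio j, f.comp i

lemma before_add_comp_le {i j : Fin (p + 1)} (h : i < j) : f.before i + f.comp i ≤ f.before j := by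
  rw [before, before, add_comm, ← Finset.sum_insert (by simp)]
  refine Finset.sum_le_sum_of_subset fun l hl => ?_
  rw [Finset.mem_Iio]
  rcases Finset.mem_insert.1 hl with rfl | hl
  · exact h
  · exact (Finset.mem_Iio.1 hl).trans h

lemma before_mono {i j : Fin (p + 1)} (h : i ≤ j) : f.before i ≤ f.before j := by
  rcases h.eq_or_lt with rfl | h
  · rfl
  · exact (Nat.le_add_right _ _).trans (f.before_add_comp_le h)

lemma val_gap (j : Fin p) : (f.gap j : ℕ) = j + f.before j.succ := by
  have h : Finset.Iic j.castSucc = Finset.Iio j.succ := by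
    ext l
    simp [Fin.lt_def, Fin.le_def]
  simp only [gap, before, h]

lemma sum_castLE_eq_sum_Iio {m : ℕ} (g : Fin m → ℕ) (j : Fin m) :
    ∑ i : Fin (j : ℕ), g (Fin.castLE j.2.le i) = ∑ i ∈ Finset.Iio j, g i := by
  refine Finset.sum_bij (fun i _ => Fin.castLE j.2.le i) (fun i _ => ?_) (fun i _ i' _ h => ?_)
    (fun i hi => ?_) fun _ _ => rfl
  · rw [Finset.mem_Iio, Fin.lt_def]
    exact i.2
  · exact Fin.castLE_injective _ h
  · exact ⟨⟨i, Fin.lt_def.1 (Finset.mem_Iio.1 hi)⟩, Finset.mem_univ _, rfl⟩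

lemma val_vertexEquiv (j : Fin (p + 1)) (r : Fin (f.comp j)) :
    (f.vertexEquiv ⟨j, r⟩ : ℕ) = f.before j + r := by
  simp only [vertexEquiv, Equiv.trans_apply, finCongr_apply, Fin.val_cast, finSigmaFinEquiv_apply]
  rw [before, ← sum_castLE_eq_sum_Iio]

lemma val_leafEquiv {n : ℕ} (h : p + k = n) (j : Fin (p + 1)) (r : Fin (f.comp j + 1)) :
    (f.leafEquiv h ⟨j, r⟩ : ℕ) = f.before j + j + r := by
  simp only [leafEquiv, Equiv.trans_apply, finCongr_apply, Fin.val_cast, finSigmaFinEquiv_apply]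
  rw [Finset.sum_add_distrib, before, ← sum_castLE_eq_sum_Iio]
  simp

/-- The tree which contains the `r`-th vertex of `f`. -/
def treeOf (r : Fin k) : Fin (p + 1) := (f.vertexEquiv.symm r).1

lemma before_treeOf_le (r : Fin k) : f.before (f.treeOf r) ≤ r := by
  have h := f.val_vertexEquiv _ (f.vertexEquiv.symm r).2
  rw [Sigma.eta, Equiv.apply_symm_apply] at h
  rw [h, treeOf]
  omega

lemma lt_before_treeOf_add (r : Fin k) :
    (r : ℕ) < f.before (f.treeOf r) + f.comp (f.treeOf r) := by
  have h := f.val_vertexEquiv _ (f.vertexEquiv.symm r).2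
  rw [Sigma.eta, Equiv.apply_symm_apply] at h
  rw [h, treeOf]
  have := (f.vertexEquiv.symm r).2.2
  omega

lemma treeOf_vertexEquiv (j : Fin (p + 1)) (r : Fin (f.comp j)) :
    f.treeOf (f.vertexEquiv ⟨j, r⟩) = j := by
  rw [treeOf, Equiv.symm_apply_apply]

lemma treeOf_eq {r : Fin k} {j : Fin (p + 1)} (h : f.before j ≤ r)
    (h' : (r : ℕ) < f.before j + f.comp j) : f.treeOf r = j := by
  rcases lt_trichotomy (f.treeOf r) j with hj | hj | hj
  · have h1 := f.before_add_comp_le hj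
    have h2 := f.lt_before_treeOf_add r
    omega
  · exact hj
  · have h1 := f.before_add_comp_le hj
    have h2 := f.before_treeOf_le r
    omega

lemma treeOf_mono {r r' : Fin k} (h : r ≤ r') : f.treeOf r ≤ f.treeOf r' := by
  by_contra hlt
  have h1 := f.before_add_comp_le (not_le.1 hlt)
  have h2 := f.before_treeOf_le r
  have h3 := f.lt_before_treeOf_add r'
  have h4 := Fin.le_def.1 h
  omega

/-- The face of `f` on which its `r`-th vertex lies. -/
def vertexFace (r : Fin k) : Fin (p + k) :=
  ⟨f.treeOf r + r, by have := (f.treeOf r).2; have := r.2; omega⟩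

lemma vertexFace_strictMono : StrictMono f.vertexFace := fun r r' h => by
  have h1 := Fin.le_def.1 (f.treeOf_mono h.le)
  rw [Fin.lt_def] at h ⊢
  simp only [vertexFace]
  omega

/-- Both faces are numbered by counting gaps and vertices to their left; the inequalities follow
from the bounds on `r` given by the tree containing this vertex. -/
lemma gap_lt_vertexFace_iff (j : Fin p) (r : Fin k) :
    f.gap j < f.vertexFace r ↔ j.castSucc < f.treeOf r := by
  have h1 := f.before_treeOf_le r
  have h2 := f.lt_before_treeOf_add r
  rw [Fin.lt_def, val_gap]
  simp only [vertexFace]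
  constructor
  · intro h
    by_contra hlt
    have h3 := not_lt.1 hlt
    have h4 := f.before_add_comp_le (show f.treeOf r < j.succ from
      h3.trans_lt (Fin.castSucc_lt_succ))
    have h5 := Fin.le_def.1 h3
    simp only [Fin.val_castSucc] at h5
    omega
  · intro h
    have h3 : j.succ ≤ f.treeOf r := h
    have h4 := f.before_mono h3
    have h5 := Fin.lt_def.1 h
    simp only [Fin.val_castSucc] at h5
    omega

lemma gap_ne_vertexFace (j : Fin p) (r : Fin k) : f.gap j ≠ f.vertexFace r := by
  intro h
  have h1 := f.before_treeOf_le r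
  have h2 := f.lt_before_treeOf_add r
  have h0 : ¬ j.castSucc < f.treeOf r := fun hlt =>
    ((f.gap_lt_vertexFace_iff j r).2 hlt).ne h
  have h3 := not_lt.1 h0
  have h4 := f.before_add_comp_le (show f.treeOf r < j.succ from
    h3.trans_lt (Fin.castSucc_lt_succ))
  have h5 := Fin.le_def.1 h3
  have h6 := congrArg Fin.val h
  rw [val_gap] at h6
  simp only [vertexFace, Fin.val_castSucc] at h5 h6
  omega

/-- A count: the `p` gaps and the `k` vertex faces are distinct, hence exhaust the `p + k` faces. -/
lemma exists_gap_or_vertexFace (q : Fin (p + k)) :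
    (∃ j, f.gap j = q) ∨ ∃ r, f.vertexFace r = q := by
  have hinj : Function.Injective (Sum.elim f.gap f.vertexFace) :=
    f.gap_strictMono.injective.sumElim f.vertexFace_strictMono.injective f.gap_ne_vertexFace
  have hbij := (Fintype.bijective_iff_injective_and_card _).2 ⟨hinj, by simp⟩
  obtain ⟨x, rfl⟩ := hbij.surjective q
  cases x with
  | inl j => exact Or.inl ⟨j, rfl⟩
  | inr r => exact Or.inr ⟨r, rfl⟩

end LevelledForest

/-! ### The faces of `upper τ` inside `τ` -/

section Upper

lemma exists_lowPos_eq {n p : ℕ} (τ : Perm (Fin n)) (h : p ≤ n) {i : Fin n} (hi : (τ i : ℕ) < p) :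
    ∃ j, lowPos τ h j = i := by
  have h1 : i ∈ (lowLevels n p).map τ.symm.toEmbedding := by simpa [lowLevels] using hi
  rw [← Finset.mem_coe, ← Finset.range_orderEmbOfFin _ (card_positions τ _ (card_lowLevels h))] at h1
  exact h1

lemma filter_lt_lowPos {n p : ℕ} (τ : Perm (Fin n)) (h : p ≤ n) (j : Fin p) :
    (Finset.univ.filter fun i => i < lowPos τ h j ∧ (τ i : ℕ) < p) =
      (Finset.Iio j).map (lowPos τ h).toEmbedding := by
  ext i
  simp only [Finset.mem_filter, Finset.mem_univ, true_and, Finset.mem_map, Finset.mem_Iio]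
  constructor
  · rintro ⟨h1, h2⟩
    obtain ⟨j', rfl⟩ := exists_lowPos_eq τ h h2
    exact ⟨j', (lowPos τ h).lt_iff_lt.1 h1, rfl⟩
  · rintro ⟨j', h1, rfl⟩
    refine ⟨(lowPos τ h).lt_iff_lt.2 h1, ?_⟩
    change (τ (lowPos τ h j') : ℕ) < p
    rw [val_lowPos]
    exact (lower τ h j').2

/-- Links the order of positions to the count which defines the parts of `upper`: a high letter
precedes the low letter number `j` exactly when its tree has number at most `j`. -/
lemma lt_lowPos_iff {n p : ℕ} (τ : Perm (Fin n)) (h : p ≤ n) (j : Fin p) {i : Fin n}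
    (hi : p ≤ (τ i : ℕ)) : i < lowPos τ h j ↔
      (Finset.univ.filter fun i' => i' < i ∧ (τ i' : ℕ) < p).card < (j : ℕ) + 1 := by
  have hj : (τ (lowPos τ h j) : ℕ) < p := by
    rw [val_lowPos]
    exact (lower τ h j).2
  have hc := congrArg Finset.card (filter_lt_lowPos τ h j)
  rw [Finset.card_map, Fin.card_Iio] at hc
  constructor
  · intro hlt
    rw [Nat.lt_succ_iff, ← hc]
    refine Finset.card_le_card fun i' hi' => ?_
    simp only [Finset.mem_filter, Finset.mem_univ, true_and] at hi' ⊢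
    exact ⟨hi'.1.trans hlt, hi'.2⟩
  · intro hlt
    by_contra hle
    have hlt' : lowPos τ h j < i := lt_of_le_of_ne (not_lt.1 hle) fun e => by
      rw [e] at hj
      omega
    refine absurd hlt (not_lt.2 ?_)
    rw [← hc, Nat.succ_le_iff]
    refine Finset.card_lt_card (Finset.ssubset_iff_of_subset (fun i' hi' => ?_)|>.2
      ⟨lowPos τ h j, ?_, ?_⟩)
    · simp only [Finset.mem_filter, Finset.mem_univ, true_and] at hi' ⊢
      exact ⟨hi'.1.trans hlt', hi'.2⟩
    · simpa using ⟨hlt', hj⟩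
    · simp

variable {p k : ℕ} (τ : Perm (Fin (p + k)))

/-- A position is the number of letters before it. Before the low letter number `j` there are `j`
low letters, and the high letters there are exactly the vertices of the trees `0, …, j`. -/
lemma gap_upper (j : Fin p) :
    (upper τ rfl).gap j = lowPos τ (Nat.le_add_right p k) j := by
  refine Fin.ext ?_
  set q := lowPos τ (Nat.le_add_right p k) j with hq
  have h1 : (q : ℕ) = (Finset.univ.filter fun i => i < q).card := by
    rw [← Fin.card_Iio q]
    congr 1
    ext i
    simp
  have h2 : (Finset.univ.filter fun i => i < q ∧ (τ i : ℕ) < p).card = j := by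
    rw [hq, filter_lt_lowPos, Finset.card_map, Fin.card_Iio]
  have h3 : (upper τ rfl).before j.succ =
      (Finset.univ.filter fun i => i < q ∧ ¬ (τ i : ℕ) < p).card := by
    have hmap : ∀ i ∈ (Finset.univ.filter fun i => i < q ∧ ¬ (τ i : ℕ) < p),
        (Finset.univ.filter fun i' => i' < i ∧ (τ i' : ℕ) < p).card ∈
          (Finset.Iio j.succ).map Fin.valEmbedding := by
      intro i hi
      simp only [Finset.mem_filter, Finset.mem_univ, true_and, not_lt] at hi
      have := (lt_lowPos_iff τ _ j hi.2).1 hi.1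
      rw [Finset.mem_map]
      exact ⟨⟨_, this.trans (by have := j.2; omega)⟩, Finset.mem_Iio.2 (Fin.lt_def.2 this), rfl⟩
    rw [Finset.card_eq_sum_card_fiberwise hmap, Finset.sum_map, LevelledForest.before]
    refine Finset.sum_congr rfl fun l hl => ?_
    rw [Finset.filter_filter]
    simp only [upper]
    congr 1
    ext i
    simp only [Finset.mem_filter, Finset.mem_univ, true_and, not_lt, Fin.valEmbedding_apply]
    refine ⟨fun hi => ⟨⟨(lt_lowPos_iff τ _ j hi.1).2 ?_, hi.1⟩, hi.2⟩, fun hi => ⟨hi.1.2, hi.2⟩⟩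
    rw [hi.2]
    exact Fin.lt_def.1 (Finset.mem_Iio.1 hl)
  rw [LevelledForest.val_gap, h1, h3, ← h2, ← Finset.filter_filter, ← Finset.filter_filter]
  exact Finset.card_filter_add_card_filter_not _

lemma val_gap_upper (j : Fin p) :
    (τ ((upper τ rfl).gap j) : ℕ) = lower τ (Nat.le_add_right p k) j := by
  rw [gap_upper, val_lowPos]

/-- The low letters are on the gaps, so the vertex faces carry high letters. Being increasing, they
enumerate the positions of the high letters, and `perm` is the standardization of these letters,
shifted down by `p`. -/
lemma val_vertexFace_upper (r : Fin k) :
    (τ ((upper τ rfl).vertexFace r) : ℕ) = p + (upper τ rfl).perm r := by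
  have h1 : (upper τ rfl).vertexFace = ((highLevels (p + k) p).map τ.symm.toEmbedding).orderEmbOfFin
      (card_positions τ _ (card_highLevels rfl)) := by
    refine Finset.orderEmbOfFin_unique _ (fun r => ?_) (upper τ rfl).vertexFace_strictMono
    have : p ≤ (τ ((upper τ rfl).vertexFace r) : ℕ) := by
      by_contra hlt
      obtain ⟨j, hj⟩ := exists_lowPos_eq τ (Nat.le_add_right p k) (not_le.1 hlt)
      rw [← gap_upper] at hj
      exact LevelledForest.gap_ne_vertexFace _ j r hj
    simpa [highLevels] using this
  rw [h1, ← orderEmbOfFin_subword, val_orderEmbOfFin_highLevels rfl]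
  rfl

end Upper

/-! ### The faces of a glued forest -/

section Gluing

lemma card_filter_lt_orderEmbOfFin {n p : ℕ} (S : Finset (Fin n)) (h : S.card = p) (i : Fin p) :
    (S.filter (· < S.orderEmbOfFin h i)).card = i := by
  have : S.filter (· < S.orderEmbOfFin h i) =
      (Finset.Iio i).map (S.orderEmbOfFin h).toEmbedding := by
    ext q
    simp only [Finset.mem_filter, Finset.mem_map, Finset.mem_Iio]
    constructor
    · rintro ⟨h1, h2⟩
      rw [← Finset.mem_coe, ← Finset.range_orderEmbOfFin S h] at h1
      obtain ⟨i', rfl⟩ := h1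
      exact ⟨i', (S.orderEmbOfFin h).lt_iff_lt.1 h2, rfl⟩
    · rintro ⟨i', h1, rfl⟩
      exact ⟨Finset.orderEmbOfFin_mem S h i', (S.orderEmbOfFin h).lt_iff_lt.2 h1⟩
  rw [this, Finset.card_map, Fin.card_Iio]

lemma orderEmbOfFin_eq_of_card {n p : ℕ} {S : Finset (Fin n)} (h : S.card = p) {q : Fin n}
    (hq : q ∈ S) {i : Fin p} (hi : (S.filter (· < q)).card = i) : S.orderEmbOfFin h i = q := by
  rw [← Finset.mem_coe, ← Finset.range_orderEmbOfFin S h] at hq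
  obtain ⟨i', rfl⟩ := hq
  rw [card_filter_lt_orderEmbOfFin] at hi
  rw [Fin.ext hi]

namespace LevelledForest

variable {p k : ℕ} (f : LevelledForest p k) (I : Finset (Fin p))

/-- The number of the tree of `f.glue I` which contains the tree `j` of `f`. -/
def glueIndex (I : Finset (Fin p)) (j : Fin (p + 1)) : Fin (Iᶜ.card + 1) :=
  ⟨(Iᶜ.filter fun i => i.castSucc < j).card, Nat.lt_succ_of_le (Finset.card_filter_le _ _)⟩

lemma glueIndex_mono {i j : Fin (p + 1)} (h : i ≤ j) : glueIndex I i ≤ glueIndex I j :=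
  Fin.le_def.2 (Finset.card_le_card fun l hl => by
    rw [Finset.mem_filter] at hl ⊢
    exact ⟨hl.1, hl.2.trans_le h⟩)

lemma comp_glue (l : Fin (Iᶜ.card + 1)) :
    (f.glue I).comp l = ∑ j with glueIndex I j = l, f.comp j := by
  simp only [glue, glueIndex, Fin.ext_iff]

lemma before_glue (l : Fin (Iᶜ.card + 1)) :
    (f.glue I).before l = ∑ j with glueIndex I j < l, f.comp j := by
  rw [before, ← Finset.sum_fiberwise_of_maps_to (t := Finset.Iio l) (g := glueIndex I)
    (fun j hj => by simpa using hj)]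
  refine Finset.sum_congr rfl fun l' hl' => ?_
  rw [comp_glue, Finset.filter_filter]
  refine Finset.sum_congr (Finset.filter_congr fun j _ => ?_) fun _ _ => rfl
  exact ⟨fun h => ⟨h ▸ Finset.mem_Iio.1 hl', h⟩, fun h => h.2⟩

/-- `glueIndex` is monotone, so a glued tree is a block of consecutive trees of `f`, and its
interval of vertices contains the interval of each of them. -/
lemma treeOf_glue (r : Fin k) : (f.glue I).treeOf r = glueIndex I (f.treeOf r) := by
  refine treeOf_eq _ ?_ ?_
  · refine le_trans ?_ (f.before_treeOf_le r)
    rw [before_glue, before]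
    refine Finset.sum_le_sum_of_subset fun j hj => ?_
    rw [Finset.mem_Iio]
    by_contra hle
    exact absurd (glueIndex_mono I (not_lt.1 hle)) (not_le.2 (Finset.mem_filter.1 hj).2)
  · refine (f.lt_before_treeOf_add r).trans_le ?_
    rw [before_glue, comp_glue, before, add_comm, ← Finset.sum_insert (by simp),
      ← Finset.sum_union (Finset.disjoint_filter.2 fun j _ h h' => h.ne h')]
    refine Finset.sum_le_sum_of_subset fun j hj => ?_
    have hj' : j ≤ f.treeOf r := by
      rcases Finset.mem_insert.1 hj with rfl | hj
      · exact le_rfl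
      · exact (Finset.mem_Iio.1 hj).le
    rw [Finset.mem_union, Finset.mem_filter, Finset.mem_filter]
    rcases (glueIndex_mono I hj').lt_or_eq with h | h
    · exact Or.inl ⟨Finset.mem_univ _, h⟩
    · exact Or.inr ⟨Finset.mem_univ _, h⟩

lemma gap_mem_gaps {j : Fin p} : f.gap j ∈ f.gaps I ↔ j ∈ I := by
  rw [gaps, Finset.mem_map]
  exact ⟨fun ⟨j', h, e⟩ => f.gap_strictMono.injective e ▸ h, fun h => ⟨j, h, rfl⟩⟩

lemma vertexFace_notMem_gaps (r : Fin k) : f.vertexFace r ∉ f.gaps I := fun h => by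
  rw [gaps, Finset.mem_map] at h
  obtain ⟨j, -, e⟩ := h
  exact f.gap_ne_vertexFace j r e

/-- By ranks: among the faces left after deletion of the gaps in `I`, those before the `r`-th vertex
are the kept gaps, counted by `glueIndex`, and `r` vertex faces. This sum is the number of the
vertex face in the glued forest. -/
lemma orderEmbOfFin_vertexFace_glue (r : Fin k) :
    (f.gaps I)ᶜ.orderEmbOfFin (f.card_compl_gaps I) ((f.glue I).vertexFace r) = f.vertexFace r := by
  refine orderEmbOfFin_eq_of_card _ (Finset.mem_compl.2 (f.vertexFace_notMem_gaps I r)) ?_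
  have h : (f.gaps I)ᶜ.filter (· < f.vertexFace r) =
      (Iᶜ.filter fun i => i.castSucc < f.treeOf r).map ⟨f.gap, f.gap_strictMono.injective⟩ ∪
        (Finset.Iio r).map ⟨f.vertexFace, f.vertexFace_strictMono.injective⟩ := by
    ext q
    rw [Finset.mem_filter, Finset.mem_compl, Finset.mem_union, Finset.mem_map, Finset.mem_map]
    simp only [Function.Embedding.coeFn_mk, Finset.mem_filter, Finset.mem_compl, Finset.mem_Iio]
    constructor
    · rintro ⟨h1, h2⟩
      rcases f.exists_gap_or_vertexFace q with ⟨j, rfl⟩ | ⟨r', rfl⟩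
      · exact Or.inl ⟨j, ⟨fun hj => h1 ((f.gap_mem_gaps I).2 hj),
          (f.gap_lt_vertexFace_iff j r).1 h2⟩, rfl⟩
      · exact Or.inr ⟨r', f.vertexFace_strictMono.lt_iff_lt.1 h2, rfl⟩
    · rintro (⟨j, ⟨h1, h2⟩, rfl⟩ | ⟨r', h1, rfl⟩)
      · exact ⟨fun hj => h1 ((f.gap_mem_gaps I).1 hj), (f.gap_lt_vertexFace_iff j r).2 h2⟩
      · exact ⟨f.vertexFace_notMem_gaps I r', f.vertexFace_strictMono h1⟩
  rw [h, Finset.card_union_of_disjoint, Finset.card_map, Finset.card_map, Fin.card_Iio]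
  · simp only [vertexFace, treeOf_glue, glueIndex]
  · rw [Finset.disjoint_left]
    intro q h1 h2
    obtain ⟨j, -, rfl⟩ := Finset.mem_map.1 h1
    obtain ⟨r', -, e⟩ := Finset.mem_map.1 h2
    exact f.gap_ne_vertexFace j r' e.symm

/-- The vertex faces being matched already, the gaps of the glued forest can only go to kept gaps of
`f`; both sides are then the increasing enumeration of `f.gaps Iᶜ`. -/
lemma orderEmbOfFin_gap_glue (j : Fin Iᶜ.card) :
    (f.gaps I)ᶜ.orderEmbOfFin (f.card_compl_gaps I) ((f.glue I).gap j) =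
      f.gap (Iᶜ.orderEmbOfFin rfl j) := by
  have hcard : (f.gaps Iᶜ).card = Iᶜ.card := Finset.card_map _
  have h1 := Finset.orderEmbOfFin_unique (s := f.gaps Iᶜ) hcard
    (f := fun j => f.gap (Iᶜ.orderEmbOfFin rfl j))
    (fun j => (f.gap_mem_gaps _).2 (Finset.orderEmbOfFin_mem _ _ _))
    (f.gap_strictMono.comp (Iᶜ.orderEmbOfFin rfl).strictMono)
  have h2 := Finset.orderEmbOfFin_unique (s := f.gaps Iᶜ) hcard
    (f := fun j => (f.gaps I)ᶜ.orderEmbOfFin (f.card_compl_gaps I) ((f.glue I).gap j))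
    (fun j => by
      have hmem := Finset.mem_compl.1
        (Finset.orderEmbOfFin_mem (f.gaps I)ᶜ (f.card_compl_gaps I) ((f.glue I).gap j))
      rcases f.exists_gap_or_vertexFace
        ((f.gaps I)ᶜ.orderEmbOfFin (f.card_compl_gaps I) ((f.glue I).gap j)) with ⟨i, hi⟩ | ⟨r, hr⟩
      · rw [← hi] at hmem ⊢
        exact (f.gap_mem_gaps _).2 (Finset.mem_compl.2 fun h => hmem ((f.gap_mem_gaps I).2 h))
      · rw [← f.orderEmbOfFin_vertexFace_glue I r] at hr
        exact absurd (((f.gaps I)ᶜ.orderEmbOfFin (f.card_compl_gaps I)).injective hr).symm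
          (gap_ne_vertexFace _ j r))
    (((f.gaps I)ᶜ.orderEmbOfFin (f.card_compl_gaps I)).strictMono.comp (f.glue I).gap_strictMono)
  exact congrFun (h2.trans h1.symm) j

end LevelledForest

end Gluing

/-! ### The gluing condition and membership in the group -/

section GroupCondition

lemma append_lower_gap_upper {A : Type*} {p k : ℕ} (τ : Perm (Fin (p + k))) (x : Fin p → A)
    (v : Fin k → A) (j : Fin p) :
    Fin.append (fun i => x ((lower τ (Nat.le_add_right p k))⁻¹ i)) v (τ ((upper τ rfl).gap j)) =
      x j := by
  have : τ ((upper τ rfl).gap j) = Fin.castAdd k (lower τ (Nat.le_add_right p k) j) :=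
    Fin.ext (val_gap_upper τ j)
  rw [this, Fin.append_left]
  exact congrArg x (Equiv.symm_apply_apply _ _)

lemma append_vertexFace_upper {A : Type*} {p k : ℕ} (τ : Perm (Fin (p + k))) (x : Fin p → A)
    (v : Fin k → A) (r : Fin k) :
    Fin.append x v (τ ((upper τ rfl).vertexFace r)) = v ((upper τ rfl).perm r) := by
  have : τ ((upper τ rfl).vertexFace r) = Fin.natAdd p ((upper τ rfl).perm r) :=
    Fin.ext (val_vertexFace_upper τ r)
  rw [this, Fin.append_right]

lemma fillInputs_orderEmbOfFin {A : Type*} {n p : ℕ} (S : Finset (Fin n)) (h : S.card = p)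
    (x : Fin n → A) (y : Fin p → A) (i : Fin p) : fillInputs S h x y (S.orderEmbOfFin h i) = y i := by
  rw [fillInputs, dif_pos (Finset.orderEmbOfFin_mem S h i)]
  congr 1
  rw [OrderIso.symm_apply_eq]
  exact Subtype.ext (Finset.coe_orderIsoOfFin_apply S h i).symm

lemma fillInputs_of_notMem {A : Type*} {n p : ℕ} (S : Finset (Fin n)) (h : S.card = p)
    (x : Fin n → A) (y : Fin p → A) {i : Fin n} (hi : i ∉ S) : fillInputs S h x y i = x i :=
  dif_neg hi

variable {A : Type*} [CStarAlgebra A]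

lemma toOp_fillFC {n p : ℕ} (τ : Perm (Fin n)) (S : Finset (Fin n)) (h : S.card = p)
    (x : Fin n → A) {ρ : Perm (Fin p)} (hρ : subword τ S h = ρ) (m : FC (A := A) τ)
    (y : Fin p → A) : FC.toOp ρ (fillFC τ S h x hρ m) y = FC.toOp τ m (fillInputs S h x y) := rfl

lemma pathSig_incl_apply_lower (V : ℝ → A) (s t : ℝ) {p k : ℕ} (τ : Perm (Fin (p + k)))
    (m : FC (A := A) τ) :
    pathSig V s t (incl τ m) ⟨p, lower τ (Nat.le_add_right p k)⟩ = sigTerm V s t τ rfl m := by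
  rw [pathSig_incl, DirectSum.sum_apply,
    Finset.sum_eq_single_of_mem (⟨p, by omega⟩ : Fin (p + k + 1)) (Finset.mem_univ _)]
  · refine (incl_apply_self _ _).trans ?_
    exact congrArg (fun L => L m)
      (sigTerm_congr V s t τ (Nat.add_sub_of_le (Nat.le_add_right p k)) rfl)
  · intro q _ hq
    refine incl_apply_of_ne _ _ fun e => hq (Fin.ext ?_)
    exact (congrArg Sigma.fst e).symm

lemma toOp_sigTerm {V : ℝ → A} (hV : Continuous V) (s t : ℝ) {p k : ℕ} (τ : Perm (Fin (p + k)))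
    (m : FC (A := A) τ) (y : Fin p → A) : FC.toOp _ (sigTerm V s t τ rfl m) y =
      iterInt V s k t fun v => FC.toOp τ m (Fin.append y v) := by
  rw [sigTerm_apply hV]
  refine (map_iterInt hV s (((ContinuousMultilinearMap.apply ℂ (fun _ : Fin p => A) A y).comp
    (FC.toOp (lower τ (Nat.le_add_right p k)))).restrictScalars ℝ) k t
    ((continuous_contract τ rfl).clm_apply continuous_const)).trans ?_
  congr 1
  ext v
  exact contract_apply τ v m y

lemma toOp_component_pathSig {V : ℝ → A} (hV : Continuous V) (s t : ℝ) {p k : ℕ}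
    (τ : Perm (Fin (p + k))) (m : FCid A (p + k)) (x : Fin p → A) :
    FC.toOp 1 (component (pathSig V s t) (lower τ (Nat.le_add_right p k)) τ m) x =
      iterInt V s k t fun v => FC.toOp 1 m fun i =>
        Fin.append (fun j => x ((lower τ (Nat.le_add_right p k))⁻¹ j)) v (τ i) := by
  have h : component (pathSig V s t) (lower τ (Nat.le_add_right p k)) τ m =
      relabel (lower τ (Nat.le_add_right p k))⁻¹ (inv_mul_cancel _)
        (pathSig V s t (incl τ (relabel τ (mul_one τ) m))
          ⟨p, lower τ (Nat.le_add_right p k)⟩) := rfl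
  rw [h, pathSig_incl_apply_lower, relabel_apply, toOp_sigTerm hV]
  rfl

/-- Both sides are iterated integrals of `m` evaluated at tuples indexed by the faces of the forest,
and the tuples already agree before integration. Gaps in `I` receive `w`, other gaps receive the
free inputs, and vertex faces receive the velocities in the order of `perm`, which gluing preserves.
-/
lemma fillFC_component_pathSig {V : ℝ → A} (hV : Continuous V) (s t : ℝ) {p k : ℕ}
    (I : Finset (Fin p)) (τ : Perm (Fin (p + k))) (ρ : Perm (Fin (Iᶜ.card + k)))
    (hρ : upper ρ rfl = (upper τ rfl).glue I) (m : FCid A (p + k)) (w : Fin p → A) :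
    fillFC 1 Iᶜ rfl w (subword_one _ _)
        (component (pathSig V s t) (lower τ (Nat.le_add_right p k)) τ m) =
      component (pathSig V s t) (lower ρ (Nat.le_add_right Iᶜ.card k)) ρ
        (fillFC 1 ((upper τ rfl).gaps I)ᶜ ((upper τ rfl).card_compl_gaps I)
          (Function.extend (upper τ rfl).gap w 0) (subword_one _ _) m) := by
  refine FC.toOp_ext fun z => ?_
  rw [toOp_fillFC, toOp_component_pathSig hV, toOp_component_pathSig hV]
  congr 1
  ext v
  rw [toOp_fillFC]
  congr 1
  ext q
  set f := upper τ rfl with hf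
  rcases f.exists_gap_or_vertexFace q with ⟨j, rfl⟩ | ⟨r, rfl⟩
  · rw [append_lower_gap_upper]
    by_cases hj : j ∈ I
    · rw [fillInputs_of_notMem _ _ _ _ (by simpa using hj), fillInputs_of_notMem _ _ _ _
        (by simpa [f.gap_mem_gaps] using hj), f.gap_strictMono.injective.extend_apply]
    · have hj' : j ∈ ((Iᶜ : Finset (Fin p)) : Set (Fin p)) := by simpa using hj
      rw [← Finset.range_orderEmbOfFin Iᶜ rfl] at hj'
      obtain ⟨j, rfl⟩ := hj'
      rw [fillInputs_orderEmbOfFin, ← f.orderEmbOfFin_gap_glue, fillInputs_orderEmbOfFin, ← hρ,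
        append_lower_gap_upper]
  · rw [append_vertexFace_upper, ← f.orderEmbOfFin_vertexFace_glue I, fillInputs_orderEmbOfFin,
      ← hρ, append_vertexFace_upper, hρ]
    rfl

lemma pathSig_mem_groupG {V : ℝ → A} (hV : Continuous V) (s t : ℝ) :
    pathSig V s t ∈ groupG A := by
  refine ⟨⟨⟨isAlgHom_pathSig hV s t, isUnitriangular_pathSig V s t⟩,
    pathSig_mem_insertionClosure hV s t⟩, ?_⟩
  rintro p k f I - τ rfl ρ hρ m w
  exact fillFC_component_pathSig hV s t I τ ρ hρ m w

end GroupCondition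

/-! ### Cutting a word along a forest -/

section Segments

variable {A : Type*} [CStarAlgebra A]

/-- The product `α o · β o · α (o + 1) ⋯ β (o + c - 1) · α (o + c)`. -/
def segment (α β : ℕ → A) (o : ℕ) : ℕ → A
  | 0 => α o
  | c + 1 => segment α β o c * (β (o + c) * α (o + c + 1))

lemma segment_append (α β : ℕ → A) (o c c' : ℕ) : segment α β o (c + 1 + c') =
    segment α β o c * (β (o + c) * segment α β (o + c + 1) c') := by
  induction c' with
  | zero => rfl
  | succ c' ih =>
    rw [← add_assoc, segment, ih, segment]
    simp only [mul_assoc, add_assoc]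

/-- Words indexed by `ℕ` with an offset make concatenation a matter of adding integers, without
casts between finite types. -/
lemma interleave_one_eq_segment (α β : ℕ → A) (o : ℕ) {c : ℕ} {a : Fin (c + 1) → A}
    {x : Fin c → A} (ha : ∀ r, a r = α (o + r)) (hx : ∀ r, x r = β (o + r)) :
    interleave 1 a x = segment α β o c := by
  induction c with
  | zero => simp [interleave, segment, ha]
  | succ c ih =>
    have h := ih (a := fun r => a r.castSucc) (x := fun r => x r.castSucc)
      (fun r => ha r.castSucc) (fun r => hx r.castSucc)
    rw [segment, ← h, interleave, interleave, List.ofFn_succ_last, List.prod_append, mul_assoc]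
    simp [ha, hx, add_assoc]

/-- A product over segments of lengths `c 0, …, c q`, separated by single letters, is a product
over one long segment. -/
lemma segment_segment (α β : ℕ → A) (c : ℕ → ℕ) (q : ℕ) :
    segment (fun j => segment α β (∑ i ∈ Finset.range j, c i + j) (c j))
      (fun j => β (∑ i ∈ Finset.range (j + 1), c i + j)) 0 q =
      segment α β 0 (∑ i ∈ Finset.range (q + 1), c i + q) := by
  induction q with
  | zero => simp [segment]
  | succ q ih =>
    rw [segment, ih, Finset.sum_range_succ _ (q + 1)]
    have h := segment_append α β 0 (∑ i ∈ Finset.range (q + 1), c i + q) (c (q + 1))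
    simp only [zero_add] at h ⊢
    rw [add_assoc (∑ i ∈ Finset.range (q + 1), c i) q 1] at h
    rw [← h]
    congr 1
    omega

variable {p k : ℕ} (f : LevelledForest p k)

lemma interleave_eq_interleave_one {n : ℕ} (τ : Perm (Fin n)) (a : Fin (n + 1) → A)
    (x : Fin n → A) : interleave τ a x = interleave 1 a fun i => x (τ i) := rfl

/-- Cutting a word along the faces between the trees of a forest. -/
lemma interleave_forest (a : Fin (p + k + 1) → A) (x : Fin (p + k) → A) :
    interleave 1 (fun j => interleave 1 (fun r => a (f.leafEquiv rfl ⟨j, r⟩))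
      fun r => x (f.vertexFace (f.vertexEquiv ⟨j, r⟩))) (fun j => x (f.gap j)) =
      interleave 1 a x := by
  -- The default values `0` of `α`, `β` and `c` are never used: all indices which occur are in
  -- range.
  let α : ℕ → A := fun i => if h : i < p + k + 1 then a ⟨i, h⟩ else 0
  let β : ℕ → A := fun i => if h : i < p + k then x ⟨i, h⟩ else 0
  set c : ℕ → ℕ := fun i => if h : i < p + 1 then f.comp ⟨i, h⟩ else 0 with hc
  have ha : ∀ i, a i = α i := fun i => by
    simp only [α]
    rw [dif_pos i.2]
  have hx : ∀ i, x i = β i := fun i => by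
    simp only [β]
    rw [dif_pos i.2]
  have hcomp : ∀ j, f.comp j = c j := fun i => by
    simp only [hc]
    rw [dif_pos i.2]
  have hbefore : ∀ j, f.before j = ∑ i ∈ Finset.range j, c i := fun j => by
    rw [LevelledForest.before, ← LevelledForest.sum_castLE_eq_sum_Iio, Finset.sum_range]
    exact Finset.sum_congr rfl fun i _ => hcomp _
  have hk : ∑ i ∈ Finset.range (p + 1), c i = k := by
    rw [← f.sum_comp, Finset.sum_range]
    exact Finset.sum_congr rfl fun i _ => (hcomp i).symm
  have h1 : interleave 1 a x = segment α β 0 (∑ i ∈ Finset.range (p + 1), c i + p) := by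
    rw [hk, interleave_one_eq_segment α β 0 (fun r => by rw [ha, zero_add])
      (fun r => by rw [hx, zero_add]), add_comm]
  rw [h1, ← segment_segment]
  refine interleave_one_eq_segment _ _ 0 (fun j => ?_) fun j => ?_
  · rw [zero_add, ← hbefore, ← hcomp]
    refine interleave_one_eq_segment _ _ _ (fun r => ?_) fun r => ?_
    · rw [ha, LevelledForest.val_leafEquiv]
    · rw [hx, LevelledForest.vertexFace]
      simp only [LevelledForest.treeOf_vertexEquiv, LevelledForest.val_vertexEquiv]
      congr 1
      omega
  · rw [hx, LevelledForest.val_gap, hbefore, zero_add, add_comm, Fin.val_succ]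

end Segments

/-! ### Partial contractions and the map `♯` -/

section ForestOperators

variable {A : Type*} [CStarAlgebra A] {p k : ℕ} (f : LevelledForest p k)

lemma exists_level_eq (l : Fin k) : ∃ j r, f.level j r = l := by
  refine ⟨(f.vertexEquiv.symm (f.perm.symm l)).1, (f.vertexEquiv.symm (f.perm.symm l)).2, ?_⟩
  rw [LevelledForest.level, Sigma.eta, Equiv.apply_symm_apply, Equiv.apply_symm_apply]

lemma level_injective {j j' : Fin (p + 1)} {r : Fin (f.comp j)} {r' : Fin (f.comp j')}
    (h : f.level j r = f.level j' r') : (⟨j, r⟩ : Σ j, Fin (f.comp j)) = ⟨j', r'⟩ :=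
  f.vertexEquiv.injective (f.perm.injective h)

/-- Each level sits on one vertex of one tree, so changing `v` at this level affects a single tensor
factor. Multilinearity of `forestOp` in `v` follows. -/
lemma interleave_level_update (b : ∀ j, Fin (f.comp j + 1) → A) (v : Fin k → A)
    (j : Fin (p + 1)) (r : Fin (f.comp j)) (z : A) :
    (fun i => interleave 1 (b i) fun q => Function.update v (f.level j r) z (f.level i q)) =
      Function.update (fun i => interleave 1 (b i) fun q => v (f.level i q)) j
        (sharpOp 1 (b j) (Function.update (fun q => v (f.level j q)) r z)) := by
  ext i
  by_cases hi : i = j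
  · subst hi
    rw [Function.update_self, sharpOp_apply]
    congr 1
    ext q
    by_cases hq : q = r
    · subst hq; simp
    · rw [Function.update_of_ne hq, Function.update_of_ne]
      intro e
      exact hq (by simpa using level_injective f e)
  · rw [Function.update_of_ne hi]
    congr 1
    ext q
    rw [Function.update_of_ne]
    intro e
    exact hi (congrArg Sigma.fst (level_injective f e))

lemma norm_elemTensor_le {n : ℕ} (a : Fin n → A) : ‖elemTensor A n a‖ ≤ ∏ i, ‖a i‖ :=
  (UniformSpace.Completion.norm_coe _).trans_le (PiTensorProduct.projectiveSeminorm_tprod_le a)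

lemma norm_forestOp_le {n : ℕ} (h : p + k = n) (v : Fin k → A) :
    ‖forestOp f h v‖ ≤ ∏ i, ‖v i‖ := by
  have h0 : 0 ≤ ∏ i, ‖v i‖ := Finset.prod_nonneg fun _ _ => norm_nonneg _
  refine (norm_liftTensor_le _).trans (ContinuousMultilinearMap.opNorm_le_bound h0 fun a => ?_)
  refine (norm_elemTensor_le _).trans ((Finset.prod_le_prod
    (g := fun j => (∏ r, ‖a (f.leafEquiv h ⟨j, r⟩)‖) * ∏ r, ‖v (f.level j r)‖)
    (fun _ _ => norm_nonneg _) fun j _ => norm_interleave_le 1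
      (fun r => a (f.leafEquiv h ⟨j, r⟩)) fun r => v (f.level j r)).trans_eq ?_)
  rw [Finset.prod_mul_distrib, mul_comm]
  congr 1
  · rw [← Fintype.prod_sigma' (fun j r => ‖v (f.level j r)‖)]
    exact Equiv.prod_comp (f.vertexEquiv.trans f.perm) fun i => ‖v i‖
  · rw [← Fintype.prod_sigma' (fun j r => ‖a (f.leafEquiv h ⟨j, r⟩)‖)]
    exact Equiv.prod_comp (f.leafEquiv h) fun i => ‖a i‖

/-- `forestOp`, as a bounded multilinear function of the inserted elements. -/
def forestOpL {n : ℕ} (h : p + k = n) : ContinuousMultilinearMap ℂ (fun _ : Fin k => A)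
    (TensorPow A (n + 1) →L[ℂ] TensorPow A (p + 1)) :=
  MultilinearMap.mkContinuous
    { toFun := forestOp f h
      map_update_add' := fun {inst} v l z z' => by
        rw [Subsingleton.elim inst (instDecidableEqFin k)]
        obtain ⟨j, r, rfl⟩ := exists_level_eq f l
        refine tensorPow_hom_ext fun a => ?_
        rw [add_apply]
        simp only [forestOp_elemTensor, interleave_level_update,
          ContinuousMultilinearMap.map_update_add]
      map_update_smul' := fun {inst} v l c z => by
        rw [Subsingleton.elim inst (instDecidableEqFin k)]
        obtain ⟨j, r, rfl⟩ := exists_level_eq f l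
        refine tensorPow_hom_ext fun a => ?_
        rw [smul_apply]
        simp only [forestOp_elemTensor, interleave_level_update,
          ContinuousMultilinearMap.map_update_smul] } 1
    (fun v => by simpa using norm_forestOp_le f h v)

lemma continuous_forestOp {n : ℕ} (h : p + k = n) : Continuous (forestOp (A := A) f h) :=
  (forestOpL f h).cont

/-- On elementary tensors both sides are the same product: the word on the faces of `τ`, with `v` on
the high levels and free inputs on the low ones. `interleave_forest` brackets it along the gaps,
which are the low faces. -/
lemma sharpFC_comp_forestOp {n : ℕ} (τ : Perm (Fin n)) (h : p + k = n) (v : Fin k → A) :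
    (sharpFC (lower τ (h ▸ Nat.le_add_right p k))).comp (forestOp (upper τ h) h v) =
      (contract τ h v).comp (sharpFC τ) := by
  subst h
  refine tensorPow_hom_ext fun a => ?_
  rw [ContinuousLinearMap.comp_apply, ContinuousLinearMap.comp_apply, forestOp_elemTensor,
    sharpFC_elemTensor, sharpFC_elemTensor]
  refine FC.toOp_ext fun y => ?_
  rw [contract_apply, FC.toOp_mk, FC.toOp_mk, sharpOp_apply, sharpOp_apply,
    interleave_eq_interleave_one τ, ← interleave_forest (upper τ rfl)]
  simp only [append_vertexFace_upper]
  rw [interleave_eq_interleave_one]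
  congr 1
  ext j
  have : τ ((upper τ rfl).gap j) = Fin.castAdd k (lower τ (Nat.le_add_right p k) j) :=
    Fin.ext (val_gap_upper τ j)
  rw [this, Fin.append_left]

/-- Composition with `sharpFC` on either side is bounded and linear in the other operator, hence
commutes with the integrals and reduces the claim to `sharpFC_comp_forestOp` under the integral
sign. -/
lemma sharpFC_iterInt_forestOp {V : ℝ → A} (hV : Continuous V) (s t : ℝ) {n : ℕ}
    (τ : Perm (Fin n)) (h : p + k = n) (x : TensorPow A (n + 1)) :
    sharpFC (lower τ (h ▸ Nat.le_add_right p k)) (iterInt V s k t (forestOp (upper τ h) h) x) =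
      sigTerm V s t τ h (sharpFC τ x) := by
  have h1 := map_iterInt hV s ((ContinuousLinearMap.compL ℂ (TensorPow A (n + 1))
    (TensorPow A (p + 1)) (FC (A := A) (lower τ (h ▸ Nat.le_add_right p k)))
    (sharpFC _)).restrictScalars ℝ) k t (continuous_forestOp (A := A) (upper τ h) h)
  have h2 := map_iterInt hV s (((ContinuousLinearMap.compL ℂ (TensorPow A (n + 1))
    (FC (A := A) τ) (FC (A := A) (lower τ (h ▸ Nat.le_add_right p k)))).flip
    (sharpFC τ)).restrictScalars ℝ) k t (continuous_contract (A := A) τ h)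
  have h3 : (fun v => ((ContinuousLinearMap.compL ℂ (TensorPow A (n + 1))
      (TensorPow A (p + 1)) (FC (A := A) (lower τ (h ▸ Nat.le_add_right p k)))
      (sharpFC _)).restrictScalars ℝ) (forestOp (upper τ h) h v)) =
      fun v => (((ContinuousLinearMap.compL ℂ (TensorPow A (n + 1))
        (FC (A := A) τ) (FC (A := A) (lower τ (h ▸ Nat.le_add_right p k)))).flip
        (sharpFC τ)).restrictScalars ℝ) (contract τ h v) :=
    funext fun v => sharpFC_comp_forestOp τ h v
  rw [h3, ← h2] at h1
  exact DFunLike.congr_fun h1 x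

lemma sharp_comp_barX {X : ℝ → A} (hX : ContDiffOn ℝ ∞ X (Set.Icc (0 : ℝ) 1)) {s t : ℝ}
    (hs : s ∈ Set.Icc (0 : ℝ) 1) (ht : t ∈ Set.Icc (0 : ℝ) 1) :
    sharp A ∘ₗ barX X s t = signature X s t ∘ₗ sharp A := by
  refine DirectSum.linearMap_ext ℂ fun τ => LinearMap.ext fun x => ?_
  obtain ⟨n, τ⟩ := τ
  simp only [LinearMap.comp_apply]
  rw [signature_eq_pathSig X hs ht, barX, DirectSum.toModule_lof, LinearMap.sum_apply, map_sum,
    sharp, DirectSum.lmap_lof]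
  refine Eq.trans ?_ (pathSig_incl (velocity X) s t τ (sharpFC τ x)).symm
  refine Finset.sum_congr rfl fun q _ => ?_
  rw [LinearMap.comp_apply, DirectSum.lmap_lof]
  congr 1
  rw [partialContraction, iteratedIntegral_eq_iterInt X hs _ ht]
  exact sharpFC_iterInt_forestOp (continuous_velocity hX) s t τ _ x

end ForestOperators

end NCSignature
end

theorem mainTheorem1 {A : Type*} [CStarAlgebra A] (X : ℝ → A)
    (hX : ContDiffOn ℝ ∞ X (Set.Icc (0 : ℝ) 1)) :
    (∀ s ∈ Set.Icc (0 : ℝ) 1, ∀ t ∈ Set.Icc (0 : ℝ) 1,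
      NCSignature.signature X s t ∈ NCSignature.groupG A) ∧
    (∀ s ∈ Set.Icc (0 : ℝ) 1, ∀ u ∈ Set.Icc (0 : ℝ) 1, ∀ t ∈ Set.Icc (0 : ℝ) 1,
      NCSignature.signature X s t =
        NCSignature.signature X u t ∘ₗ NCSignature.signature X s u) ∧
    (∀ s ∈ Set.Icc (0 : ℝ) 1, ∀ t ∈ Set.Icc (0 : ℝ) 1,
      NCSignature.sharp A ∘ₗ NCSignature.barX X s t =
        NCSignature.signature X s t ∘ₗ NCSignature.sharp A) ∧
    ((∀ t ∈ Set.Icc (0 : ℝ) 1, star (X t) = X t) →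
      ∀ s ∈ Set.Icc (0 : ℝ) 1, ∀ t ∈ Set.Icc (0 : ℝ) 1,
        NCSignature.IsStarAlgHom (NCSignature.signature X s t)) := by
  have hV := NCSignature.continuous_velocity hX
  refine ⟨fun s hs t ht => ?_, fun s hs u hu t ht => ?_, fun s hs t ht => ?_,
    fun hstar s hs t ht => ?_⟩
  · rw [NCSignature.signature_eq_pathSig X hs ht]
    exact NCSignature.pathSig_mem_groupG hV s t
  · rw [NCSignature.signature_eq_pathSig X hs ht, NCSignature.signature_eq_pathSig X hu ht,
      NCSignature.signature_eq_pathSig X hs hu]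
    exact NCSignature.pathSig_comp hV s u t
  · exact NCSignature.sharp_comp_barX hX hs ht
  · rw [NCSignature.signature_eq_pathSig X hs ht]
    exact NCSignature.isStarAlgHom_pathSig hV (NCSignature.star_velocity hstar) s t
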